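/- For $g\in\mathbb S^2$ and $\lambda>0$ consider the Vlasov-Stokes system on $\mathbb R^3\times\mathbb R^3$ $$\partial_t f+v\cdot\nabla_x f+\lambda\,\mathrm{div}_v\big((g+u-v)f\big)=0,\qquad -\Delta u+\nabla p=\int (v-u)\,f\,\mathrm dv,\quad \mathrm{div}\,u=0,\qquad f(0)=f^0. \tag{VS}$$ Write $M_k[h]=\int|v|^k\,\mathrm dh(x,v)$ and $\rho[h]=\int h\,\mathrm dv$, and let $\mathcal W_2$ be the ($[0,\infty]$-valued) $2$-Wasserstein distance on $\mathcal P(\mathbb R^3\times\mathbb R^3)$. For $K>9$ and $T>0$, a solution of (VS) on $[0,T]$ is a pair $(f,u)$ with $f\in L^\infty((0,T)\times\mathbb R^3\times\mathbb R^3)$, $f:[0,T]\to\mathcal P(\mathbb R^3\times\mathbb R^3)$ continuous for $\mathcal W_2$, $f(0)=f^0$, $\sup_{t\in(0,T)}M_K[f(t)]<\infty$, $u\in L^\infty(0,T;W^{1,\infty}(\mathbb R^3))\cap C((0,T)\times\mathbb R^3)$, such that the first equation holds in the sense of distributions on $(0,T)\times\mathbb R^3\times\mathbb R^3$ and, for almost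 every $t\in(0,T)$, $u(t)\in\dot H^1(\mathbb R^3)=\{w\in L^6:\nabla w\in L^2\}$ is a weak solution of the second equation. **Corollary 5.2.** For every $q\in(4,\infty]$ and every $M\in[0,\infty)$ there is a constant $C\in(0,\infty)$, depending only on $q$ and $M$, such that the following holds. Let $g\in\mathbb S^2$, $K>9$, $\lambda>0$, $T>0$. For $i=1,2$ let $f_i^0\in\mathcal P(\mathbb R^3\times\mathbb R^3)\cap L^\infty(\mathbb R^3\times\mathbb R^3)$ with $M_K[f_i^0]<\infty$, and let $(f_i,u_i)$ be a solution of (VS) on $[0,T]$ with initial datum $f_i^0$. If $$\sup_{t\in(0,T)}\Big(\|\rho[f_1(t)]\|_{L^q(\mathbb R^3)}+\|\rho[f_2(t)]\|_{L^q(\mathbb R^3)}+\|u_2(t)\|_{W^{1,\infty}(\mathbb R^3)}+M_9[f_2(t)]\Big)\le M,$$ then for all $t\in[0,T]$ $$\mathcal W_2(f_1(t),f_2(t))\le C\,\mathcal W_2(f_1^0,f_2^0)\,e^{Ct}.$$ In particular $C$ does not depend on $g$, $K$, $\lambda$ or $T$, except through $M$. -/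

import Mathlib

open MeasureTheory Set Filter Topology
open scoped ENNReal NNReal ContDiff

noncomputable section

namespace VlasovStokes

/-- The physical space `ℝ³` with its Euclidean structure. -/
abbrev E3 : Type := EuclideanSpace ℝ (Fin 3)

/-- The phase space `ℝ³ × ℝ³` of pairs (position, velocity). -/
abbrev Phase : Type := E3 × E3

/-- `γ` is a transport plan between `μ` and `ν`. -/
def IsTransportPlan (μ ν : Measure Phase) (γ : Measure (Phase × Phase)) : Prop :=
  γ.map Prod.fst = μ ∧ γ.map Prod.snd = ν

/-- The (possibly infinite) `2`-Wasserstein distance on `ℝ³ × ℝ³ = ℝ⁶` for the Euclidean distance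
`|(x₁, v₁) - (x₂, v₂)|² = |x₁ - x₂|² + |v₁ - v₂|²`. -/
def W2 (μ ν : Measure Phase) : ℝ≥0∞ :=
  (⨅ (γ : Measure (Phase × Phase)) (_ : IsTransportPlan μ ν γ),
    ∫⁻ z, (edist z.1.1 z.2.1 ^ 2 + edist z.1.2 z.2.2 ^ 2) ∂γ) ^ (1 / 2 : ℝ)

/-- The velocity moment `M_k[μ] = ∫ |v|^k dμ(x, v)`. -/
def moment (k : ℝ) (μ : Measure Phase) : ℝ≥0∞ :=
  ∫⁻ z, ‖z.2‖ₑ ^ k ∂μ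

/-- The spatial density `ρ[μ] = ∫ μ dv`, as a function on `ℝ³`: the Lebesgue density of the first
marginal of `μ` (which is absolutely continuous whenever `μ` is). -/
def spatialDensity (μ : Measure Phase) : E3 → ℝ≥0∞ :=
  (μ.map Prod.fst).rnDeriv volume

/-- The density of `μ` with respect to Lebesgue measure on `ℝ³ × ℝ³` is bounded by `M`. -/
def HasDensityLE (M : ℝ≥0) (μ : Measure Phase) : Prop :=
  μ ≤ M • (volume : Measure Phase)

/-- `G` is the weak (distributional) gradient of the vector field `u`. -/
def HasWeakGradient (u : E3 → E3) (G : E3 → E3 →L[ℝ] E3) : Prop :=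
  LocallyIntegrable u volume ∧ LocallyIntegrable G volume ∧
    ∀ φ : E3 → ℝ, ContDiff ℝ ∞ φ → HasCompactSupport φ → ∀ e : E3,
      ∫ x, φ x • G x e = - ∫ x, fderiv ℝ φ x e • u x

/-- The norm `‖u‖_{W^{1,∞}} = ‖u‖_∞ + ‖∇u‖_∞`, equal to `∞` if `u` has no weak gradient (the weak
gradient is unique up to null sets, so the infimum runs over a single value). -/
def W1inftyNorm (u : E3 → E3) : ℝ≥0∞ :=
  ⨅ (G : E3 → E3 →L[ℝ] E3) (_ : HasWeakGradient u G),
    eLpNorm u ∞ volume + eLpNorm G ∞ volume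

/-- The divergence (trace) of a gradient matrix. -/
def tr (A : E3 →L[ℝ] E3) : ℝ :=
  ∑ i : Fin 3, A (EuclideanSpace.single i 1) i

/-- The Frobenius product `A : B` of two gradient matrices. -/
def frob (A B : E3 →L[ℝ] E3) : ℝ :=
  ∑ i : Fin 3, inner ℝ (A (EuclideanSpace.single i 1)) (B (EuclideanSpace.single i 1))

/-- `u ∈ Ḣ¹(ℝ³)` (that is, `u ∈ L⁶` and `∇u ∈ L²`) is the weak solution of
`-Δu + ∇p = ∫ (v - u) dμ(·, v)`, `div u = 0` in `ℝ³`; the pressure is eliminated by testing with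
divergence-free fields. -/
def IsWeakBrinkmanSolution (μ : Measure Phase) (u : E3 → E3) : Prop :=
  ∃ G : E3 → E3 →L[ℝ] E3, HasWeakGradient u G ∧
    MemLp u 6 volume ∧ MemLp G 2 volume ∧
    (∀ᵐ x, tr (G x) = 0) ∧
    ∀ φ : E3 → E3, ContDiff ℝ ∞ φ → HasCompactSupport φ → (∀ x, tr (fderiv ℝ φ x) = 0) →
      ∫ x, frob (G x) (fderiv ℝ φ x) = ∫ z, inner ℝ (z.2 - u z.1) (φ z.1) ∂μ

/-- `f` satisfies `∂ₜ f + v · ∇ₓ f + λ div_v ((g + u - v) f) = 0` in the sense of distributions on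
`(0, T) × ℝ³ × ℝ³`. The derivative of the test function `φ` at `(t, x, v)` in the direction
`(1, v, λ (g + u - v))` is `∂ₜφ + v · ∇ₓφ + λ (g + u - v) · ∇_v φ`. -/
def IsDistributionalVlasovSolution (g : E3) (lam T : ℝ) (f : ℝ → Measure Phase)
    (u : ℝ → E3 → E3) : Prop :=
  ∀ φ : ℝ × Phase → ℝ, ContDiff ℝ ∞ φ → HasCompactSupport φ →
    tsupport φ ⊆ Ioo 0 T ×ˢ (univ : Set Phase) →
      ∫ t in Ioo 0 T, (∫ z, fderiv ℝ φ (t, z) (1, z.2, lam • (g + u t z.1 - z.2)) ∂(f t)) = 0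

/-- `(f, u)` is a weak solution of the Vlasov-Stokes equation on `[0, T]` with initial datum `f0`,
in the class `f ∈ L^∞((0,T) × ℝ³ × ℝ³) ∩ C([0,T]; (𝒫, W₂))`,
`u ∈ L^∞(0,T; W^{1,∞}) ∩ C((0,T) × ℝ³)`, `sup_{(0,T)} M_K[f(t)] < ∞`. -/
structure IsSolution (g : E3) (lam T K : ℝ) (f0 : Measure Phase) (f : ℝ → Measure Phase)
    (u : ℝ → E3 → E3) : Prop where
  prob : ∀ t ∈ Icc 0 T, IsProbabilityMeasure (f t)
  continuous_f : ∀ t ∈ Icc 0 T, Tendsto (fun s => W2 (f s) (f t)) (𝓝[Icc 0 T] t) (𝓝 0)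
  bounded_f : ∃ M : ℝ≥0, ∀ᵐ t ∂(volume.restrict (Ioo 0 T)), HasDensityLE M (f t)
  moment_f : ∃ M : ℝ≥0, ∀ t ∈ Ioo 0 T, moment K (f t) ≤ M
  continuous_u : ContinuousOn (fun p : ℝ × E3 => u p.1 p.2) (Ioo 0 T ×ˢ (univ : Set E3))
  bounded_u : ∃ M : ℝ≥0, ∀ᵐ t ∂(volume.restrict (Ioo 0 T)), W1inftyNorm (u t) ≤ M
  vlasov : IsDistributionalVlasovSolution g lam T f u
  brinkman : ∀ᵐ t ∂(volume.restrict (Ioo 0 T)), IsWeakBrinkmanSolution (f t) (u t)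
  initial : f 0 = f0

end VlasovStokes

end

noncomputable section

namespace VlasovStokes

/-! The two solutions are coupled along characteristics. A nearly optimal plan between `f₁ s` and
`f₂ s` is pushed forward by the two flows. The differences `x` of positions, `v` of velocities and
`U = u₁(X₁) - u₂(X₂)` then satisfy `x' = v` and `v' = lam (U - v)`. By Duhamel, `v` is a decaying
multiple of its initial value plus an integral of `U` against a kernel of mass at most one, whatever
`lam` is. Hence an estimate `‖U‖ ≤ θ ‖v‖ + C ‖x‖` in `L²` of the plan, with `θ < 1`, closes an
exponential bound uniform in `lam` (`l2norm_add_l2norm_le_exp`).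

That `θ < 1` is due to the friction term `-u` in the fluid equation. A constant multiple of `uᵢ` is
the Stokeslet convolution of the force `Vᵢ - uᵢ(Xᵢ)`, so `U = p + r`. Here `p` is the Stokes
operator for particles at `X₁` applied to `v - U`, and `r` is the effect of moving the particles
from `X₁` to `X₂`. The Stokes operator is symmetric, of positive type, and bounded on `L²` by
Schur's test, so `‖p‖² ≤ τ ⟨p, v - U⟩`. Absorbing `-⟨p, U⟩` gives `‖U‖ ≤ τ/(1+τ) ‖v‖ + 2 ‖r‖`
(`norm_le_of_sq_norm_le_inner`). The remainder `r` is bounded by `‖x‖` because `u₂` is Lipschitz and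
differences of the Stokeslet are controlled by `|z|⁻²`. Cauchy-Schwarz splits this kernel into the
powers `9/4` and `7/4`. The potential of `|z|^(-9/4)` is bounded since `q > 4` gives `(9/4) q' < 3`
(`exists_potential_bound`), and the ninth moment of `f₂` pays for the other factor
(`l2norm_velocity_difference_le`).

Kernel computations use the regularized Stokeslet, the double curl of `-√(|z|² + ε²) e`. It is a
positive superposition of double curls of Gaussians, whence its positive type
(`integral_inner_stokeslet_nonneg`). Testing the weak equation with a truncation of it shows that
its convolution with the force is a mollification of `u`
(`IsWeakBrinkmanSolution.integral_bump_inner`), and `ε → 0` recovers `u`.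

To use characteristics, the distributional solutions must be carried by the flow (`IsFlow.eq_map`).
This is done on compact subintervals of `(0, T)`, and `W2`-continuity extends the bound to both
endpoints (`W2_le_of_forall_interior`). -/

/-- The regularized distance `√(|z|² + ε²)`. -/
def regNorm (ε : ℝ) (z : E3) : ℝ := Real.sqrt (‖z‖ ^ 2 + ε ^ 2)

/-- The regularized Stokeslet (up to a constant factor). -/
def stokeslet (ε : ℝ) (z h : E3) : E3 :=
  ((regNorm ε z)⁻¹ + ε ^ 2 * (regNorm ε z)⁻¹ ^ 3) • h + (inner ℝ z h * (regNorm ε z)⁻¹ ^ 3) • z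

/-- The double curl of a Gaussian. -/
def gaussKernel (t : ℝ) (z h k : E3) : ℝ :=
  (4 * t * inner ℝ h k - 4 * t ^ 2 * (‖z‖ ^ 2 * inner ℝ h k - inner ℝ z h * inner ℝ z k)) *
    Real.exp (-t * ‖z‖ ^ 2)

lemma regNorm_sq (ε : ℝ) (z : E3) : regNorm ε z ^ 2 = ‖z‖ ^ 2 + ε ^ 2 :=
  Real.sq_sqrt (by positivity)

lemma regNorm_pos {ε : ℝ} (hε : 0 < ε) (z : E3) : 0 < regNorm ε z :=
  Real.sqrt_pos.2 (by positivity)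

lemma norm_le_regNorm (ε : ℝ) (z : E3) : ‖z‖ ≤ regNorm ε z :=
  Real.le_sqrt_of_sq_le (by nlinarith [sq_nonneg ε])

lemma le_regNorm {ε : ℝ} (z : E3) : ε ≤ regNorm ε z :=
  Real.le_sqrt_of_sq_le (by nlinarith [sq_nonneg ‖z‖])

lemma continuous_regNorm (ε : ℝ) : Continuous (regNorm ε) := by
  unfold regNorm; fun_prop

lemma continuous_stokeslet {ε : ℝ} (hε : 0 < ε) :
    Continuous (fun p : E3 × E3 => stokeslet ε p.1 p.2) := by
  have h : Continuous (fun p : E3 × E3 => (regNorm ε p.1)⁻¹) :=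
    ((continuous_regNorm ε).comp continuous_fst).inv₀ fun p => (regNorm_pos hε p.1).ne'
  unfold stokeslet
  fun_prop

/-! ### Positive type of the regularized Stokeslet, through Gaussians. -/

section Psd

variable {Ω : Type*} [MeasurableSpace Ω] {γ : Measure Ω} [IsFiniteMeasure γ]

/-- With `Aᵢⱼ = ∫ aᵢ kⱼ` the double integral factorizes into `∑ (Aᵢⱼ² - Aᵢⱼ Aⱼᵢ) = ½ ∑ (Aᵢⱼ -
Aⱼᵢ)²`, the squared length of the vector `∫ a × k`. -/
lemma integral_curl_form_nonneg {a k : Ω → E3}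
    (hak : ∀ i j, Integrable (fun o => a o i * k o j) γ) :
    0 ≤ ∫ p : Ω × Ω, (inner ℝ (a p.1) (a p.2) * inner ℝ (k p.1) (k p.2)
      - inner ℝ (a p.1) (k p.2) * inner ℝ (a p.2) (k p.1)) ∂(γ.prod γ) := by
  set A : Fin 3 → Fin 3 → Ω → ℝ := fun i j o => a o i * k o j with hA
  have hint : ∀ i j i' j', Integrable (fun p : Ω × Ω => A i j p.1 * A i' j' p.2) (γ.prod γ) :=
    fun i j i' j' => (hak i j).mul_prod (hak i' j')
  have hval : ∀ i j i' j', ∫ p : Ω × Ω, A i j p.1 * A i' j' p.2 ∂(γ.prod γ)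
      = (∫ o, A i j o ∂γ) * ∫ o, A i' j' o ∂γ := fun i j i' j' => integral_prod_mul _ _
  have heq : (fun p : Ω × Ω => inner ℝ (a p.1) (a p.2) * inner ℝ (k p.1) (k p.2)
      - inner ℝ (a p.1) (k p.2) * inner ℝ (a p.2) (k p.1)) = fun p : Ω × Ω =>
      ∑ i, ∑ j, (A i j p.1 * A i j p.2 - A i j p.1 * A j i p.2) := by
    funext p
    simp only [hA, PiLp.inner_apply, Fin.sum_univ_three, RCLike.inner_apply, conj_trivial]
    ring
  have hdiff : ∀ i j, Integrable (fun p : Ω × Ω => A i j p.1 * A i j p.2 - A i j p.1 * A j i p.2)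
      (γ.prod γ) := fun i j => (hint i j i j).sub (hint i j j i)
  rw [heq, integral_finsetSum _ fun i _ => integrable_finsetSum _ fun j _ => hdiff i j]
  have h2 : ∀ i, ∫ p : Ω × Ω, ∑ j, (A i j p.1 * A i j p.2 - A i j p.1 * A j i p.2) ∂(γ.prod γ)
      = ∑ j, ((∫ o, A i j o ∂γ) * (∫ o, A i j o ∂γ) - (∫ o, A i j o ∂γ) * ∫ o, A j i o ∂γ) := by
    intro i
    rw [integral_finsetSum _ fun j _ => hdiff i j]
    refine Finset.sum_congr rfl fun j _ => ?_
    rw [integral_sub (hint i j i j) (hint i j j i), hval, hval]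
  rw [Finset.sum_congr rfl fun i _ => h2 i]
  simp only [Fin.sum_univ_three]
  nlinarith [sq_nonneg ((∫ o, A 0 1 o ∂γ) - ∫ o, A 1 0 o ∂γ),
    sq_nonneg ((∫ o, A 0 2 o ∂γ) - ∫ o, A 2 0 o ∂γ),
    sq_nonneg ((∫ o, A 1 2 o ∂γ) - ∫ o, A 2 1 o ∂γ)]

lemma integrable_gauss {b : ℝ} (hb : 0 < b) :
    Integrable (fun σ : E3 => Real.exp (-b * ‖σ‖ ^ 2)) := by
  have h := GaussianFourier.integrable_cexp_neg_mul_sq_norm_add (V := E3) (b := (b : ℂ))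
    (by simpa using hb) 0 0
  have h2 := h.re
  refine h2.congr (Eventually.of_forall fun σ => ?_)
  have : (-(b : ℂ) * (‖σ‖ : ℂ) ^ 2 + 0 * ((inner ℝ (0 : E3) σ : ℝ) : ℂ))
      = ((-b * ‖σ‖ ^ 2 : ℝ) : ℂ) := by push_cast; ring
  beta_reduce
  rw [this, ← Complex.ofReal_exp]
  exact Complex.ofReal_re _

lemma sq_mul_gauss_le {b : ℝ} (hb : 0 < b) (r : ℝ) :
    r ^ 2 * Real.exp (-b * r ^ 2) ≤ (2 / b) * Real.exp (-(b / 2) * r ^ 2) := by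
  have h1 : (b / 2) * r ^ 2 ≤ Real.exp ((b / 2) * r ^ 2) := by
    linarith [Real.add_one_le_exp ((b / 2) * r ^ 2)]
  have h2 : Real.exp (-b * r ^ 2)
      = Real.exp (-(b / 2) * r ^ 2) * (Real.exp ((b / 2) * r ^ 2))⁻¹ := by
    rw [← Real.exp_neg, ← Real.exp_add]; ring_nf
  rw [h2]
  have h3 : r ^ 2 * (Real.exp ((b / 2) * r ^ 2))⁻¹ ≤ 2 / b := by
    rw [← div_eq_mul_inv, div_le_div_iff₀ (Real.exp_pos _) hb]
    linarith
  nlinarith [Real.exp_pos (-(b / 2) * r ^ 2)]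

lemma integrable_sq_mul_gauss {b : ℝ} (hb : 0 < b) :
    Integrable (fun σ : E3 => ‖σ‖ ^ 2 * Real.exp (-b * ‖σ‖ ^ 2)) := by
  refine ((integrable_gauss (half_pos hb)).const_mul (2 / b)).mono' (by fun_prop)
    (Eventually.of_forall fun σ => ?_)
  rw [Real.norm_of_nonneg (by positivity)]
  exact sq_mul_gauss_le hb ‖σ‖

lemma integrable_inner_mul_inner_mul_gauss {b : ℝ} (hb : 0 < b) (h k : E3) :
    Integrable (fun σ : E3 => inner ℝ σ h * inner ℝ σ k * Real.exp (-b * ‖σ‖ ^ 2)) := by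
  refine ((integrable_sq_mul_gauss hb).const_mul (‖h‖ * ‖k‖)).mono' (by fun_prop)
    (Eventually.of_forall fun σ => ?_)
  rw [norm_mul, norm_mul, Real.norm_of_nonneg (Real.exp_pos _).le]
  have h1 := norm_inner_le_norm (𝕜 := ℝ) σ h
  have h2 := norm_inner_le_norm (𝕜 := ℝ) σ k
  calc _ ≤ (‖σ‖ * ‖h‖) * (‖σ‖ * ‖k‖) * Real.exp (-b * ‖σ‖ ^ 2) := by gcongr
    _ = _ := by ring

lemma integrable_inner_mul_gauss {b : ℝ} (hb : 0 < b) (h : E3) :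
    Integrable (fun σ : E3 => inner ℝ σ h * Real.exp (-b * ‖σ‖ ^ 2)) := by
  refine (((integrable_gauss hb).add (integrable_sq_mul_gauss hb)).const_mul ‖h‖).mono'
    (by fun_prop) (Eventually.of_forall fun σ => ?_)
  rw [norm_mul, Real.norm_of_nonneg (Real.exp_pos _).le]
  have h1 := norm_inner_le_norm (𝕜 := ℝ) σ h
  have h2 : ‖σ‖ ≤ 1 + ‖σ‖ ^ 2 := by nlinarith [sq_nonneg (‖σ‖ - 1)]
  calc _ ≤ ((1 + ‖σ‖ ^ 2) * ‖h‖) * Real.exp (-b * ‖σ‖ ^ 2) := by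
        gcongr; exact h1.trans (by gcongr)
    _ = _ := by simp only [Pi.add_apply]; ring

lemma integral_inner_mul_gauss (b : ℝ) (h : E3) :
    ∫ σ : E3, inner ℝ σ h * Real.exp (-b * ‖σ‖ ^ 2) = 0 := by
  have := integral_neg_eq_self (fun σ : E3 => inner ℝ σ h * Real.exp (-b * ‖σ‖ ^ 2)) volume
  simp only [norm_neg, inner_neg_left, neg_mul] at this
  rw [integral_neg] at this
  simp only [neg_mul]
  linarith

/-- Integration by parts: the derivative of the Gaussian in direction `k` produces the factor `-2b
⟨σ, k⟩`. -/
lemma integral_inner_mul_inner_mul_gauss {b : ℝ} (hb : 0 < b) (h k : E3) :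
    ∫ σ : E3, inner ℝ σ h * inner ℝ σ k * Real.exp (-b * ‖σ‖ ^ 2)
      = inner ℝ h k / (2 * b) * ∫ σ : E3, Real.exp (-b * ‖σ‖ ^ 2) := by
  have hf : ∀ σ : E3, HasFDerivAt (fun σ : E3 => (inner ℝ σ h : ℝ)) (innerSL ℝ h) σ := by
    intro σ
    have : (fun σ : E3 => (inner ℝ σ h : ℝ)) = innerSL ℝ h := by
      funext σ; simp [real_inner_comm]
    rw [this]; exact (innerSL ℝ h).hasFDerivAt
  have hg : ∀ σ : E3, HasFDerivAt (fun σ : E3 => Real.exp (-b * ‖σ‖ ^ 2))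
      (Real.exp (-b * ‖σ‖ ^ 2) • (-b) • ((2 : ℝ) • innerSL ℝ σ)) σ := by
    intro σ
    have := ((hasStrictFDerivAt_norm_sq (F := E3) σ).hasFDerivAt.const_mul (-b)).exp
    simpa [ofNat_smul_eq_nsmul] using this
  have key := integral_mul_fderiv_eq_neg_fderiv_mul_of_integrable (μ := (volume : Measure E3))
    (𝕜 := ℝ) (v := k) (f := fun σ : E3 => (inner ℝ σ h : ℝ))
    (g := fun σ : E3 => Real.exp (-b * ‖σ‖ ^ 2)) ?_ ?_ (integrable_inner_mul_gauss hb h)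
    (fun x _ => (hf x).differentiableAt) (fun x _ => (hg x).differentiableAt)
  · simp only [fun σ => (hf σ).fderiv, fun σ => (hg σ).fderiv] at key
    have e1 : (fun σ : E3 => (inner ℝ σ h : ℝ) *
        (Real.exp (-b * ‖σ‖ ^ 2) • (-b) • ((2 : ℝ) • innerSL ℝ σ)) k)
        = fun σ => (-(2 * b)) * (inner ℝ σ h * inner ℝ σ k * Real.exp (-b * ‖σ‖ ^ 2)) := by
      funext σ; simp; ring
    have e2 : (fun σ : E3 => ((innerSL ℝ h) k : ℝ) * Real.exp (-b * ‖σ‖ ^ 2))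
        = fun σ => inner ℝ h k * Real.exp (-b * ‖σ‖ ^ 2) := by
      funext σ; simp
    rw [e1, e2, integral_const_mul, integral_const_mul] at key
    field_simp
    field_simp at key
    linarith
  · simp only [fun σ => (hf σ).fderiv]
    exact (integrable_gauss hb).const_mul _
  · simp only [fun σ => (hg σ).fderiv]
    refine ((integrable_inner_mul_inner_mul_gauss hb h k).const_mul (-(2 * b))).congr
      (Eventually.of_forall fun σ => ?_)
    simp; ring

lemma integral_gauss_pos {b : ℝ} (hb : 0 < b) : 0 < ∫ σ : E3, Real.exp (-b * ‖σ‖ ^ 2) := by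
  rw [GaussianFourier.integral_rexp_neg_mul_sq_norm hb]
  positivity

end Psd

section Psd

variable {Ω : Type*} [MeasurableSpace Ω] {γ : Measure Ω} [IsFiniteMeasure γ]

lemma integrable_mul_translate {X : Type*} [MeasurableSpace X] {μ : Measure X} [SFinite μ]
    {F : E3 → ℝ} (hFc : Continuous F) (hF : Integrable F) {Y : X → E3} (hY : Measurable Y)
    {φ : X → ℝ} (hφ : Integrable φ μ) :
    Integrable (fun p : X × E3 => φ p.1 * F (Y p.1 - p.2)) (μ.prod volume) := by
  have hm : AEStronglyMeasurable (fun p : X × E3 => φ p.1 * F (Y p.1 - p.2)) (μ.prod volume) := by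
    refine (hφ.aestronglyMeasurable.comp_fst).mul ?_
    exact (hFc.measurable.comp
      ((hY.comp measurable_fst).sub measurable_snd)).aestronglyMeasurable
  rw [integrable_prod_iff hm]
  refine ⟨Eventually.of_forall fun x => (hF.comp_sub_left (Y x)).const_mul (φ x), ?_⟩
  refine (hφ.norm.mul_const (∫ s, ‖F s‖)).congr (Eventually.of_forall fun x => ?_)
  simp only [norm_mul]
  rw [integral_const_mul, integral_sub_left_eq_self (fun s => ‖F s‖) volume (Y x)]

/-- The vector Gaussian `(x - s) exp (-2 t |x - s|²)`. -/
def gaussFeature (t : ℝ) (x s : E3) : E3 := Real.exp (-(2 * t) * ‖x - s‖ ^ 2) • (x - s)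

/-- This writes `gaussKernel` as a superposition over `s` of the forms in
`integral_curl_form_nonneg`. Centred at the midpoint of `x` and `y`, the product of the two
Gaussians is `exp (-t|x-y|²)` times a Gaussian in `σ`, and only moments of order at most two remain.
-/
lemma integral_gaussFeature {t : ℝ} (ht : 0 < t) (x y h k : E3) :
    ∫ s : E3, (inner ℝ (gaussFeature t x s) (gaussFeature t y s) * inner ℝ h k
      - inner ℝ (gaussFeature t x s) k * inner ℝ (gaussFeature t y s) h)
      = (∫ σ : E3, Real.exp (-(4 * t) * ‖σ‖ ^ 2)) / (16 * t ^ 2) * gaussKernel t (x - y) h k := by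
  have h4 : 0 < 4 * t := by linarith
  set d : E3 := (1 / 2 : ℝ) • (x - y) with hd
  set G : E3 → ℝ := fun σ => Real.exp (-(4 * t) * ‖σ‖ ^ 2) with hG
  rw [← integral_add_right_eq_self _ ((1 / 2 : ℝ) • (x + y))]
  have hx : ∀ σ : E3, x - (σ + (1 / 2 : ℝ) • (x + y)) = d - σ := by
    intro σ; rw [hd]; module
  have hy : ∀ σ : E3, y - (σ + (1 / 2 : ℝ) • (x + y)) = -d - σ := by
    intro σ; rw [hd]; module
  have hn : ∀ σ : E3, Real.exp (-(2 * t) * ‖d - σ‖ ^ 2) * Real.exp (-(2 * t) * ‖-d - σ‖ ^ 2)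
      = Real.exp (-t * ‖x - y‖ ^ 2) * G σ := by
    intro σ
    have e0 : x - y = (2 : ℝ) • d := by rw [hd]; module
    have e1 : ‖d - σ‖ ^ 2 = ‖d‖ ^ 2 - 2 * inner ℝ d σ + ‖σ‖ ^ 2 := norm_sub_sq_real d σ
    have e2 : ‖-d - σ‖ ^ 2 = ‖d‖ ^ 2 + 2 * inner ℝ d σ + ‖σ‖ ^ 2 := by
      rw [← norm_neg, show -(-d - σ) = d + σ by abel]; exact norm_add_sq_real d σ
    have e3 : ‖x - y‖ ^ 2 = 4 * ‖d‖ ^ 2 := by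
      rw [e0, norm_smul, mul_pow]; norm_num
    rw [hG, ← Real.exp_add, ← Real.exp_add, e1, e2, e3]
    ring_nf
  have hint : ∀ σ : E3, (inner ℝ (gaussFeature t x (σ + (1 / 2 : ℝ) • (x + y)))
        (gaussFeature t y (σ + (1 / 2 : ℝ) • (x + y))) * inner ℝ h k
      - inner ℝ (gaussFeature t x (σ + (1 / 2 : ℝ) • (x + y))) k *
        inner ℝ (gaussFeature t y (σ + (1 / 2 : ℝ) • (x + y))) h)
      = Real.exp (-t * ‖x - y‖ ^ 2) * (
        (inner ℝ d k * inner ℝ d h - ‖d‖ ^ 2 * inner ℝ h k) * G σ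
        + inner ℝ h k * (‖σ‖ ^ 2 * G σ)
        + inner ℝ d k * (inner ℝ σ h * G σ) - inner ℝ d h * (inner ℝ σ k * G σ)
        - inner ℝ σ k * inner ℝ σ h * G σ) := by
    intro σ
    unfold gaussFeature
    rw [hx, hy]
    simp only [inner_smul_left, inner_smul_right, conj_trivial, inner_sub_left, inner_sub_right,
      inner_neg_left, inner_neg_right, real_inner_self_eq_norm_sq]
    rw [real_inner_comm σ d]
    linear_combination ((‖σ‖ ^ 2 - ‖d‖ ^ 2) * inner ℝ h k
        + (inner ℝ d k - inner ℝ σ k) * (inner ℝ d h + inner ℝ σ h)) * hn σ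
  have hnsq : ∀ σ : E3, ‖σ‖ ^ 2 * G σ = ∑ i, inner ℝ σ (EuclideanSpace.single i (1 : ℝ)) *
      inner ℝ σ (EuclideanSpace.single i (1 : ℝ)) * G σ := by
    intro σ
    rw [EuclideanSpace.norm_sq_eq, Finset.sum_mul]
    refine Finset.sum_congr rfl fun i _ => ?_
    simp [EuclideanSpace.inner_single_right, pow_two]
  have hI2 : ∫ σ : E3, ‖σ‖ ^ 2 * G σ = 3 / (2 * (4 * t)) * ∫ σ, G σ := by
    simp only [hnsq]
    rw [integral_finsetSum _ fun i _ => integrable_inner_mul_inner_mul_gauss h4 _ _]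
    simp only [hG, integral_inner_mul_inner_mul_gauss h4]
    simp
    ring
  have i0 : Integrable G := integrable_gauss h4
  have i2 : Integrable fun σ : E3 => ‖σ‖ ^ 2 * G σ := integrable_sq_mul_gauss h4
  have ih : Integrable fun σ : E3 => inner ℝ σ h * G σ := integrable_inner_mul_gauss h4 h
  have ik : Integrable fun σ : E3 => inner ℝ σ k * G σ := integrable_inner_mul_gauss h4 k
  have ikh : Integrable fun σ : E3 => inner ℝ σ k * inner ℝ σ h * G σ :=
    integrable_inner_mul_inner_mul_gauss h4 k h
  simp only [hint]
  rw [integral_const_mul, integral_sub, integral_sub, integral_add, integral_add,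
    integral_const_mul, integral_const_mul, integral_const_mul, integral_const_mul, hI2,
    show ∫ σ : E3, inner ℝ σ k * G σ = 0 from integral_inner_mul_gauss _ k,
    show ∫ σ : E3, inner ℝ σ h * G σ = 0 from integral_inner_mul_gauss _ h,
    show ∫ σ : E3, inner ℝ σ k * inner ℝ σ h * G σ
      = inner ℝ k h / (2 * (4 * t)) * ∫ σ : E3, G σ from
      integral_inner_mul_inner_mul_gauss h4 k h]
  · unfold gaussKernel
    have e0 : x - y = (2 : ℝ) • d := by rw [hd]; module
    have e3 : ‖x - y‖ ^ 2 = 4 * ‖d‖ ^ 2 := by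
      rw [e0, norm_smul, mul_pow]; norm_num
    have e4 : (inner ℝ (x - y) h : ℝ) = 2 * inner ℝ d h := by rw [e0, inner_smul_left]; simp
    have e5 : (inner ℝ (x - y) k : ℝ) = 2 * inner ℝ d k := by rw [e0, inner_smul_left]; simp
    rw [e3, e4, e5, real_inner_comm k h]
    field_simp
    ring
  all_goals first
    | exact i0.const_mul _
    | exact i2.const_mul _
    | exact ih.const_mul _
    | exact ik.const_mul _
    | exact ikh
    | exact (i0.const_mul _).add (i2.const_mul _)
    | exact ((i0.const_mul _).add (i2.const_mul _)).add (ih.const_mul _)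
    | exact (((i0.const_mul _).add (i2.const_mul _)).add (ih.const_mul _)).sub (ik.const_mul _)

lemma norm_gaussFeature_le {t : ℝ} (ht : 0 < t) (x s : E3) :
    ‖gaussFeature t x s‖ ≤ (1 + 1 / t) * Real.exp (-t * ‖x - s‖ ^ 2) := by
  unfold gaussFeature
  rw [norm_smul, Real.norm_of_nonneg (Real.exp_pos _).le]
  have h1 := sq_mul_gauss_le (b := 2 * t) (by linarith) ‖x - s‖
  have h2 : ‖x - s‖ ≤ 1 + ‖x - s‖ ^ 2 := by nlinarith [sq_nonneg (‖x - s‖ - 1)]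
  have h3 : Real.exp (-(2 * t) * ‖x - s‖ ^ 2) ≤ Real.exp (-t * ‖x - s‖ ^ 2) := by
    apply Real.exp_le_exp.2
    nlinarith [sq_nonneg ‖x - s‖]
  have h4 : (2 : ℝ) / (2 * t) = 1 / t := by field_simp
  have h5 : -(2 * t / 2) * ‖x - s‖ ^ 2 = -t * ‖x - s‖ ^ 2 := by ring
  rw [h4, h5] at h1
  nlinarith [Real.exp_pos (-(2 * t) * ‖x - s‖ ^ 2)]

lemma continuous_gaussFeature (t : ℝ) : Continuous fun p : E3 × E3 => gaussFeature t p.1 p.2 := by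
  unfold gaussFeature; fun_prop

/-- The kernel `gaussKernel` is of positive type. -/
lemma integral_gaussKernel_nonneg {t : ℝ} (ht : 0 < t) {Y k : Ω → E3} (hY : Measurable Y)
    (hk : Integrable k γ) :
    0 ≤ ∫ p : Ω × Ω, gaussKernel t (Y p.1 - Y p.2) (k p.1) (k p.2) ∂(γ.prod γ) := by
  set Z := (∫ σ : E3, Real.exp (-(4 * t) * ‖σ‖ ^ 2)) / (16 * t ^ 2) with hZdef
  have hZ : 0 < Z := div_pos (integral_gauss_pos (by linarith)) (by positivity)
  set Ψ : Ω × Ω → E3 → ℝ := fun p s =>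
    inner ℝ (gaussFeature t (Y p.1) s) (gaussFeature t (Y p.2) s) * inner ℝ (k p.1) (k p.2)
      - inner ℝ (gaussFeature t (Y p.1) s) (k p.2) * inner ℝ (gaussFeature t (Y p.2) s) (k p.1)
    with hΨ
  have hΨint : Integrable (Function.uncurry Ψ) ((γ.prod γ).prod volume) := by
    have hb := integrable_mul_translate (μ := γ.prod γ) (F := fun z : E3 => Real.exp (-t * ‖z‖ ^ 2))
      (by fun_prop) (integrable_gauss ht) (hY.comp measurable_fst)
      ((hk.norm.mul_prod hk.norm).const_mul (2 * (1 + 1 / t) ^ 2))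
    refine hb.mono' ?_ (Eventually.of_forall ?_)
    · have m1 : AEStronglyMeasurable (fun q : (Ω × Ω) × E3 => gaussFeature t (Y q.1.1) q.2)
          ((γ.prod γ).prod volume) :=
        ((continuous_gaussFeature t).measurable.comp
          ((hY.comp (measurable_fst.comp measurable_fst)).prodMk measurable_snd)).aestronglyMeasurable
      have m2 : AEStronglyMeasurable (fun q : (Ω × Ω) × E3 => gaussFeature t (Y q.1.2) q.2)
          ((γ.prod γ).prod volume) :=
        ((continuous_gaussFeature t).measurable.comp
          ((hY.comp (measurable_snd.comp measurable_fst)).prodMk measurable_snd)).aestronglyMeasurable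
      have k1 : AEStronglyMeasurable (fun q : (Ω × Ω) × E3 => k q.1.1)
          ((γ.prod γ).prod (volume : Measure E3)) := hk.aestronglyMeasurable.comp_fst.comp_fst
      have k2 : AEStronglyMeasurable (fun q : (Ω × Ω) × E3 => k q.1.2)
          ((γ.prod γ).prod (volume : Measure E3)) := hk.aestronglyMeasurable.comp_snd.comp_fst
      exact ((m1.inner m2).mul (k1.inner k2)).sub ((m1.inner k2).mul (m2.inner k1))
    · rintro ⟨p, s⟩
      simp only [Function.uncurry, hΨ, Function.comp]
      set A := gaussFeature t (Y p.1) s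
      set B := gaussFeature t (Y p.2) s
      have hA : ‖A‖ ≤ (1 + 1 / t) * Real.exp (-t * ‖Y p.1 - s‖ ^ 2) := norm_gaussFeature_le ht _ _
      have hB : ‖B‖ ≤ (1 + 1 / t) := (norm_gaussFeature_le ht _ _).trans (by
        refine mul_le_of_le_one_right (by positivity) (Real.exp_le_one_iff.2 ?_)
        nlinarith [sq_nonneg ‖Y p.2 - s‖])
      have e1 : ‖(inner ℝ A B * inner ℝ (k p.1) (k p.2) : ℝ)‖
          ≤ (‖A‖ * ‖B‖) * (‖k p.1‖ * ‖k p.2‖) := by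
        rw [norm_mul]; gcongr <;> exact norm_inner_le_norm _ _
      have e2 : ‖(inner ℝ A (k p.2) * inner ℝ B (k p.1) : ℝ)‖
          ≤ (‖A‖ * ‖k p.2‖) * (‖B‖ * ‖k p.1‖) := by
        rw [norm_mul]; gcongr <;> exact norm_inner_le_norm _ _
      calc _ ≤ (‖A‖ * ‖B‖) * (‖k p.1‖ * ‖k p.2‖) + (‖A‖ * ‖k p.2‖) * (‖B‖ * ‖k p.1‖) :=
            (norm_sub_le _ _).trans (add_le_add e1 e2)
        _ = 2 * (‖A‖ * ‖B‖) * (‖k p.1‖ * ‖k p.2‖) := by ring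
        _ ≤ 2 * (((1 + 1 / t) * Real.exp (-t * ‖Y p.1 - s‖ ^ 2)) * (1 + 1 / t)) *
            (‖k p.1‖ * ‖k p.2‖) := by gcongr
        _ = _ := by ring
  have hswap := integral_integral_swap hΨint
  have hL : ∫ p : Ω × Ω, (∫ s, Ψ p s) ∂(γ.prod γ)
      = Z * ∫ p : Ω × Ω, gaussKernel t (Y p.1 - Y p.2) (k p.1) (k p.2) ∂(γ.prod γ) := by
    rw [← integral_const_mul]
    refine integral_congr_ae (Eventually.of_forall fun p => ?_)
    exact integral_gaussFeature ht (Y p.1) (Y p.2) (k p.1) (k p.2)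
  have hR : 0 ≤ ∫ s, (∫ p : Ω × Ω, Ψ p s ∂(γ.prod γ)) := by
    refine integral_nonneg fun s => ?_
    refine integral_curl_form_nonneg (γ := γ) (a := fun o => gaussFeature t (Y o) s) (k := k)
      fun i j => ?_
    have hkj : Integrable (fun o => k o j) γ := by
      refine hk.norm.mono' ?_ (Eventually.of_forall fun o => PiLp.norm_apply_le _ _)
      exact (EuclideanSpace.proj (𝕜 := ℝ) j).continuous.comp_aestronglyMeasurable
        hk.aestronglyMeasurable
    refine hkj.bdd_mul (c := 1 + 1 / t) ?_ (Eventually.of_forall fun o => ?_)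
    · exact ((EuclideanSpace.proj (𝕜 := ℝ) i).continuous.measurable.comp
        ((continuous_gaussFeature t).measurable.comp
          (hY.prodMk measurable_const))).aestronglyMeasurable
    · refine (PiLp.norm_apply_le _ _).trans ((norm_gaussFeature_le ht _ _).trans ?_)
      refine mul_le_of_le_one_right (by positivity) (Real.exp_le_one_iff.2 ?_)
      nlinarith [sq_nonneg ‖Y o - s‖]
  rw [← hswap, hL] at hR
  exact nonneg_of_mul_nonneg_right hR hZ

lemma inner_stokeslet (ε : ℝ) (z h k : E3) :
    inner ℝ h (stokeslet ε z k) = ((regNorm ε z)⁻¹ + ε ^ 2 * (regNorm ε z)⁻¹ ^ 3) * inner ℝ h k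
      + inner ℝ z h * inner ℝ z k * (regNorm ε z)⁻¹ ^ 3 := by
  unfold stokeslet
  rw [inner_add_right, inner_smul_right, inner_smul_right, real_inner_comm z h]
  ring

lemma rpow_mul_gaussKernel {ε t : ℝ} (ht : 0 < t) (z h k : E3) :
    t ^ (-(3 / 2) : ℝ) * Real.exp (-(ε ^ 2 * t)) * gaussKernel t z h k
      = (4 * inner ℝ h k) * (t ^ ((1 / 2 : ℝ) - 1) * Real.exp (-(regNorm ε z ^ 2 * t)))
      - (4 * (‖z‖ ^ 2 * inner ℝ h k - inner ℝ z h * inner ℝ z k)) *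
        (t ^ ((3 / 2 : ℝ) - 1) * Real.exp (-(regNorm ε z ^ 2 * t))) := by
  have e1 : t ^ ((1 / 2 : ℝ) - 1) = t ^ (-(3 / 2) : ℝ) * t := by
    rw [← Real.rpow_add_one ht.ne']; norm_num
  have e2 : t ^ ((3 / 2 : ℝ) - 1) = t ^ (-(3 / 2) : ℝ) * t ^ 2 := by
    rw [← Real.rpow_natCast t 2, ← Real.rpow_add ht]; norm_num
  have e3 : Real.exp (-(regNorm ε z ^ 2 * t))
      = Real.exp (-(ε ^ 2 * t)) * Real.exp (-t * ‖z‖ ^ 2) := by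
    rw [regNorm_sq, ← Real.exp_add]; ring_nf
  rw [e1, e2, e3]
  unfold gaussKernel
  ring

lemma integrableOn_rpow_mul_exp {s r : ℝ} (hs : 0 < s) (hr : 0 < r) :
    IntegrableOn (fun t : ℝ => t ^ (s - 1) * Real.exp (-(r * t))) (Ioi 0) := by
  have := integrableOn_rpow_mul_exp_neg_mul_rpow (p := 1) (s := s - 1) (b := r)
    (by linarith) one_pos hr
  simpa using this

/-- The weight `t^(-3/2) exp (-ε² t)` turns the two terms of `gaussKernel` into Gamma integrals with
values `Γ(1/2)` and `Γ(3/2)`, which yield the powers `-1` and `-3` of `regNorm ε z`. -/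
lemma integral_rpow_mul_gaussKernel {ε : ℝ} (hε : 0 < ε) (z h k : E3) :
    ∫ t in Ioi (0 : ℝ), t ^ (-(3 / 2) : ℝ) * Real.exp (-(ε ^ 2 * t)) * gaussKernel t z h k
      = 2 * Real.sqrt Real.pi * inner ℝ h (stokeslet ε z k) := by
  have hf := regNorm_pos hε z
  have hf2 : 0 < regNorm ε z ^ 2 := by positivity
  rw [setIntegral_congr_fun measurableSet_Ioi fun t ht => rpow_mul_gaussKernel (ε := ε) ht z h k,
    integral_sub ((integrableOn_rpow_mul_exp (by norm_num) hf2).const_mul _)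
      ((integrableOn_rpow_mul_exp (by norm_num) hf2).const_mul _), integral_const_mul,
    integral_const_mul, Real.integral_rpow_mul_exp_neg_mul_Ioi (by norm_num) hf2,
    Real.integral_rpow_mul_exp_neg_mul_Ioi (by norm_num) hf2, inner_stokeslet]
  have g2 : Real.Gamma (3 / 2) = 1 / 2 * Real.sqrt Real.pi := by
    rw [← Real.Gamma_one_half_eq, ← Real.Gamma_add_one (by norm_num)]; norm_num
  have p1 : (1 / regNorm ε z ^ 2) ^ (1 / 2 : ℝ) = (regNorm ε z)⁻¹ := by
    rw [one_div, ← inv_pow, ← Real.sqrt_eq_rpow, Real.sqrt_sq (by positivity)]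
  have p2 : (1 / regNorm ε z ^ 2) ^ (3 / 2 : ℝ) = (regNorm ε z)⁻¹ ^ 3 := by
    rw [show (3 / 2 : ℝ) = (1 / 2) * (3 : ℕ) by norm_num, Real.rpow_mul (by positivity), p1,
      Real.rpow_natCast]
  rw [Real.Gamma_one_half_eq, g2, p1, p2]
  have hz : ‖z‖ ^ 2 = regNorm ε z ^ 2 - ε ^ 2 := by rw [regNorm_sq]; ring
  rw [hz]
  field_simp
  ring

/-- Linear growth in `t` is what makes `t^(-3/2) * gaussKernel` integrable at `t = 0`, uniformly in
`z`; at infinity the factor `exp (-ε² t)` suffices. -/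
lemma abs_gaussKernel_le {t : ℝ} (ht : 0 < t) (z h k : E3) :
    |gaussKernel t z h k| ≤ 12 * t * (‖h‖ * ‖k‖) := by
  unfold gaussKernel
  have hhk : |(inner ℝ h k : ℝ)| ≤ ‖h‖ * ‖k‖ := abs_real_inner_le_norm _ _
  have hzh : |(inner ℝ z h : ℝ)| ≤ ‖z‖ * ‖h‖ := abs_real_inner_le_norm _ _
  have hzk : |(inner ℝ z k : ℝ)| ≤ ‖z‖ * ‖k‖ := abs_real_inner_le_norm _ _
  have hzz : |(inner ℝ z h * inner ℝ z k : ℝ)| ≤ ‖z‖ ^ 2 * (‖h‖ * ‖k‖) := by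
    rw [abs_mul]
    calc _ ≤ (‖z‖ * ‖h‖) * (‖z‖ * ‖k‖) := by gcongr
      _ = _ := by ring
  have he0 := Real.exp_pos (-t * ‖z‖ ^ 2)
  have he1 : Real.exp (-t * ‖z‖ ^ 2) ≤ 1 := Real.exp_le_one_iff.2 (by nlinarith [sq_nonneg ‖z‖])
  have he2 : t * ‖z‖ ^ 2 * Real.exp (-t * ‖z‖ ^ 2) ≤ 1 := by
    have := Real.add_one_le_exp (t * ‖z‖ ^ 2)
    have e : Real.exp (-t * ‖z‖ ^ 2) = (Real.exp (t * ‖z‖ ^ 2))⁻¹ := by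
      rw [← Real.exp_neg]; ring_nf
    rw [e, ← div_eq_mul_inv, div_le_one (Real.exp_pos _)]
    linarith
  rw [abs_mul, abs_of_pos he0]
  set P := ‖h‖ * ‖k‖
  have hP : 0 ≤ P := by positivity
  have hB : |‖z‖ ^ 2 * inner ℝ h k - inner ℝ z h * inner ℝ z k| ≤ 2 * ‖z‖ ^ 2 * P := by
    calc _ ≤ |‖z‖ ^ 2 * inner ℝ h k| + |(inner ℝ z h * inner ℝ z k : ℝ)| := abs_sub _ _
      _ ≤ ‖z‖ ^ 2 * P + ‖z‖ ^ 2 * P := by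
        rw [abs_mul, abs_of_nonneg (by positivity : 0 ≤ ‖z‖ ^ 2)]
        gcongr
      _ = _ := by ring
  have hA : |4 * t * inner ℝ h k - 4 * t ^ 2 * (‖z‖ ^ 2 * inner ℝ h k - inner ℝ z h * inner ℝ z k)|
      ≤ 4 * t * P + 4 * t ^ 2 * (2 * ‖z‖ ^ 2 * P) := by
    refine (abs_sub _ _).trans ?_
    rw [abs_mul, abs_mul (4 * t ^ 2), abs_of_pos (by positivity : 0 < 4 * t),
      abs_of_pos (by positivity : 0 < 4 * t ^ 2)]
    gcongr
  calc _ ≤ (4 * t * P + 4 * t ^ 2 * (2 * ‖z‖ ^ 2 * P)) * Real.exp (-t * ‖z‖ ^ 2) := by gcongr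
    _ = 4 * t * P * Real.exp (-t * ‖z‖ ^ 2)
        + 8 * t * P * (t * ‖z‖ ^ 2 * Real.exp (-t * ‖z‖ ^ 2)) := by ring
    _ ≤ 4 * t * P * 1 + 8 * t * P * 1 := by gcongr
    _ = _ := by ring

/-- The regularized Stokeslet is a kernel of positive type. -/
theorem integral_inner_stokeslet_nonneg {ε : ℝ} (hε : 0 < ε) {Y k : Ω → E3} (hY : Measurable Y)
    (hk : Integrable k γ) :
    0 ≤ ∫ p : Ω × Ω, inner ℝ (k p.1) (stokeslet ε (Y p.1 - Y p.2) (k p.2)) ∂(γ.prod γ) := by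
  set Ψ : Ω × Ω → ℝ → ℝ := fun p t => t ^ (-(3 / 2) : ℝ) * Real.exp (-(ε ^ 2 * t)) *
    gaussKernel t (Y p.1 - Y p.2) (k p.1) (k p.2) with hΨ
  have hΨint : Integrable (Function.uncurry Ψ)
      ((γ.prod γ).prod (volume.restrict (Ioi (0 : ℝ)))) := by
    have hb : Integrable (fun q : (Ω × Ω) × ℝ => (‖k q.1.1‖ * ‖k q.1.2‖) *
        (12 * (q.2 ^ ((1 / 2 : ℝ) - 1) * Real.exp (-(ε ^ 2 * q.2)))))
        ((γ.prod γ).prod (volume.restrict (Ioi (0 : ℝ)))) :=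
      (hk.norm.mul_prod hk.norm).mul_prod
        ((integrableOn_rpow_mul_exp (s := 1 / 2) (by norm_num) (by positivity : 0 < ε ^ 2)).const_mul
          12)
    refine hb.mono' ?_ ?_
    · have k1 : AEStronglyMeasurable (fun q : (Ω × Ω) × ℝ => k q.1.1)
          ((γ.prod γ).prod (volume.restrict (Ioi (0 : ℝ)))) :=
        hk.aestronglyMeasurable.comp_fst.comp_fst
      have k2 : AEStronglyMeasurable (fun q : (Ω × Ω) × ℝ => k q.1.2)
          ((γ.prod γ).prod (volume.restrict (Ioi (0 : ℝ)))) :=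
        hk.aestronglyMeasurable.comp_snd.comp_fst
      have z1 : Measurable (fun q : (Ω × Ω) × ℝ => Y q.1.1 - Y q.1.2) :=
        (hY.comp (measurable_fst.comp measurable_fst)).sub
          (hY.comp (measurable_snd.comp measurable_fst))
      have z2 : AEStronglyMeasurable (fun q : (Ω × Ω) × ℝ => Y q.1.1 - Y q.1.2)
          ((γ.prod γ).prod (volume.restrict (Ioi (0 : ℝ)))) := z1.aestronglyMeasurable
      have t1 : AEStronglyMeasurable (fun q : (Ω × Ω) × ℝ => q.2)
          ((γ.prod γ).prod (volume.restrict (Ioi (0 : ℝ)))) := measurable_snd.aestronglyMeasurable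
      have t2 : AEStronglyMeasurable
          (fun q : (Ω × Ω) × ℝ => q.2 ^ (-(3 / 2) : ℝ) * Real.exp (-(ε ^ 2 * q.2)))
          ((γ.prod γ).prod (volume.restrict (Ioi (0 : ℝ)))) := by
        refine Measurable.aestronglyMeasurable ?_
        fun_prop
      refine t2.mul ?_
      unfold gaussKernel
      refine AEStronglyMeasurable.mul ?_ ?_
      · exact ((t1.const_mul 4).mul (k1.inner k2)).sub (((t1.pow 2).const_mul 4).mul
          (((z2.norm.pow 2).mul (k1.inner k2)).sub ((z2.inner k1).mul (z2.inner k2))))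
      · exact Real.continuous_exp.comp_aestronglyMeasurable (t1.neg.mul (z2.norm.pow 2))
    · have hmem : ∀ᵐ q ∂((γ.prod γ).prod (volume.restrict (Ioi (0 : ℝ)))), q.2 ∈ Ioi (0 : ℝ) :=
        Measure.quasiMeasurePreserving_snd.ae (ae_restrict_mem measurableSet_Ioi)
      filter_upwards [hmem] with q hq
      have hq0 : 0 < q.2 := hq
      simp only [Function.uncurry, hΨ]
      rw [norm_mul, Real.norm_of_nonneg (by positivity), Real.norm_eq_abs]
      have e1 : q.2 ^ ((1 / 2 : ℝ) - 1) = q.2 ^ (-(3 / 2) : ℝ) * q.2 := by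
        rw [← Real.rpow_add_one hq0.ne']; norm_num
      calc _ ≤ q.2 ^ (-(3 / 2) : ℝ) * Real.exp (-(ε ^ 2 * q.2)) *
            (12 * q.2 * (‖k q.1.1‖ * ‖k q.1.2‖)) := by
            gcongr
            exact abs_gaussKernel_le hq0 _ _ _
        _ = _ := by rw [e1]; ring
  have hswap := integral_integral_swap hΨint
  have hL : ∫ p : Ω × Ω, (∫ t in Ioi (0 : ℝ), Ψ p t) ∂(γ.prod γ) = 2 * Real.sqrt Real.pi *
      ∫ p : Ω × Ω, inner ℝ (k p.1) (stokeslet ε (Y p.1 - Y p.2) (k p.2)) ∂(γ.prod γ) := by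
    rw [← integral_const_mul]
    exact integral_congr_ae (Eventually.of_forall fun p => integral_rpow_mul_gaussKernel hε _ _ _)
  have hR : 0 ≤ ∫ t in Ioi (0 : ℝ), (∫ p : Ω × Ω, Ψ p t ∂(γ.prod γ)) := by
    refine setIntegral_nonneg measurableSet_Ioi fun t ht => ?_
    have ht0 : 0 < t := ht
    simp only [hΨ]
    rw [integral_const_mul]
    exact mul_nonneg (by positivity) (integral_gaussKernel_nonneg ht0 hY hk)
  rw [← hswap, hL] at hR
  exact nonneg_of_mul_nonneg_right hR (by positivity)

end Psd

/-! ### The regularized Stokeslet as a bounded symmetric operator on L². -/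

lemma stokeslet_add (ε : ℝ) (z h k : E3) :
    stokeslet ε z (h + k) = stokeslet ε z h + stokeslet ε z k := by
  unfold stokeslet
  rw [inner_add_right]
  module

lemma stokeslet_smul (ε : ℝ) (z : E3) (c : ℝ) (h : E3) :
    stokeslet ε z (c • h) = c • stokeslet ε z h := by
  unfold stokeslet
  rw [inner_smul_right]
  module

lemma stokeslet_neg_left (ε : ℝ) (z h : E3) : stokeslet ε (-z) h = stokeslet ε z h := by
  unfold stokeslet regNorm
  rw [inner_neg_left, norm_neg]
  module

lemma inner_stokeslet_comm (ε : ℝ) (z h k : E3) :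
    inner ℝ h (stokeslet ε z k) = inner ℝ k (stokeslet ε z h) := by
  rw [inner_stokeslet, inner_stokeslet, real_inner_comm h k]
  ring

lemma norm_stokeslet_le {ε : ℝ} (hε : 0 < ε) (z h : E3) :
    ‖stokeslet ε z h‖ ≤ 2 * (regNorm ε z)⁻¹ * ‖h‖ := by
  have hf := regNorm_pos hε z
  unfold stokeslet
  have hz : ‖z‖ ^ 2 = regNorm ε z ^ 2 - ε ^ 2 := by rw [regNorm_sq]; ring
  have hin : |(inner ℝ z h : ℝ)| ≤ ‖z‖ * ‖h‖ := abs_real_inner_le_norm _ _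
  calc _ ≤ ((regNorm ε z)⁻¹ + ε ^ 2 * (regNorm ε z)⁻¹ ^ 3) * ‖h‖
        + (‖z‖ * ‖h‖ * (regNorm ε z)⁻¹ ^ 3) * ‖z‖ := by
        refine (norm_add_le _ _).trans ?_
        rw [norm_smul, norm_smul, Real.norm_of_nonneg (by positivity), norm_mul,
          Real.norm_of_nonneg (by positivity : 0 ≤ (regNorm ε z)⁻¹ ^ 3)]
        gcongr
        exact hin
    _ = ((regNorm ε z)⁻¹ + (ε ^ 2 + ‖z‖ ^ 2) * (regNorm ε z)⁻¹ ^ 3) * ‖h‖ := by ring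
    _ = _ := by
        rw [hz]
        field_simp
        ring

lemma inv_regNorm_le {ε : ℝ} (hε : 0 < ε) (z : E3) : (regNorm ε z)⁻¹ ≤ ε⁻¹ :=
  inv_anti₀ hε (le_regNorm z)

section StokesletOperator

variable {Ω : Type*} [MeasurableSpace Ω] {γ : Measure Ω} [IsProbabilityMeasure γ]

/-- The convolution of the regularized Stokeslet with a force distributed along `Y`. -/
def stokesletConv (γ : Measure Ω) (ε : ℝ) (Y k : Ω → E3) (x : E3) : E3 :=
  ∫ o, stokeslet ε (x - Y o) (k o) ∂γ

omit [IsProbabilityMeasure γ] in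
lemma integrable_stokeslet {ε : ℝ} (hε : 0 < ε) {Y k : Ω → E3} (hY : Measurable Y)
    (hk : Integrable k γ) (x : E3) : Integrable (fun o => stokeslet ε (x - Y o) (k o)) γ := by
  refine (hk.norm.const_mul (2 * ε⁻¹)).mono' ?_ (Eventually.of_forall fun o => ?_)
  · exact (continuous_stokeslet hε).comp_aestronglyMeasurable₂
      ((measurable_const.sub hY).aestronglyMeasurable) hk.aestronglyMeasurable
  · exact (norm_stokeslet_le hε _ _).trans (by
      gcongr; exact le_regNorm _)

omit [IsProbabilityMeasure γ] in
lemma integrable_inner_stokeslet {ε : ℝ} (hε : 0 < ε) {Y k h : Ω → E3} (hY : Measurable Y)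
    (hk : Integrable k γ) (hh : Integrable h γ) :
    Integrable (fun p : Ω × Ω => (inner ℝ (k p.1) (stokeslet ε (Y p.1 - Y p.2) (h p.2)) : ℝ))
      (γ.prod γ) := by
  refine ((hk.norm.mul_prod hh.norm).const_mul (2 * ε⁻¹)).mono' ?_
    (Eventually.of_forall fun p => ?_)
  · refine hk.aestronglyMeasurable.comp_fst.inner ?_
    exact (continuous_stokeslet hε).comp_aestronglyMeasurable₂
      (((hY.comp measurable_fst).sub (hY.comp measurable_snd)).aestronglyMeasurable)
      hh.aestronglyMeasurable.comp_snd
  · refine (norm_inner_le_norm _ _).trans ?_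
    calc _ ≤ ‖k p.1‖ * (2 * ε⁻¹ * ‖h p.2‖) := by
          gcongr
          exact (norm_stokeslet_le hε _ _).trans (by gcongr; exact le_regNorm _)
      _ = _ := by ring

lemma integral_inner_stokeslet_eq {ε : ℝ} (hε : 0 < ε) {Y k h : Ω → E3} (hY : Measurable Y)
    (hk : Integrable k γ) (hh : Integrable h γ) :
    ∫ p : Ω × Ω, inner ℝ (k p.1) (stokeslet ε (Y p.1 - Y p.2) (h p.2)) ∂(γ.prod γ)
      = ∫ o, inner ℝ (k o) (stokesletConv γ ε Y h (Y o)) ∂γ := by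
  rw [integral_prod _ (integrable_inner_stokeslet hε hY hk hh)]
  refine integral_congr_ae (Eventually.of_forall fun o => ?_)
  exact integral_inner (integrable_stokeslet hε hY hh (Y o)) (k o)

omit [IsProbabilityMeasure γ] in
lemma norm_stokesletConv_le {ε : ℝ} (hε : 0 < ε) {Y h : Ω → E3}
    (hh : Integrable h γ) (x : E3) :
    ‖stokesletConv γ ε Y h x‖ ≤ 2 * ε⁻¹ * ∫ o, ‖h o‖ ∂γ := by
  rw [← integral_const_mul]
  refine norm_integral_le_of_norm_le (hh.norm.const_mul _) (Eventually.of_forall fun o => ?_)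
  exact (norm_stokeslet_le hε _ _).trans (by gcongr; exact le_regNorm _)

lemma aestronglyMeasurable_stokesletConv {ε : ℝ} (hε : 0 < ε) {Y h : Ω → E3} (hY : Measurable Y)
    (hh : Integrable h γ) :
    AEStronglyMeasurable (fun o => stokesletConv γ ε Y h (Y o)) γ := by
  have : AEStronglyMeasurable (fun p : Ω × Ω => stokeslet ε (Y p.1 - Y p.2) (h p.2))
      (γ.prod γ) :=
    (continuous_stokeslet hε).comp_aestronglyMeasurable₂
      (((hY.comp measurable_fst).sub (hY.comp measurable_snd)).aestronglyMeasurable)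
      hh.aestronglyMeasurable.comp_snd
  exact this.integral_prod_right'

lemma memLp_stokesletConv {ε : ℝ} (hε : 0 < ε) {Y h : Ω → E3} (hY : Measurable Y)
    (hh : Integrable h γ) : MemLp (fun o => stokesletConv γ ε Y h (Y o)) 2 γ :=
  (memLp_top_of_bound (aestronglyMeasurable_stokesletConv hε hY hh) _
    (Eventually.of_forall fun o => norm_stokesletConv_le hε hh (Y o))).mono_exponent le_top

/-- Schur's test for a symmetric kernel: `2 ‖k₁‖ ‖k₂‖ ≤ ‖k₁‖² + ‖k₂‖²`, and each square is
integrated against the potential of the other variable. -/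
lemma integral_inner_stokeslet_le {ε P : ℝ} (hε : 0 < ε) {Y k : Ω → E3} (hY : Measurable Y)
    (hk : MemLp k 2 γ) (hP : ∀ x, ∫ o, (regNorm ε (x - Y o))⁻¹ ∂γ ≤ P) :
    ∫ p : Ω × Ω, inner ℝ (k p.1) (stokeslet ε (Y p.1 - Y p.2) (k p.2)) ∂(γ.prod γ)
      ≤ 2 * P * ∫ o, ‖k o‖ ^ 2 ∂γ := by
  have hki := hk.integrable (by norm_num)
  have hk2 : Integrable (fun o => ‖k o‖ ^ 2) γ := hk.integrable_norm_pow (by norm_num)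
  have hcont : Continuous fun z => (regNorm ε z)⁻¹ :=
    (continuous_regNorm ε).inv₀ fun z => (regNorm_pos hε z).ne'
  have hpm : Measurable (fun p : Ω × Ω => (regNorm ε (Y p.1 - Y p.2))⁻¹) :=
    hcont.measurable.comp ((hY.comp measurable_fst).sub (hY.comp measurable_snd))
  have hpm' : Measurable (fun p : Ω × Ω => (regNorm ε (Y p.2 - Y p.1))⁻¹) :=
    hcont.measurable.comp ((hY.comp measurable_snd).sub (hY.comp measurable_fst))
  have i1 : Integrable (fun p : Ω × Ω => ‖k p.1‖ ^ 2 * (regNorm ε (Y p.1 - Y p.2))⁻¹)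
      (γ.prod γ) := by
    refine (hk2.comp_fst γ).mul_bdd (c := ε⁻¹) hpm.aestronglyMeasurable
      (Eventually.of_forall fun p => ?_)
    rw [Real.norm_of_nonneg (inv_nonneg.2 (regNorm_pos hε _).le)]
    exact inv_regNorm_le hε _
  have i2 : Integrable (fun p : Ω × Ω => ‖k p.2‖ ^ 2 * (regNorm ε (Y p.2 - Y p.1))⁻¹)
      (γ.prod γ) := by
    refine (hk2.comp_snd γ).mul_bdd (c := ε⁻¹) hpm'.aestronglyMeasurable
      (Eventually.of_forall fun p => ?_)
    rw [Real.norm_of_nonneg (inv_nonneg.2 (regNorm_pos hε _).le)]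
    exact inv_regNorm_le hε _
  have v1 : ∫ p : Ω × Ω, ‖k p.1‖ ^ 2 * (regNorm ε (Y p.1 - Y p.2))⁻¹ ∂(γ.prod γ)
      ≤ P * ∫ o, ‖k o‖ ^ 2 ∂γ := by
    rw [integral_prod _ i1, ← integral_const_mul]
    refine integral_mono i1.integral_prod_left (hk2.const_mul P) fun o => ?_
    simp only
    rw [integral_const_mul, mul_comm]
    gcongr
    exact hP _
  have v2 : ∫ p : Ω × Ω, ‖k p.2‖ ^ 2 * (regNorm ε (Y p.2 - Y p.1))⁻¹ ∂(γ.prod γ)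
      ≤ P * ∫ o, ‖k o‖ ^ 2 ∂γ := by
    refine le_trans (le_of_eq ?_) v1
    exact integral_prod_swap (μ := γ) (ν := γ)
      (fun p : Ω × Ω => ‖k p.1‖ ^ 2 * (regNorm ε (Y p.1 - Y p.2))⁻¹)
  calc _ ≤ ∫ p : Ω × Ω, (‖k p.1‖ ^ 2 * (regNorm ε (Y p.1 - Y p.2))⁻¹
        + ‖k p.2‖ ^ 2 * (regNorm ε (Y p.2 - Y p.1))⁻¹) ∂(γ.prod γ) := by
        refine integral_mono (integrable_inner_stokeslet hε hY hki hki) (i1.add i2) fun p => ?_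
        simp only
        have e : regNorm ε (Y p.2 - Y p.1) = regNorm ε (Y p.1 - Y p.2) := by
          unfold regNorm; rw [norm_sub_rev]
        rw [e]
        have hf := inv_pos.2 (regNorm_pos hε (Y p.1 - Y p.2))
        set f := (regNorm ε (Y p.1 - Y p.2))⁻¹
        calc _ ≤ ‖k p.1‖ * (2 * f * ‖k p.2‖) :=
              (real_inner_le_norm _ _).trans (by gcongr; exact norm_stokeslet_le hε _ _)
          _ ≤ _ := by nlinarith [mul_nonneg hf.le (sq_nonneg (‖k p.1‖ - ‖k p.2‖))]
    _ ≤ _ := by rw [integral_add i1 i2]; linarith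

/-- A bounded operator of positive type satisfies `|T k|² ≤ ‖T‖ ⟨T k, k⟩`. -/
theorem integral_norm_sq_stokesletConv_le {ε P : ℝ} (hε : 0 < ε) (hP0 : 0 < P) {Y k : Ω → E3}
    (hY : Measurable Y) (hk : MemLp k 2 γ) (hP : ∀ x, ∫ o, (regNorm ε (x - Y o))⁻¹ ∂γ ≤ P) :
    ∫ o, ‖stokesletConv γ ε Y k (Y o)‖ ^ 2 ∂γ
      ≤ 2 * P * ∫ o, inner ℝ (stokesletConv γ ε Y k (Y o)) (k o) ∂γ := by
  have hki := hk.integrable (by norm_num)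
  set p : Ω → E3 := fun o => stokesletConv γ ε Y k (Y o) with hp
  have hpL : MemLp p 2 γ := memLp_stokesletConv hε hY hki
  have hpi := hpL.integrable (by norm_num)
  -- Positivity is applied to `k - c p`, where `p = T k`. Since `⟨T p, p⟩ ≤ 2P ‖p‖²`, it gives `⟨T
  -- k, k⟩ ≥ (2c - 2P c²) ‖p‖²`, and this `c` maximizes the coefficient.
  set c : ℝ := (2 * P)⁻¹ with hc
  have hc0 : 0 < c := by positivity
  have hcp : Integrable (fun o => -c • p o) γ := hpi.smul (-c)
  have h0 := integral_inner_stokeslet_nonneg (γ := γ) hε hY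
    (show Integrable (fun o => k o + -c • p o) γ from hki.add hcp)
  have ikk := integrable_inner_stokeslet hε hY hki hki
  have ikp := integrable_inner_stokeslet hε hY hki hpi
  have ipk := integrable_inner_stokeslet hε hY hpi hki
  have ipp := integrable_inner_stokeslet hε hY hpi hpi
  have hexp : (fun q : Ω × Ω => (inner ℝ (k q.1 + -c • p q.1)
      (stokeslet ε (Y q.1 - Y q.2) (k q.2 + -c • p q.2)) : ℝ)) = fun q : Ω × Ω =>
      inner ℝ (k q.1) (stokeslet ε (Y q.1 - Y q.2) (k q.2))
      + (-c) * inner ℝ (k q.1) (stokeslet ε (Y q.1 - Y q.2) (p q.2))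
      + (-c) * inner ℝ (p q.1) (stokeslet ε (Y q.1 - Y q.2) (k q.2))
      + c ^ 2 * inner ℝ (p q.1) (stokeslet ε (Y q.1 - Y q.2) (p q.2)) := by
    funext q
    simp only [stokeslet_add, stokeslet_smul, inner_add_left, inner_add_right, inner_smul_left,
      inner_smul_right, conj_trivial]
    ring
  have hsymm : ∫ q : Ω × Ω, (inner ℝ (k q.1) (stokeslet ε (Y q.1 - Y q.2) (p q.2)) : ℝ) ∂(γ.prod γ)
      = ∫ q : Ω × Ω, (inner ℝ (p q.1) (stokeslet ε (Y q.1 - Y q.2) (k q.2)) : ℝ) ∂(γ.prod γ) := by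
    rw [← integral_prod_swap]
    refine integral_congr_ae (Eventually.of_forall fun q => ?_)
    simp only [Prod.fst_swap, Prod.snd_swap]
    rw [inner_stokeslet_comm, ← neg_sub, stokeslet_neg_left]
  have hpk : ∫ q : Ω × Ω, (inner ℝ (p q.1) (stokeslet ε (Y q.1 - Y q.2) (k q.2)) : ℝ) ∂(γ.prod γ)
      = ∫ o, ‖p o‖ ^ 2 ∂γ := by
    rw [integral_inner_stokeslet_eq hε hY hpi hki]
    refine integral_congr_ae (Eventually.of_forall fun o => ?_)
    exact real_inner_self_eq_norm_sq _
  have hkk : ∫ q : Ω × Ω, (inner ℝ (k q.1) (stokeslet ε (Y q.1 - Y q.2) (k q.2)) : ℝ) ∂(γ.prod γ)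
      = ∫ o, inner ℝ (p o) (k o) ∂γ := by
    rw [integral_inner_stokeslet_eq hε hY hki hki]
    exact integral_congr_ae (Eventually.of_forall fun o => real_inner_comm _ _)
  have hpp := integral_inner_stokeslet_le hε hY hpL hP
  rw [hexp, integral_add, integral_add, integral_add, integral_const_mul, integral_const_mul,
    integral_const_mul, hsymm, hpk, hkk] at h0
  · have hcc : c ^ 2 * (2 * P * ∫ o, ‖p o‖ ^ 2 ∂γ) = c * ∫ o, ‖p o‖ ^ 2 ∂γ := by
      rw [hc]; field_simp
    have h1 := mul_le_mul_of_nonneg_left hpp (sq_nonneg c)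
    rw [hcc] at h1
    have h2 : c * ∫ o, ‖p o‖ ^ 2 ∂γ ≤ ∫ o, inner ℝ (p o) (k o) ∂γ := by linarith
    rw [hc, inv_mul_le_iff₀ (by positivity)] at h2
    exact h2
  · exact ikk
  · exact ikp.const_mul _
  · exact ikk.add (ikp.const_mul _)
  · exact ipk.const_mul _
  · exact (ikk.add (ikp.const_mul _)).add (ipk.const_mul _)
  · exact ipp.const_mul _

end StokesletOperator

/-! ### Variation of the kernel under displacement of the particles. -/

lemma abs_regNorm_sub_le (ε : ℝ) (a b : E3) : |regNorm ε a - regNorm ε b| ≤ ‖a - b‖ := by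
  have key : ∀ a b : E3, regNorm ε a ≤ regNorm ε b + ‖a - b‖ := by
    intro a b
    have hb : 0 ≤ regNorm ε b := Real.sqrt_nonneg _
    apply Real.sqrt_le_iff.2 ⟨by positivity, ?_⟩
    have h1 : ‖a‖ ≤ ‖b‖ + ‖a - b‖ := by
      calc ‖a‖ = ‖b + (a - b)‖ := by rw [add_sub_cancel]
        _ ≤ _ := norm_add_le _ _
    have h2 := norm_le_regNorm ε b
    have h3 := regNorm_sq ε b
    nlinarith [norm_nonneg (a - b), norm_nonneg a, norm_nonneg b]
  rw [abs_sub_le_iff]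
  constructor
  · linarith [key a b]
  · have := key b a
    rw [norm_sub_rev] at this
    linarith

/-- Put `f = regNorm ε z` and `n = z / f`. The kernel is `f⁻¹ (1 + ε² f⁻² + n ⊗ n)` with `‖n‖ ≤ 1`,
and `f`, `f⁻¹`, `n` vary in a controlled way. The five terms of `hdecomp` change one factor at a
time and add up to at most `5x² + 3xy + y²`, where `x` and `y` are the two values of `f⁻¹`. -/
lemma norm_stokeslet_sub_le {ε : ℝ} (hε : 0 < ε) (a b h : E3) :
    ‖stokeslet ε a h - stokeslet ε b h‖
      ≤ 7 * ‖a - b‖ * ((regNorm ε a)⁻¹ ^ 2 + (regNorm ε b)⁻¹ ^ 2) * ‖h‖ := by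
  have hf := regNorm_pos hε a
  have hg := regNorm_pos hε b
  have hfg := abs_regNorm_sub_le ε a b
  have ha := norm_le_regNorm ε a
  have hb := norm_le_regNorm ε b
  have hεf : ε ≤ regNorm ε a := le_regNorm a
  have hεg : ε ≤ regNorm ε b := le_regNorm b
  unfold stokeslet
  set f := regNorm ε a
  set g := regNorm ε b
  set δ := ‖a - b‖
  set n : E3 := f⁻¹ • a with hn
  set n' : E3 := g⁻¹ • b with hn'
  have hn1 : ‖n‖ ≤ 1 := by
    rw [hn, norm_smul, Real.norm_of_nonneg (by positivity), inv_mul_le_iff₀ hf]; linarith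
  have hn1' : ‖n'‖ ≤ 1 := by
    rw [hn', norm_smul, Real.norm_of_nonneg (by positivity), inv_mul_le_iff₀ hg]; linarith
  have hinv : |f⁻¹ - g⁻¹| ≤ δ * f⁻¹ * g⁻¹ := by
    have : f⁻¹ - g⁻¹ = (g - f) * f⁻¹ * g⁻¹ := by field_simp
    rw [this, abs_mul, abs_mul, abs_of_pos (inv_pos.2 hf), abs_of_pos (inv_pos.2 hg), abs_sub_comm]
    gcongr
  have hnn : ‖n - n'‖ ≤ 2 * δ * f⁻¹ := by
    have : n - n' = f⁻¹ • (a - b) + (f⁻¹ - g⁻¹) • b := by rw [hn, hn']; module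
    rw [this]
    refine (norm_add_le _ _).trans ?_
    rw [norm_smul, norm_smul, Real.norm_of_nonneg (by positivity : 0 ≤ f⁻¹), Real.norm_eq_abs]
    have : |f⁻¹ - g⁻¹| * ‖b‖ ≤ (δ * f⁻¹ * g⁻¹) * g := by gcongr
    have e : (δ * f⁻¹ * g⁻¹) * g = δ * f⁻¹ := by field_simp
    rw [e] at this
    change f⁻¹ * δ + _ ≤ _
    linarith
  have hδ : 0 ≤ δ := norm_nonneg _
  set x := f⁻¹ with hx
  set y := g⁻¹ with hy
  have hx0 : 0 < x := inv_pos.2 hf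
  have hy0 : 0 < y := inv_pos.2 hg
  have hcube : |ε ^ 2 * (x ^ 3 - y ^ 3)| ≤ δ * (x ^ 2 + x * y + y ^ 2) := by
    have e : ε ^ 2 * (x ^ 3 - y ^ 3) = (x - y) * (ε ^ 2 * (x ^ 2 + x * y + y ^ 2)) := by ring
    have hε2 : ε ^ 2 * (x * y) ≤ 1 := by
      have h1 : ε * x ≤ 1 := by rw [hx, ← div_eq_mul_inv, div_le_one hf]; exact hεf
      have h2 : ε * y ≤ 1 := by rw [hy, ← div_eq_mul_inv, div_le_one hg]; exact hεg
      calc ε ^ 2 * (x * y) = (ε * x) * (ε * y) := by ring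
        _ ≤ 1 * 1 := by gcongr
        _ = 1 := one_mul 1
    rw [e, abs_mul, abs_of_nonneg (by positivity : 0 ≤ ε ^ 2 * (x ^ 2 + x * y + y ^ 2))]
    calc _ ≤ (δ * x * y) * (ε ^ 2 * (x ^ 2 + x * y + y ^ 2)) := by gcongr
      _ = δ * (ε ^ 2 * (x * y)) * (x ^ 2 + x * y + y ^ 2) := by ring
      _ ≤ δ * 1 * (x ^ 2 + x * y + y ^ 2) := by gcongr
      _ = _ := by ring
  have ean : a = f • n := by rw [hn, smul_smul, mul_inv_cancel₀ hf.ne', one_smul]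
  have ebn : b = g • n' := by rw [hn', smul_smul, mul_inv_cancel₀ hg.ne', one_smul]
  have e1 : (inner ℝ a h * x ^ 3) • a = (x * inner ℝ n h) • n := by
    rw [ean, inner_smul_left, smul_smul]
    simp only [conj_trivial]
    congr 1
    rw [hx]; field_simp
  have e2 : (inner ℝ b h * y ^ 3) • b = (y * inner ℝ n' h) • n' := by
    rw [ebn, inner_smul_left, smul_smul]
    simp only [conj_trivial]
    congr 1
    rw [hy]; field_simp
  have hdecomp : (x + ε ^ 2 * x ^ 3) • h + (inner ℝ a h * x ^ 3) • a
      - ((y + ε ^ 2 * y ^ 3) • h + (inner ℝ b h * y ^ 3) • b)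
      = (x - y) • h + (ε ^ 2 * (x ^ 3 - y ^ 3)) • h + (x * inner ℝ (n - n') h) • n
        + (x * inner ℝ n' h) • (n - n') + ((x - y) * inner ℝ n' h) • n' := by
    rw [e1, e2, inner_sub_left]
    module
  rw [hdecomp]
  have i1 : |(inner ℝ (n - n') h : ℝ)| ≤ (2 * δ * x) * ‖h‖ :=
    (abs_real_inner_le_norm _ _).trans (by gcongr)
  have i2 : |(inner ℝ n' h : ℝ)| ≤ 1 * ‖h‖ :=
    (abs_real_inner_le_norm _ _).trans (by gcongr)
  have b1 : ‖(x - y) • h‖ ≤ (δ * x * y) * ‖h‖ := by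
    rw [norm_smul, Real.norm_eq_abs]; gcongr
  have b2 : ‖(ε ^ 2 * (x ^ 3 - y ^ 3)) • h‖ ≤ (δ * (x ^ 2 + x * y + y ^ 2)) * ‖h‖ := by
    rw [norm_smul, Real.norm_eq_abs]; gcongr
  have b3 : ‖(x * inner ℝ (n - n') h) • n‖ ≤ (x * ((2 * δ * x) * ‖h‖)) * 1 := by
    rw [norm_smul, norm_mul, Real.norm_of_nonneg hx0.le, Real.norm_eq_abs]; gcongr
  have b4 : ‖(x * inner ℝ n' h) • (n - n')‖ ≤ (x * (1 * ‖h‖)) * (2 * δ * x) := by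
    rw [norm_smul, norm_mul, Real.norm_of_nonneg hx0.le, Real.norm_eq_abs]; gcongr
  have b5 : ‖((x - y) * inner ℝ n' h) • n'‖ ≤ ((δ * x * y) * (1 * ‖h‖)) * 1 := by
    rw [norm_smul, norm_mul, Real.norm_eq_abs, Real.norm_eq_abs]; gcongr
  refine ((norm_add_le _ _).trans (add_le_add ((norm_add_le _ _).trans (add_le_add
    ((norm_add_le _ _).trans (add_le_add ((norm_add_le _ _).trans (add_le_add b1 b2)) b3)) b4))
    b5)).trans ?_
  have hxy : x * y ≤ (x ^ 2 + y ^ 2) / 2 := by nlinarith [sq_nonneg (x - y)]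
  have : 0 ≤ δ * ‖h‖ := by positivity
  nlinarith [mul_nonneg this (sq_nonneg (x - y)), mul_nonneg this (sq_nonneg x),
    mul_nonneg this (sq_nonneg y)]

lemma sq_integral_mul_le {Ω : Type*} [MeasurableSpace Ω] {γ : Measure Ω} {a b : Ω → ℝ}
    (ha : MemLp a 2 γ) (hb : MemLp b 2 γ) :
    (∫ o, a o * b o ∂γ) ^ 2 ≤ (∫ o, a o ^ 2 ∂γ) * ∫ o, b o ^ 2 ∂γ := by
  have ia : Integrable (fun o => a o ^ 2) γ := ha.integrable_sq
  have ib : Integrable (fun o => b o ^ 2) γ := hb.integrable_sq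
  have iab : Integrable (fun o => a o * b o) γ := ha.integrable_mul hb
  have h : ∀ t : ℝ, 0 ≤ (∫ o, b o ^ 2 ∂γ) * (t * t) + (2 * ∫ o, a o * b o ∂γ) * t
      + ∫ o, a o ^ 2 ∂γ := by
    intro t
    have h0 : 0 ≤ ∫ o, (t * t * b o ^ 2 + 2 * t * (a o * b o) + a o ^ 2) ∂γ :=
      integral_nonneg fun o => by
        change 0 ≤ t * t * b o ^ 2 + 2 * t * (a o * b o) + a o ^ 2
        nlinarith [sq_nonneg (t * b o + a o)]
    have i1 : Integrable (fun o => t * t * b o ^ 2 + 2 * t * (a o * b o)) γ :=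
      (ib.const_mul _).add (iab.const_mul _)
    rw [integral_add i1 ia,
      integral_add (ib.const_mul _) (iab.const_mul _), integral_const_mul,
      integral_const_mul] at h0
    linarith
  have := discrim_le_zero h
  unfold discrim at this
  nlinarith

section Remainder

variable {Ω : Type*} [MeasurableSpace Ω] {γ : Measure Ω} [IsProbabilityMeasure γ]

lemma continuous_regNorm_rpow {ε : ℝ} (hε : 0 < ε) (s : ℝ) :
    Continuous fun z => regNorm ε z ^ s :=
  (continuous_regNorm ε).rpow_const fun z => Or.inl (regNorm_pos hε z).ne'

lemma regNorm_rpow_neg_le {ε s : ℝ} (hε : 0 < ε) (hs : 0 ≤ s) (z : E3) :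
    regNorm ε z ^ (-s) ≤ ε ^ (-s) :=
  Real.rpow_le_rpow_of_nonpos hε (le_regNorm z) (by linarith)

lemma integrable_regNorm_rpow {ε s : ℝ} (hε : 0 < ε) (hs : 0 ≤ s) {Y : Ω → E3} (hY : Measurable Y)
    (x : E3) : Integrable (fun o => regNorm ε (x - Y o) ^ (-s)) γ := by
  refine (integrable_const (ε ^ (-s))).mono'
    ((continuous_regNorm_rpow hε (-s)).measurable.comp
      (measurable_const.sub hY)).aestronglyMeasurable (Eventually.of_forall fun o => ?_)
  rw [Real.norm_of_nonneg (Real.rpow_nonneg (regNorm_pos hε _).le _)]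
  exact regNorm_rpow_neg_le hε hs _

lemma integral_inv_regNorm_le {ε B : ℝ} (hε : 0 < ε) {Y : Ω → E3} (hY : Measurable Y)
    (hB : ∀ x, ∫ o, regNorm ε (x - Y o) ^ (-(9 / 4) : ℝ) ∂γ ≤ B) (x : E3) :
    ∫ o, (regNorm ε (x - Y o))⁻¹ ∂γ ≤ 1 + B := by
  have i1 : Integrable (fun o => (regNorm ε (x - Y o))⁻¹) γ := by
    simpa [Real.rpow_neg_one] using
      integrable_regNorm_rpow (γ := γ) (s := 1) hε zero_le_one hY x
  have i2 := integrable_regNorm_rpow (γ := γ) (s := 9 / 4) hε (by norm_num) hY x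
  calc _ ≤ ∫ o, (1 + regNorm ε (x - Y o) ^ (-(9 / 4) : ℝ)) ∂γ := by
        refine integral_mono i1 ((integrable_const 1).add i2) fun o => ?_
        simp only
        have hf := regNorm_pos hε (x - Y o)
        set f := regNorm ε (x - Y o)
        have hp : 0 < f ^ (-(9 / 4) : ℝ) := Real.rpow_pos_of_pos hf _
        rcases le_total 1 f with h | h
        · have : f⁻¹ ≤ 1 := inv_le_one_of_one_le₀ h
          linarith
        · have : f⁻¹ ≤ f ^ (-(9 / 4) : ℝ) := by
            rw [← Real.rpow_neg_one]
            exact Real.rpow_le_rpow_of_exponent_ge hf h (by norm_num)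
          linarith
    _ ≤ _ := by
        rw [integral_add (integrable_const 1) i2]
        simp only [integral_const, probReal_univ, smul_eq_mul, mul_one]
        linarith [hB x]

/-- Cauchy-Schwarz for the kernel `|x - Y|⁻²`, split as `|x - Y|^{-9/8} |x - Y|^{-7/8}`. -/
lemma sq_integral_regNorm_inv_sq_le {ε B W : ℝ} (hε : 0 < ε) {Y : Ω → E3} (hY : Measurable Y)
    (hB : ∀ x, ∫ o, regNorm ε (x - Y o) ^ (-(9 / 4) : ℝ) ∂γ ≤ B)
    {d w : Ω → ℝ} (hd : MemLp d 2 γ) (hw0 : ∀ o, 0 ≤ w o)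
    (hw : MemLp w 9 γ) (hW : ∫ o, w o ^ 9 ∂γ ≤ W) (x : E3) :
    (∫ o, d o * w o * (regNorm ε (x - Y o))⁻¹ ^ 2 ∂γ) ^ 2
      ≤ (W + B) * ∫ o, d o ^ 2 * regNorm ε (x - Y o) ^ (-(9 / 4) : ℝ) ∂γ := by
  have hmeas : ∀ s : ℝ, AEStronglyMeasurable (fun o => regNorm ε (x - Y o) ^ (-s)) γ := fun s =>
    ((continuous_regNorm_rpow hε (-s)).measurable.comp
      (measurable_const.sub hY)).aestronglyMeasurable
  have hbdd : ∀ s : ℝ, 0 ≤ s → ∀ᵐ o ∂γ, ‖regNorm ε (x - Y o) ^ (-s)‖ ≤ ε ^ (-s) := fun s hs =>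
    Eventually.of_forall fun o => by
      rw [Real.norm_of_nonneg (Real.rpow_nonneg (regNorm_pos hε _).le _)]
      exact regNorm_rpow_neg_le hε hs _
  have hw2 : MemLp w 2 γ := hw.mono_exponent (by norm_num)
  have hLtop : ∀ s : ℝ, 0 ≤ s → MemLp (fun o => regNorm ε (x - Y o) ^ (-s)) ∞ γ := fun s hs =>
    memLp_top_of_bound (hmeas s) _ (hbdd s hs)
  have ma : MemLp (fun o => d o * regNorm ε (x - Y o) ^ (-(9 / 8) : ℝ)) 2 γ :=
    (hLtop (9 / 8) (by norm_num)).mul' hd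
  have mb : MemLp (fun o => w o * regNorm ε (x - Y o) ^ (-(7 / 8) : ℝ)) 2 γ :=
    (hLtop (7 / 8) (by norm_num)).mul' hw2
  have key := sq_integral_mul_le ma mb
  have e1 : ∀ o, d o * regNorm ε (x - Y o) ^ (-(9 / 8) : ℝ) *
      (w o * regNorm ε (x - Y o) ^ (-(7 / 8) : ℝ)) = d o * w o * (regNorm ε (x - Y o))⁻¹ ^ 2 := by
    intro o
    have hf := regNorm_pos hε (x - Y o)
    have : (regNorm ε (x - Y o))⁻¹ ^ 2 = regNorm ε (x - Y o) ^ (-(9 / 8) : ℝ) *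
        regNorm ε (x - Y o) ^ (-(7 / 8) : ℝ) := by
      rw [← Real.rpow_add hf, ← Real.rpow_natCast, ← Real.rpow_neg_one, ← Real.rpow_mul hf.le]
      norm_num
    rw [this]; ring
  have e2 : ∀ o, (d o * regNorm ε (x - Y o) ^ (-(9 / 8) : ℝ)) ^ 2
      = d o ^ 2 * regNorm ε (x - Y o) ^ (-(9 / 4) : ℝ) := by
    intro o
    have hf := regNorm_pos hε (x - Y o)
    rw [mul_pow, ← Real.rpow_natCast (_ ^ _), ← Real.rpow_mul hf.le]
    norm_num
  have e3 : ∀ o, (w o * regNorm ε (x - Y o) ^ (-(7 / 8) : ℝ)) ^ 2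
      ≤ w o ^ 9 + regNorm ε (x - Y o) ^ (-(9 / 4) : ℝ) := by
    intro o
    have hf := regNorm_pos hε (x - Y o)
    set f := regNorm ε (x - Y o)
    -- The exponents `9/2` and `9/7` send `w²` to `w⁹` and the power `-7/4` to `-9/4`. Thus the
    -- ninth moment and the potential already used elsewhere bound the second Cauchy-Schwarz factor.
    have hy := Real.young_inequality_of_nonneg (a := w o ^ 2) (b := f ^ (-(7 / 4) : ℝ))
      (p := 9 / 2) (q := 9 / 7) (by positivity) (by positivity)
      (Real.holderConjugate_iff.2 ⟨by norm_num, by norm_num⟩)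
    have h1 : (w o ^ 2) ^ (9 / 2 : ℝ) = w o ^ 9 := by
      rw [← Real.rpow_natCast (w o) 2, ← Real.rpow_mul (hw0 o), ← Real.rpow_natCast (w o) 9]
      norm_num
    have h2 : (f ^ (-(7 / 4) : ℝ)) ^ (9 / 7 : ℝ) = f ^ (-(9 / 4) : ℝ) := by
      rw [← Real.rpow_mul hf.le]; norm_num
    have h3 : (w o * f ^ (-(7 / 8) : ℝ)) ^ 2 = w o ^ 2 * f ^ (-(7 / 4) : ℝ) := by
      rw [mul_pow, ← Real.rpow_natCast (f ^ _), ← Real.rpow_mul hf.le]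
      norm_num
    rw [h1, h2] at hy
    rw [h3]
    have : 0 ≤ w o ^ 9 := pow_nonneg (hw0 o) 9
    have : 0 < f ^ (-(9 / 4) : ℝ) := Real.rpow_pos_of_pos hf _
    refine hy.trans ?_
    rw [div_eq_mul_inv, div_eq_mul_inv]
    nlinarith
  simp only [e1, e2] at key
  refine key.trans ?_
  rw [mul_comm]
  have iw : Integrable (fun o => w o ^ 9) γ := by
    refine (hw.integrable_norm_pow (by norm_num)).congr (Eventually.of_forall fun o => ?_)
    simp only [Real.norm_of_nonneg (hw0 o)]
  have i2 := integrable_regNorm_rpow (γ := γ) (s := 9 / 4) hε (by norm_num) hY x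
  refine mul_le_mul_of_nonneg_right ?_ (integral_nonneg fun o => mul_nonneg (sq_nonneg _)
    (Real.rpow_nonneg (regNorm_pos hε _).le _))
  calc _ ≤ ∫ o, (w o ^ 9 + regNorm ε (x - Y o) ^ (-(9 / 4) : ℝ)) ∂γ :=
        integral_mono mb.integrable_sq (iw.add i2) e3
    _ ≤ _ := by rw [integral_add iw i2]; exact add_le_add hW (hB x)

/-- Two potentials enter. The pointwise Cauchy-Schwarz bound uses the one generated by `Y`. After
Fubini the remaining kernel is integrated over the positions `X`, and the potential generated by `X`
leaves only `∫ d²`. -/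
lemma integral_sq_integral_regNorm_inv_sq_le {ε B W : ℝ} (hε : 0 < ε) {X Y : Ω → E3}
    (hX : Measurable X) (hY : Measurable Y)
    (hBX : ∀ x, ∫ o, regNorm ε (x - X o) ^ (-(9 / 4) : ℝ) ∂γ ≤ B)
    (hBY : ∀ x, ∫ o, regNorm ε (x - Y o) ^ (-(9 / 4) : ℝ) ∂γ ≤ B)
    {d w : Ω → ℝ} (hd : MemLp d 2 γ) (hw0 : ∀ o, 0 ≤ w o)
    (hw : MemLp w 9 γ) (hW : ∫ o, w o ^ 9 ∂γ ≤ W) :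
    MemLp (fun o => ∫ o', d o' * w o' * (regNorm ε (X o - Y o'))⁻¹ ^ 2 ∂γ) 2 γ ∧
    ∫ o, (∫ o', d o' * w o' * (regNorm ε (X o - Y o'))⁻¹ ^ 2 ∂γ) ^ 2 ∂γ
      ≤ (W + B) * B * ∫ o, d o ^ 2 ∂γ := by
  have hwB : 0 ≤ W + B := by
    have h1 : 0 ≤ W := (integral_nonneg fun o => pow_nonneg (hw0 o) 9).trans hW
    have h2 : 0 ≤ B :=
      (integral_nonneg fun o => Real.rpow_nonneg (regNorm_pos hε _).le _).trans (hBX 0)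
    linarith
  have hmeas : ∀ s : ℝ, Measurable (fun p : Ω × Ω => regNorm ε (X p.1 - Y p.2) ^ s) :=
    fun s => (continuous_regNorm_rpow hε s).measurable.comp
      ((hX.comp measurable_fst).sub (hY.comp measurable_snd))
  have hprod : Integrable (fun p : Ω × Ω => d p.2 ^ 2 *
      regNorm ε (X p.1 - Y p.2) ^ (-(9 / 4) : ℝ)) (γ.prod γ) := by
    refine (hd.integrable_sq.comp_snd γ).mul_bdd (c := ε ^ (-(9 / 4) : ℝ))
      (hmeas _).aestronglyMeasurable (Eventually.of_forall fun p => ?_)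
    rw [Real.norm_of_nonneg (Real.rpow_nonneg (regNorm_pos hε _).le _)]
    exact regNorm_rpow_neg_le hε (by norm_num) _
  have hNmeas : AEStronglyMeasurable
      (fun o => ∫ o', d o' * w o' * (regNorm ε (X o - Y o'))⁻¹ ^ 2 ∂γ) γ := by
    have : AEStronglyMeasurable (fun p : Ω × Ω => d p.2 * w p.2 * (regNorm ε (X p.1 - Y p.2))⁻¹ ^ 2)
        (γ.prod γ) := by
      refine (hd.1.comp_snd.mul hw.1.comp_snd).mul ?_
      have h1 := hmeas 1
      simp only [Real.rpow_one] at h1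
      exact (h1.inv.pow_const 2).aestronglyMeasurable
    exact this.integral_prod_right'
  have hpt : ∀ o, (∫ o', d o' * w o' * (regNorm ε (X o - Y o'))⁻¹ ^ 2 ∂γ) ^ 2
      ≤ (W + B) * ∫ o', d o' ^ 2 * regNorm ε (X o - Y o') ^ (-(9 / 4) : ℝ) ∂γ := fun o =>
    sq_integral_regNorm_inv_sq_le hε hY hBY hd hw0 hw hW (X o)
  have hbi : Integrable (fun o => (W + B) * ∫ o', d o' ^ 2 *
      regNorm ε (X o - Y o') ^ (-(9 / 4) : ℝ) ∂γ) γ := hprod.integral_prod_left.const_mul _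
  have hL2 : MemLp (fun o => ∫ o', d o' * w o' * (regNorm ε (X o - Y o'))⁻¹ ^ 2 ∂γ) 2 γ := by
    rw [memLp_two_iff_integrable_sq hNmeas]
    refine hbi.mono' (hNmeas.pow 2) (Eventually.of_forall fun o => ?_)
    rw [Real.norm_of_nonneg (sq_nonneg _)]
    exact hpt o
  refine ⟨hL2, (integral_mono hL2.integrable_sq hbi hpt).trans ?_⟩
  rw [integral_const_mul, mul_assoc]
  refine mul_le_mul_of_nonneg_left ?_ hwB
  rw [← integral_prod _ hprod, integral_prod_symm _ hprod, ← integral_const_mul]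
  refine integral_mono hprod.integral_prod_right (hd.integrable_sq.const_mul B) fun o => ?_
  simp only
  rw [integral_const_mul, mul_comm]
  refine mul_le_mul_of_nonneg_right ?_ (sq_nonneg _)
  have e : ∀ o', regNorm ε (X o' - Y o) = regNorm ε (Y o - X o') := fun o' => by
    unfold regNorm; rw [norm_sub_rev]
  simp only [e]
  exact hBX _

end Remainder

/-- The source of the factor below one. Since `u = p + r`, one has `⟨p, v - u⟩ = ⟨p, v - r⟩ - ‖p‖²`,
and the negative square is absorbed on the left, giving `(1 + τ) ‖p‖ ≤ τ (‖v‖ + ‖r‖)`. -/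
lemma norm_le_of_sq_norm_le_inner {H : Type*} [NormedAddCommGroup H] [InnerProductSpace ℝ H]
    {τ : ℝ} (hτ : 0 < τ) {p v u r : H} (hu : u = p + r) (hp : ‖p‖ ^ 2 ≤ τ * inner ℝ p (v - u)) :
    ‖u‖ ≤ τ / (1 + τ) * ‖v‖ + 2 * ‖r‖ := by
  have h1 : (1 + τ) * ‖p‖ ≤ τ * (‖v‖ + ‖r‖) := by
    have e : (inner ℝ p (v - u) : ℝ) = inner ℝ p (v - r) - ‖p‖ ^ 2 := by
      rw [hu, ← real_inner_self_eq_norm_sq, ← inner_sub_right]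
      congr 1; abel
    have h2 : (inner ℝ p (v - r) : ℝ) ≤ ‖p‖ * (‖v‖ + ‖r‖) :=
      (real_inner_le_norm _ _).trans (by gcongr; exact norm_sub_le _ _)
    rw [e] at hp
    rcases (norm_nonneg p).eq_or_lt with h | h
    · rw [← h, mul_zero]; positivity
    · have : ‖p‖ * ((1 + τ) * ‖p‖) ≤ ‖p‖ * (τ * (‖v‖ + ‖r‖)) := by nlinarith
      exact le_of_mul_le_mul_left this h
  have h3 : ‖p‖ ≤ τ / (1 + τ) * (‖v‖ + ‖r‖) := by
    rw [div_mul_eq_mul_div, le_div_iff₀ (by linarith)]; linarith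
  have h4 : τ / (1 + τ) ≤ 1 := by rw [div_le_one (by linarith)]; linarith
  calc ‖u‖ ≤ ‖p‖ + ‖r‖ := hu ▸ norm_add_le _ _
    _ ≤ τ / (1 + τ) * (‖v‖ + ‖r‖) + ‖r‖ := by gcongr
    _ = τ / (1 + τ) * ‖v‖ + (τ / (1 + τ) * ‖r‖ + ‖r‖) := by ring
    _ ≤ τ / (1 + τ) * ‖v‖ + (1 * ‖r‖ + ‖r‖) := by gcongr
    _ = _ := by ring

/-! ### The fixed-time velocity estimate along a coupling. -/

section Fixed

variable {Ω : Type*} [MeasurableSpace Ω] {γ : Measure Ω} [IsProbabilityMeasure γ]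

/-- The `L²` norm of a vector field, as a real number. -/
def l2norm (γ : Measure Ω) (h : Ω → E3) : ℝ := Real.sqrt (∫ o, ‖h o‖ ^ 2 ∂γ)

omit [IsProbabilityMeasure γ] in
lemma l2norm_sq (h : Ω → E3) : l2norm γ h ^ 2 = ∫ o, ‖h o‖ ^ 2 ∂γ :=
  Real.sq_sqrt (integral_nonneg fun _ => sq_nonneg _)

omit [IsProbabilityMeasure γ] in
lemma l2norm_nonneg (h : Ω → E3) : 0 ≤ l2norm γ h := Real.sqrt_nonneg _

omit [IsProbabilityMeasure γ] in
lemma inner_toLp {h k : Ω → E3} (hh : MemLp h 2 γ) (hk : MemLp k 2 γ) :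
    (inner ℝ (hh.toLp h) (hk.toLp k) : ℝ) = ∫ o, inner ℝ (h o) (k o) ∂γ := by
  rw [L2.inner_def]
  refine integral_congr_ae ?_
  filter_upwards [hh.coeFn_toLp, hk.coeFn_toLp] with o h1 h2
  rw [h1, h2]

omit [IsProbabilityMeasure γ] in
lemma norm_toLp {h : Ω → E3} (hh : MemLp h 2 γ) : ‖hh.toLp h‖ = l2norm γ h := by
  rw [l2norm, eq_comm, Real.sqrt_eq_iff_mul_self_eq (integral_nonneg fun _ => sq_nonneg _)
    (norm_nonneg _), ← pow_two, ← real_inner_self_eq_norm_sq, inner_toLp]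
  simp only [real_inner_self_eq_norm_sq]

omit [IsProbabilityMeasure γ] in
lemma l2norm_add_le {h k : Ω → E3} (hh : MemLp h 2 γ) (hk : MemLp k 2 γ) :
    l2norm γ (fun o => h o + k o) ≤ l2norm γ h + l2norm γ k := by
  have := norm_add_le (hh.toLp h) (hk.toLp k)
  rwa [← MemLp.toLp_add, norm_toLp, norm_toLp, norm_toLp] at this

omit [IsProbabilityMeasure γ] in
lemma integral_inner_le_l2norm {h k : Ω → E3} (hh : MemLp h 2 γ) (hk : MemLp k 2 γ) :
    ∫ o, inner ℝ (h o) (k o) ∂γ ≤ l2norm γ h * l2norm γ k := by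
  have := real_inner_le_norm (hh.toLp h) (hk.toLp k)
  rwa [inner_toLp, norm_toLp, norm_toLp] at this

omit [IsProbabilityMeasure γ] in
lemma l2norm_le_of_norm_le {h : Ω → E3} {b : Ω → ℝ} {c : ℝ} (hc : 0 ≤ c) (hb : MemLp b 2 γ)
    (hh : AEStronglyMeasurable h γ)
    (hle : ∀ o, ‖h o‖ ≤ b o) (hbc : ∫ o, b o ^ 2 ∂γ ≤ c ^ 2) :
    MemLp h 2 γ ∧ l2norm γ h ≤ c := by
  have hL : MemLp h 2 γ := hb.mono' hh (Eventually.of_forall hle)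
  refine ⟨hL, Real.sqrt_le_iff.2 ⟨hc, le_trans ?_ hbc⟩⟩
  refine integral_mono (hL.integrable_norm_pow (by norm_num)) hb.integrable_sq fun o => ?_
  exact pow_le_pow_left₀ (norm_nonneg _) (hle o) 2

/-- Contribution of the displacement of the particles to the difference of the velocities. -/
lemma l2norm_stokesletConv_sub_le {ε B W : ℝ} (hε : 0 < ε) {X Y k : Ω → E3}
    (hX : Measurable X) (hY : Measurable Y)
    (hBX : ∀ x, ∫ o, regNorm ε (x - X o) ^ (-(9 / 4) : ℝ) ∂γ ≤ B)
    (hBY : ∀ x, ∫ o, regNorm ε (x - Y o) ^ (-(9 / 4) : ℝ) ∂γ ≤ B)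
    (hXY : MemLp (fun o => X o - Y o) 2 γ) (hk : MemLp k 9 γ) (hW : ∫ o, ‖k o‖ ^ 9 ∂γ ≤ W) :
    MemLp (fun o => stokesletConv γ ε X k (X o) - stokesletConv γ ε Y k (X o)) 2 γ ∧
    l2norm γ (fun o => stokesletConv γ ε X k (X o) - stokesletConv γ ε Y k (X o))
      ≤ 14 * Real.sqrt ((W + B) * B) * l2norm γ (fun o => X o - Y o) := by
  have hki : Integrable k γ := hk.integrable (by norm_num)
  set d : Ω → ℝ := fun o => ‖X o - Y o‖ with hd
  set w : Ω → ℝ := fun o => ‖k o‖ with hw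
  have hdL : MemLp d 2 γ := hXY.norm
  have hwL : MemLp w 9 γ := hk.norm
  have hW0 : 0 ≤ W := (integral_nonneg fun o => pow_nonneg (norm_nonneg _) 9).trans hW
  have hB0 : 0 ≤ B :=
    (integral_nonneg fun o => Real.rpow_nonneg (regNorm_pos hε _).le _).trans (hBX 0)
  obtain ⟨m1, e1⟩ := integral_sq_integral_regNorm_inv_sq_le hε hX hX hBX hBX hdL
    (fun o => norm_nonneg _) hwL hW
  obtain ⟨m2, e2⟩ := integral_sq_integral_regNorm_inv_sq_le hε hX hY hBX hBY hdL
    (fun o => norm_nonneg _) hwL hW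
  set N1 : Ω → ℝ := fun o => ∫ o', d o' * w o' * (regNorm ε (X o - X o'))⁻¹ ^ 2 ∂γ with hN1
  set N2 : Ω → ℝ := fun o => ∫ o', d o' * w o' * (regNorm ε (X o - Y o'))⁻¹ ^ 2 ∂γ with hN2
  have mb : MemLp (fun o => 7 * (N1 o + N2 o)) 2 γ := (m1.add m2).const_mul 7
  have hdw : Integrable (fun o => d o * w o) γ :=
    hdL.integrable_mul (hwL.mono_exponent (p := 2) (by norm_num))
  have hker : ∀ (Z : Ω → E3), Measurable Z → ∀ x,
      Integrable (fun o => d o * w o * (regNorm ε (x - Z o))⁻¹ ^ 2) γ := by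
    intro Z hZ x
    refine hdw.mul_bdd (c := ε⁻¹ ^ 2) ?_ (Eventually.of_forall fun o => ?_)
    · exact ((((continuous_regNorm ε).measurable.comp
        (measurable_const.sub hZ)).inv).pow_const 2).aestronglyMeasurable
    · have := inv_pos.2 (regNorm_pos hε (x - Z o))
      rw [Real.norm_of_nonneg (by positivity)]
      exact pow_le_pow_left₀ this.le (inv_regNorm_le hε _) 2
  refine l2norm_le_of_norm_le (mul_nonneg (by positivity) (l2norm_nonneg _)) mb ?_ (fun o => ?_) ?_
  · refine (aestronglyMeasurable_stokesletConv hε hX hki).sub ?_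
    have : AEStronglyMeasurable (fun p : Ω × Ω => stokeslet ε (X p.1 - Y p.2) (k p.2))
        (γ.prod γ) :=
      (continuous_stokeslet hε).comp_aestronglyMeasurable₂
        (((hX.comp measurable_fst).sub (hY.comp measurable_snd)).aestronglyMeasurable)
        hki.aestronglyMeasurable.comp_snd
    exact this.integral_prod_right'
  · unfold stokesletConv
    rw [← integral_sub (integrable_stokeslet hε hX hki _) (integrable_stokeslet hε hY hki _),
      hN1, hN2]
    simp only
    rw [← integral_add (hker X hX _) (hker Y hY _), ← integral_const_mul]
    refine norm_integral_le_of_norm_le (((hker X hX _).add (hker Y hY _)).const_mul 7)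
      (Eventually.of_forall fun o' => ?_)
    refine (norm_stokeslet_sub_le hε _ _ _).trans (le_of_eq ?_)
    rw [sub_sub_sub_cancel_left, norm_sub_rev]
    simp only [hd, hw]
    ring
  · calc ∫ o, (7 * (N1 o + N2 o)) ^ 2 ∂γ ≤ ∫ o, (98 * N1 o ^ 2 + 98 * N2 o ^ 2) ∂γ := by
          refine integral_mono mb.integrable_sq
            ((m1.integrable_sq.const_mul 98).add (m2.integrable_sq.const_mul 98)) fun o => ?_
          simp only
          nlinarith [sq_nonneg (N1 o - N2 o)]
      _ = 98 * ∫ o, N1 o ^ 2 ∂γ + 98 * ∫ o, N2 o ^ 2 ∂γ := by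
          rw [integral_add (m1.integrable_sq.const_mul 98) (m2.integrable_sq.const_mul 98),
            integral_const_mul, integral_const_mul]
      _ ≤ 98 * ((W + B) * B * ∫ o, d o ^ 2 ∂γ) + 98 * ((W + B) * B * ∫ o, d o ^ 2 ∂γ) := by
          gcongr
      _ = _ := by
          rw [mul_pow, mul_pow, Real.sq_sqrt (by positivity), l2norm_sq]
          ring

/-- The fixed time estimate for the difference of two fluid velocities, evaluated along a coupling:
the friction yields a factor strictly smaller than one in front of the velocity difference. -/
theorem l2norm_velocity_difference_le {m B W M : ℝ} (hm : 0 < m) (hM : 0 ≤ M)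
    {X₁ X₂ V₁ V₂ : Ω → E3} (hX₁ : Measurable X₁) (hX₂ : Measurable X₂)
    (hV₁ : Integrable V₁ γ) (hV : MemLp (fun o => V₁ o - V₂ o) 2 γ)
    (hX : MemLp (fun o => X₁ o - X₂ o) 2 γ)
    {u₁ u₂ : E3 → E3} (hu₁ : Continuous u₁) (hu₂ : Continuous u₂) {K : ℝ}
    (hu₁K : ∀ x, ‖u₁ x‖ ≤ K) (hu₂K : ∀ x, ‖u₂ x‖ ≤ K)
    (hlip : ∀ x y, ‖u₂ x - u₂ y‖ ≤ M * ‖x - y‖)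
    (hk9 : MemLp (fun o => V₂ o - u₂ (X₂ o)) 9 γ)
    (hW : ∫ o, ‖V₂ o - u₂ (X₂ o)‖ ^ 9 ∂γ ≤ W)
    (hB₁ : ∀ ε ∈ Ioc (0 : ℝ) 1, ∀ x, ∫ o, regNorm ε (x - X₁ o) ^ (-(9 / 4) : ℝ) ∂γ ≤ B)
    (hB₂ : ∀ ε ∈ Ioc (0 : ℝ) 1, ∀ x, ∫ o, regNorm ε (x - X₂ o) ^ (-(9 / 4) : ℝ) ∂γ ≤ B)
    (hconv₁ : ∀ x, Tendsto (fun ε => stokesletConv γ ε X₁ (fun o => V₁ o - u₁ (X₁ o)) x)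
      (𝓝[>] 0) (𝓝 (m • u₁ x)))
    (hconv₂ : ∀ x, Tendsto (fun ε => stokesletConv γ ε X₂ (fun o => V₂ o - u₂ (X₂ o)) x)
      (𝓝[>] 0) (𝓝 (m • u₂ x)))
    {A : ℝ}
    (hbd₁ : ∀ ε ∈ Ioc (0 : ℝ) 1, ∀ x, ‖stokesletConv γ ε X₁ (fun o => V₁ o - u₁ (X₁ o)) x‖ ≤ A)
    (hbd₂ : ∀ ε ∈ Ioc (0 : ℝ) 1, ∀ x, ‖stokesletConv γ ε X₂ (fun o => V₂ o - u₂ (X₂ o)) x‖ ≤ A) :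
    MemLp (fun o => u₁ (X₁ o) - u₂ (X₂ o)) 2 γ ∧
    l2norm γ (fun o => u₁ (X₁ o) - u₂ (X₂ o))
      ≤ 2 * (1 + B) / m / (1 + 2 * (1 + B) / m) * l2norm γ (fun o => V₁ o - V₂ o)
        + 2 * (14 * Real.sqrt ((W + B) * B) / m + M) * l2norm γ (fun o => X₁ o - X₂ o) := by
  have hB0 : 0 ≤ B :=
    (integral_nonneg fun o => Real.rpow_nonneg (regNorm_pos one_pos _).le _).trans
      (hB₁ 1 ⟨one_pos, le_rfl⟩ 0)
  set τ := 2 * (1 + B) / m with hτdef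
  have hτ : 0 < τ := by positivity
  have memB : ∀ {f : Ω → E3} {R : ℝ}, AEStronglyMeasurable f γ → (∀ o, ‖f o‖ ≤ R) → MemLp f 2 γ :=
    fun hf hR => (memLp_top_of_bound hf _ (Eventually.of_forall hR)).mono_exponent le_top
  have sm : ∀ {v : E3 → E3} {X : Ω → E3}, Continuous v → Measurable X →
      AEStronglyMeasurable (fun o => v (X o)) γ := fun hv hX =>
    (hv.measurable.comp hX).aestronglyMeasurable
  have mu11 : MemLp (fun o => u₁ (X₁ o)) 2 γ := memB (sm hu₁ hX₁) fun o => hu₁K _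
  have mu21 : MemLp (fun o => u₂ (X₁ o)) 2 γ := memB (sm hu₂ hX₁) fun o => hu₂K _
  have mu22 : MemLp (fun o => u₂ (X₂ o)) 2 γ := memB (sm hu₂ hX₂) fun o => hu₂K _
  have mU : MemLp (fun o => u₁ (X₁ o) - u₂ (X₂ o)) 2 γ := mu11.sub mu22
  refine ⟨mU, ?_⟩
  set k : Ω → E3 := fun o => (V₁ o - V₂ o) - (u₁ (X₁ o) - u₂ (X₂ o)) with hk
  have mk : MemLp k 2 γ := hV.sub mU
  have mki : Integrable k γ := mk.integrable (by norm_num)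
  set k₂ : Ω → E3 := fun o => V₂ o - u₂ (X₂ o) with hk₂
  have mk2i : Integrable k₂ γ := hk9.integrable (by norm_num)
  set k₁ : Ω → E3 := fun o => V₁ o - u₁ (X₁ o) with hk₁
  set S₁ : ℝ → E3 → E3 := fun ε x => stokesletConv γ ε X₁ k₁ x with hS₁
  set S₂ : ℝ → E3 → E3 := fun ε x => stokesletConv γ ε X₂ k₂ x with hS₂
  -- the regularized estimate
  set η : ℝ → Ω → E3 := fun ε o => (u₁ (X₁ o) - u₂ (X₁ o)) -
    m⁻¹ • (S₁ ε (X₁ o) - S₂ ε (X₁ o)) with hη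
  have hηm : ∀ ε ∈ Ioc (0 : ℝ) 1, AEStronglyMeasurable (η ε) γ := by
    intro ε hε
    refine (mu11.1.sub mu21.1).sub (AEStronglyMeasurable.const_smul
      (f := fun o => S₁ ε (X₁ o) - S₂ ε (X₁ o)) ?_ m⁻¹)
    have h1 : Integrable k₁ γ := hV₁.sub (mu11.integrable (by norm_num))
    refine (aestronglyMeasurable_stokesletConv hε.1 hX₁ h1).sub ?_
    have : AEStronglyMeasurable (fun p : Ω × Ω => stokeslet ε (X₁ p.1 - X₂ p.2) (k₂ p.2))
        (γ.prod γ) :=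
      (continuous_stokeslet hε.1).comp_aestronglyMeasurable₂
        (((hX₁.comp measurable_fst).sub (hX₂.comp measurable_snd)).aestronglyMeasurable)
        mk2i.aestronglyMeasurable.comp_snd
    exact this.integral_prod_right'
  have hηb : ∀ ε ∈ Ioc (0 : ℝ) 1, ∀ o, ‖η ε o‖ ≤ K + K + m⁻¹ * (A + A) := by
    intro ε hε o
    refine (norm_sub_le _ _).trans (add_le_add ((norm_sub_le _ _).trans
      (add_le_add (hu₁K _) (hu₂K _))) ?_)
    rw [norm_smul, Real.norm_of_nonneg (by positivity)]
    gcongr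
    exact (norm_sub_le _ _).trans (add_le_add (hbd₁ ε hε _) (hbd₂ ε hε _))
  have hηL : ∀ ε ∈ Ioc (0 : ℝ) 1, MemLp (η ε) 2 γ := fun ε hε => memB (hηm ε hε) (hηb ε hε)
  have hmain : ∀ ε ∈ Ioc (0 : ℝ) 1, l2norm γ (fun o => u₁ (X₁ o) - u₂ (X₂ o))
      ≤ τ / (1 + τ) * l2norm γ (fun o => V₁ o - V₂ o)
        + 2 * ((14 * Real.sqrt ((W + B) * B) / m + M) * l2norm γ (fun o => X₁ o - X₂ o)
          + l2norm γ (η ε)) := by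
    intro ε hε
    have hε0 := hε.1
    have hop := integral_norm_sq_stokesletConv_le hε0 (by linarith : 0 < 1 + B) hX₁ mk
      (integral_inv_regNorm_le hε0 hX₁ (hB₁ ε hε))
    have mT : MemLp (fun o => stokesletConv γ ε X₁ k (X₁ o)) 2 γ := memLp_stokesletConv hε0 hX₁ mki
    obtain ⟨mR, hR⟩ := l2norm_stokesletConv_sub_le hε0 hX₁ hX₂ (hB₁ ε hε) (hB₂ ε hε) hX hk9 hW
    set T : Ω → E3 := fun o => stokesletConv γ ε X₁ k (X₁ o) with hT
    set R : Ω → E3 := fun o => stokesletConv γ ε X₁ k₂ (X₁ o) - stokesletConv γ ε X₂ k₂ (X₁ o)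
      with hRdef
    have mp : MemLp (fun o => m⁻¹ • T o) 2 γ := mT.const_smul m⁻¹
    have mR' : MemLp (fun o => m⁻¹ • R o) 2 γ := mR.const_smul m⁻¹
    have mlip : MemLp (fun o => u₂ (X₁ o) - u₂ (X₂ o)) 2 γ := mu21.sub mu22
    have mr : MemLp (fun o => (m⁻¹ • R o + (u₂ (X₁ o) - u₂ (X₂ o))) + η ε o) 2 γ :=
      (mR'.add mlip).add (hηL ε hε)
    -- The force of the first solution is `k + k₂`. The part `k = v - U` gives `T`, whereas `k₂`
    -- acts from `X₁` in one field and from `X₂` in the other, which leaves `R`. Only the force of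
    -- the second solution therefore needs nine moments.
    have hsum : ∀ o, S₁ ε (X₁ o) - S₂ ε (X₁ o) = T o + R o := by
      intro o
      have h1 : Integrable k₁ γ := hV₁.sub (mu11.integrable (by norm_num))
      have : S₁ ε (X₁ o) = T o + stokesletConv γ ε X₁ k₂ (X₁ o) := by
        simp only [hS₁, hT]
        unfold stokesletConv
        rw [← integral_add (integrable_stokeslet hε0 hX₁ mki _)
          (integrable_stokeslet hε0 hX₁ mk2i _)]
        refine integral_congr_ae (Eventually.of_forall fun o' => ?_)
        simp only
        rw [← stokeslet_add]
        congr 1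
        simp only [hk, hk₁, hk₂]
        abel
      rw [this]
      simp only [hRdef, hS₂]
      abel
    -- In `L²(γ)` the velocity difference is `p + r` with `p = m⁻¹ T`, and `r` is the sum of `m⁻¹
    -- R`, the Lipschitz term and `η`. Normalization by `m` turns the operator bound `2 (1 + B)`
    -- into `τ`.
    have hHil := norm_le_of_sq_norm_le_inner (H := Lp E3 2 γ) hτ (p := mp.toLp _)
      (v := hV.toLp _) (u := mU.toLp _) (r := mr.toLp _) ?_ ?_
    · rw [norm_toLp, norm_toLp, norm_toLp] at hHil
      refine hHil.trans ?_
      gcongr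
      refine (l2norm_add_le (mR'.add mlip) (hηL ε hε)).trans ?_
      gcongr
      refine (l2norm_add_le mR' mlip).trans ?_
      rw [add_mul]
      refine add_le_add ?_ ?_
      · have : l2norm γ (fun o => m⁻¹ • R o) = m⁻¹ * l2norm γ R := by
          unfold l2norm
          simp only [norm_smul, mul_pow, integral_const_mul]
          rw [Real.sqrt_mul (by positivity), Real.sqrt_sq (norm_nonneg _),
            Real.norm_of_nonneg (inv_pos.2 hm).le]
        rw [this]
        calc _ ≤ m⁻¹ * (14 * Real.sqrt ((W + B) * B) * l2norm γ (fun o => X₁ o - X₂ o)) := by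
              gcongr
          _ = _ := by ring
      · refine (l2norm_le_of_norm_le (b := fun o => M * ‖X₁ o - X₂ o‖)
          (mul_nonneg hM (l2norm_nonneg _)) (hX.norm.const_mul M) mlip.1
          (fun o => hlip _ _) (le_of_eq ?_)).2
        rw [mul_pow, l2norm_sq, ← integral_const_mul]
        simp only [mul_pow]
    · rw [← MemLp.toLp_add]
      refine MemLp.toLp_congr _ _ (Eventually.of_forall fun o => ?_)
      simp only [Pi.add_apply, hη]
      rw [hsum]
      module
    · rw [← MemLp.toLp_sub, norm_toLp, inner_toLp, l2norm_sq]
      simp only [Pi.sub_apply, norm_smul, mul_pow, inner_smul_left, conj_trivial]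
      rw [integral_const_mul, integral_const_mul, Real.norm_of_nonneg (inv_pos.2 hm).le]
      have e : τ * (m⁻¹ * ∫ o, inner ℝ (T o) (k o) ∂γ)
          = m⁻¹ ^ 2 * (2 * (1 + B) * ∫ o, inner ℝ (T o) (k o) ∂γ) := by
        rw [hτdef]; field_simp
      refine (mul_le_mul_of_nonneg_left hop (by positivity)).trans (le_of_eq e.symm)
  have hη0 : Tendsto (fun ε => l2norm γ (η ε)) (𝓝[>] 0) (𝓝 0) := by
    have hI : ∀ᶠ ε in 𝓝[>] (0 : ℝ), ε ∈ Ioc (0 : ℝ) 1 :=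
      Ioc_mem_nhdsGT one_pos
    have h1 : Tendsto (fun ε => ∫ o, ‖η ε o‖ ^ 2 ∂γ) (𝓝[>] 0) (𝓝 (∫ o, (0 : ℝ) ∂γ)) := by
      refine tendsto_integral_filter_of_dominated_convergence
        (fun _ => (K + K + m⁻¹ * (A + A)) ^ 2) ?_ ?_ (integrable_const _) ?_
      · filter_upwards [hI] with ε hε using (hηm ε hε).norm.pow 2
      · filter_upwards [hI] with ε hε
        refine Eventually.of_forall fun o => ?_
        rw [Real.norm_of_nonneg (sq_nonneg _)]
        exact pow_le_pow_left₀ (norm_nonneg _) (hηb ε hε o) 2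
      · refine Eventually.of_forall fun o => ?_
        have h2 : Tendsto (fun ε => η ε o) (𝓝[>] 0) (𝓝 ((u₁ (X₁ o) - u₂ (X₁ o)) -
            m⁻¹ • (m • u₁ (X₁ o) - m • u₂ (X₁ o)))) :=
          tendsto_const_nhds.sub (((hconv₁ _).sub (hconv₂ _)).const_smul _)
        have h3 : (u₁ (X₁ o) - u₂ (X₁ o)) - m⁻¹ • (m • u₁ (X₁ o) - m • u₂ (X₁ o)) = 0 := by
          rw [← smul_sub, smul_smul, inv_mul_cancel₀ hm.ne', one_smul, sub_self]
        rw [h3] at h2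
        simpa using h2.norm.pow 2
    have h4 := h1.sqrt
    simpa [l2norm] using h4
  have hlim : Tendsto (fun ε => τ / (1 + τ) * l2norm γ (fun o => V₁ o - V₂ o)
        + 2 * ((14 * Real.sqrt ((W + B) * B) / m + M) * l2norm γ (fun o => X₁ o - X₂ o)
          + l2norm γ (η ε))) (𝓝[>] 0) (𝓝 (τ / (1 + τ) * l2norm γ (fun o => V₁ o - V₂ o)
        + 2 * ((14 * Real.sqrt ((W + B) * B) / m + M) * l2norm γ (fun o => X₁ o - X₂ o)
          + 0))) :=
    tendsto_const_nhds.add ((tendsto_const_nhds.add hη0).const_mul 2)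
  have := ge_of_tendsto hlim (by
    filter_upwards [Ioc_mem_nhdsGT (one_pos : (0 : ℝ) < 1)] with ε hε using hmain ε hε)
  rw [add_zero, ← mul_assoc] at this
  exact this

end Fixed

/-! ### Uniform potential bounds for densities in L^q with q > 4. -/

section Potential

lemma lintegral_ball_norm_rpow_lt_top {s : ℝ} (hs : s < 3) :
    ∫⁻ z in Metric.ball (0 : E3) 1, ENNReal.ofReal (‖z‖ ^ (-s)) < ⊤ := by
  have h : IntegrableOn (fun z : E3 => ‖z‖ ^ (-s)) (Metric.ball 0 1) := by
    rw [integrableOn_fun_norm_addHaar volume (f := fun r : ℝ => r ^ (-s))]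
    have h3 : Module.finrank ℝ E3 = 3 := by simp
    rw [h3]
    have : IntegrableOn (fun y : ℝ => y ^ (2 - s)) (Ioo 0 1) := by
      rw [intervalIntegral.integrableOn_Ioo_rpow_iff one_pos]; linarith
    refine this.congr_fun (fun y hy => ?_) measurableSet_Ioo
    simp only [smul_eq_mul]
    rw [show (2 : ℝ) - s = (2 : ℕ) + -s by push_cast; ring, Real.rpow_add hy.1, Real.rpow_natCast]
  have h2 := h.2
  rw [hasFiniteIntegral_iff_norm] at h2
  refine lt_of_le_of_lt (lintegral_mono fun z => ?_) h2
  exact ENNReal.ofReal_le_ofReal (le_abs_self _)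

/-- A finite exponent is needed for Hölder duality. For `q = ⊤` any exponent above `4` works by
interpolation with the mass, and `5` is taken. -/
lemma exists_lintegral_rpow_le {q : ℝ≥0∞} (hq : 4 < q) (M : ℝ≥0) :
    ∃ (r : ℝ) (N : ℝ≥0∞), 4 < r ∧ N < ⊤ ∧ ∀ ρ : E3 → ℝ≥0∞, Measurable ρ →
      ∫⁻ x, ρ x ≤ 1 → eLpNorm ρ q volume ≤ M → ∫⁻ x, ρ x ^ r ≤ N := by
  by_cases hq' : q = ⊤
  · refine ⟨5, (M : ℝ≥0∞) ^ (4 : ℝ), by norm_num, by finiteness, fun ρ hρ h1 hM => ?_⟩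
    rw [hq', eLpNorm_exponent_top] at hM
    have hae : ∀ᵐ x, ρ x ≤ M := by
      filter_upwards [ae_le_eLpNormEssSup (f := ρ) (μ := (volume : Measure E3))] with x hx
      exact hx.trans hM
    calc ∫⁻ x, ρ x ^ (5 : ℝ) ≤ ∫⁻ x, (M : ℝ≥0∞) ^ (4 : ℝ) * ρ x := by
          refine lintegral_mono_ae ?_
          filter_upwards [hae] with x hx
          rw [show (5 : ℝ) = 4 + 1 by norm_num,
            ENNReal.rpow_add_of_nonneg _ _ (by norm_num) (by norm_num), ENNReal.rpow_one]
          gcongr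
      _ = (M : ℝ≥0∞) ^ (4 : ℝ) * ∫⁻ x, ρ x := lintegral_const_mul _ hρ
      _ ≤ (M : ℝ≥0∞) ^ (4 : ℝ) * 1 := by gcongr
      _ = _ := mul_one _
  · have hq0 : q ≠ 0 := (lt_trans (by norm_num) hq).ne'
    have hr : 4 < q.toReal := by
      have := (ENNReal.toReal_lt_toReal (by norm_num) hq').2 hq
      simpa using this
    refine ⟨q.toReal, (M : ℝ≥0∞) ^ q.toReal, hr,
      ENNReal.rpow_lt_top_of_nonneg (by linarith) ENNReal.coe_ne_top, fun ρ _ _ hM => ?_⟩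
    rw [eLpNorm_eq_lintegral_rpow_enorm_toReal hq0 hq'] at hM
    have h2 := ENNReal.rpow_le_rpow hM (by linarith : 0 ≤ q.toReal)
    rw [← ENNReal.rpow_mul, one_div_mul_cancel (by linarith), ENNReal.rpow_one] at h2
    simpa using h2

/-- A uniform bound for the potential of a probability density in `L^q`, `q > 4`. -/
theorem exists_potential_bound {q : ℝ≥0∞} (hq : 4 < q) (M : ℝ≥0) :
    ∃ B : ℝ, ∀ μ : Measure E3, IsProbabilityMeasure μ → μ ≪ volume →
      eLpNorm (μ.rnDeriv volume) q volume ≤ M → ∀ ε : ℝ, 0 < ε → ∀ x : E3,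
        ∫ y, regNorm ε (x - y) ^ (-(9 / 4) : ℝ) ∂μ ≤ B := by
  obtain ⟨r, N, hr, hN, hrN⟩ := exists_lintegral_rpow_le hq M
  set r' := Real.conjExponent r with hr'
  have hconj : r'.HolderConjugate r := (Real.HolderConjugate.conjExponent (by linarith)).symm
  -- The threshold `4` originates here: `r > 4` means `r' < 4/3`, hence `|z|^(-(9/4) r')` is
  -- integrable near the origin of a three-dimensional space.
  have hr'4 : (9 / 4) * r' < 3 := by
    rw [hr', Real.conjExponent, mul_div_assoc', div_lt_iff₀ (by linarith)]; linarith
  set H := ∫⁻ z in Metric.ball (0 : E3) 1, ENNReal.ofReal (‖z‖ ^ (-((9 / 4) * r'))) with hH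
  have hHfin : H < ⊤ := lintegral_ball_norm_rpow_lt_top hr'4
  refine ⟨(1 + (H + N)).toReal, fun μ hμ hac hM ε hε x => ?_⟩
  set ρ := μ.rnDeriv volume with hρdef
  have hρ : Measurable ρ := Measure.measurable_rnDeriv _ _
  have hμρ : volume.withDensity ρ = μ := Measure.withDensity_rnDeriv_eq _ _ hac
  have hρ1 : ∫⁻ y, ρ y ≤ 1 := by
    have := Measure.lintegral_rnDeriv_le (μ := μ) (ν := (volume : Measure E3))
    rwa [measure_univ] at this
  have hm : Measurable fun y : E3 => regNorm ε (x - y) ^ (-(9 / 4) : ℝ) :=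
    (continuous_regNorm_rpow hε _).measurable.comp (measurable_const.sub measurable_id)
  rw [integral_eq_lintegral_of_nonneg_ae (Eventually.of_forall fun y =>
    Real.rpow_nonneg (regNorm_pos hε _).le _) hm.aestronglyMeasurable]
  refine ENNReal.toReal_mono (by finiteness) ?_
  set h : E3 → ℝ≥0∞ := fun z => (Metric.ball (0 : E3) 1).indicator
    (fun z => ENNReal.ofReal (‖z‖ ^ (-(9 / 4) : ℝ))) z with hh
  have hhm : Measurable h := by
    refine Measurable.indicator ?_ measurableSet_ball
    fun_prop
  have hhxm : Measurable fun y => h (x - y) := hhm.comp (measurable_const.sub measurable_id)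
  have hpt : ∀ᵐ y ∂μ, ENNReal.ofReal (regNorm ε (x - y) ^ (-(9 / 4) : ℝ)) ≤ 1 + h (x - y) := by
    -- At `y = x` the convention `0 ^ (-9/4) = 0` would break the comparison; absolute continuity
    -- makes this point negligible.
    have hne : ∀ᵐ y ∂μ, y ≠ x := hac.ae_le (compl_mem_ae_iff.2 (measure_singleton x))
    filter_upwards [hne] with y hy
    have hpos : 0 < ‖x - y‖ := norm_pos_iff.2 (sub_ne_zero.2 (Ne.symm hy))
    have hle := norm_le_regNorm ε (x - y)
    by_cases hb : ‖x - y‖ < 1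
    · have hmem : x - y ∈ Metric.ball (0 : E3) 1 := by simpa using hb
      rw [hh]
      simp only [indicator_of_mem hmem]
      refine le_add_left (ENNReal.ofReal_le_ofReal ?_)
      exact Real.rpow_le_rpow_of_nonpos hpos hle (by norm_num)
    · refine le_add_right ?_
      rw [← ENNReal.ofReal_one]
      refine ENNReal.ofReal_le_ofReal ?_
      exact Real.rpow_le_one_of_one_le_of_nonpos (by linarith) (by norm_num)
  calc ∫⁻ y, ENNReal.ofReal (regNorm ε (x - y) ^ (-(9 / 4) : ℝ)) ∂μ
      ≤ ∫⁻ y, (1 + h (x - y)) ∂μ := lintegral_mono_ae hpt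
    _ = 1 + ∫⁻ y, h (x - y) ∂μ := by
        rw [lintegral_add_left measurable_const]; simp
    _ ≤ 1 + (H + N) := by
        gcongr
        rw [← hμρ, lintegral_withDensity_eq_lintegral_mul _ hρ hhxm]
        calc ∫⁻ y, ρ y * h (x - y) ≤ ∫⁻ y, (h (x - y) ^ r' + ρ y ^ r) := by
              refine lintegral_mono fun y => ?_
              rw [mul_comm]
              refine (ENNReal.young_inequality _ _ hconj).trans ?_
              gcongr
              · refine ENNReal.div_le_of_le_mul ?_
                refine le_mul_of_one_le_right' ?_
                rw [← ENNReal.ofReal_one]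
                exact ENNReal.ofReal_le_ofReal hconj.lt.le
              · refine ENNReal.div_le_of_le_mul ?_
                refine le_mul_of_one_le_right' ?_
                rw [← ENNReal.ofReal_one]
                exact ENNReal.ofReal_le_ofReal (by linarith)
          _ = (∫⁻ y, h (x - y) ^ r') + ∫⁻ y, ρ y ^ r :=
              lintegral_add_left (hhxm.pow_const _) _
          _ ≤ H + N := by
              refine add_le_add (le_of_eq ?_) (hrN ρ hρ hρ1 hM)
              rw [lintegral_sub_left_eq_self (fun y => h y ^ r') x, hH,
                ← lintegral_indicator measurableSet_ball]
              refine lintegral_congr fun y => ?_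
              rw [hh]
              by_cases hy : y ∈ Metric.ball (0 : E3) 1
              · simp only [indicator_of_mem hy]
                rw [ENNReal.ofReal_rpow_of_nonneg (by positivity) hconj.nonneg,
                  ← Real.rpow_mul (norm_nonneg _)]
                congr 2; ring
              · simp only [indicator_of_notMem hy]
                exact ENNReal.zero_rpow_of_pos hconj.pos

end Potential

/-! ### Continuous fields in W^{1,∞} are Lipschitz with the expected constant. -/

section Lipschitz

lemma norm_le_of_ae_norm_le {u : E3 → E3} (hu : Continuous u) {c : ℝ}
    (h : ∀ᵐ x, ‖u x‖ ≤ c) (x : E3) : ‖u x‖ ≤ c := by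
  by_contra hx
  have hopen : IsOpen {x | c < ‖u x‖} := isOpen_lt continuous_const hu.norm
  have hzero : volume {x | c < ‖u x‖} = 0 := by
    rw [ae_iff] at h
    simpa only [not_le] using h
  have := (hopen.measure_eq_zero_iff volume).1 hzero
  have hmem : x ∈ {x | c < ‖u x‖} := not_le.1 hx
  rw [this] at hmem
  exact hmem

/-- The derivative of a mollification of `u` is the mollification of `G`, so it is bounded by `c`.
The mean value inequality applies to each mollification and passes to the limit by continuity of
`u`. -/
lemma norm_sub_le_of_hasWeakGradient {u : E3 → E3} (hu : Continuous u) {G : E3 → E3 →L[ℝ] E3}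
    (hG : HasWeakGradient u G) {c : ℝ} (hc : 0 ≤ c) (hGc : ∀ᵐ x, ‖G x‖ ≤ c) (x y : E3) :
    ‖u x - u y‖ ≤ c * ‖x - y‖ := by
  set φ : ℕ → ContDiffBump (0 : E3) := fun n =>
    ⟨1 / (2 * (n + 1)), 1 / (n + 1), by positivity, by
      rw [div_lt_div_iff₀ (by positivity) (by positivity)]; nlinarith [(n.cast_nonneg : (0:ℝ) ≤ n)]⟩
    with hφ
  have hφ0 : Tendsto (fun n => (φ n).rOut) atTop (𝓝 0) := tendsto_one_div_add_atTop_nhds_zero_nat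
  have hconv : ∀ z, Tendsto (fun n => (convolution ((φ n).normed volume) u
      (ContinuousLinearMap.lsmul ℝ ℝ) volume) z) atTop (𝓝 (u z)) := fun z =>
    ContDiffBump.convolution_tendsto_right_of_continuous hφ0 hu z
  have hlip : ∀ n, ‖(convolution ((φ n).normed volume) u (ContinuousLinearMap.lsmul ℝ ℝ) volume) x
      - (convolution ((φ n).normed volume) u (ContinuousLinearMap.lsmul ℝ ℝ) volume) y‖
      ≤ c * ‖x - y‖ := by
    intro n
    set η := (φ n).normed (volume : Measure E3) with hη
    have hηs : ContDiff ℝ ∞ η := (φ n).contDiff_normed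
    have hηc : HasCompactSupport η := (φ n).hasCompactSupport_normed
    have hd := fun z => hηc.hasFDerivAt_convolution_left (ContinuousLinearMap.lsmul ℝ ℝ)
      (hηs.of_le (by exact_mod_cast le_top)) (hu.locallyIntegrable (μ := volume)) z
    refine Convex.norm_image_sub_le_of_norm_hasFDerivWithin_le
      (f := convolution η u (ContinuousLinearMap.lsmul ℝ ℝ) volume)
      (fun z _ => (hd z).hasFDerivWithinAt) (fun z _ => ?_) convex_univ (mem_univ y) (mem_univ x)
    refine ContinuousLinearMap.opNorm_le_bound _ hc fun e => ?_
    have hint : ConvolutionExistsAt (fderiv ℝ η) u z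
        ((ContinuousLinearMap.lsmul ℝ ℝ : ℝ →L[ℝ] E3 →L[ℝ] E3).precompL E3) volume :=
      (hηc.fderiv ℝ).convolutionExists_left _ (hηs.continuous_fderiv (by simp))
        (hu.locallyIntegrable) z
    have hval : (convolution (fderiv ℝ η) u
        ((ContinuousLinearMap.lsmul ℝ ℝ : ℝ →L[ℝ] E3 →L[ℝ] E3).precompL E3) volume z) e
        = ∫ t, η (z - t) • G t e := by
      rw [convolution, ContinuousLinearMap.integral_apply hint,
        ← integral_sub_left_eq_self _ volume z]
      have hψ : ContDiff ℝ ∞ fun t => η (z - t) := hηs.comp (contDiff_const.sub contDiff_id)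
      have hψc : HasCompactSupport fun t => η (z - t) :=
        hηc.comp_homeomorph (Homeomorph.subLeft z)
      rw [hG.2.2 _ hψ hψc e, ← integral_neg]
      refine integral_congr_ae (Eventually.of_forall fun t => ?_)
      have hdη : HasFDerivAt (fun t => η (z - t))
          ((fderiv ℝ η (z - t)).comp (-ContinuousLinearMap.id ℝ E3)) t :=
        ((hηs.differentiable (by simp)) (z - t)).hasFDerivAt.comp t
          ((hasFDerivAt_id t).const_sub z)
      simp [hdη.fderiv, ContinuousLinearMap.precompL_apply]
    rw [hval]
    have hηi : Integrable (fun t => η (z - t)) := ((φ n).integrable_normed).comp_sub_left z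
    calc _ ≤ ∫ t, η (z - t) * (c * ‖e‖) := by
          refine norm_integral_le_of_norm_le (hηi.mul_const _) ?_
          filter_upwards [hGc] with t ht
          rw [norm_smul, Real.norm_of_nonneg ((φ n).nonneg_normed _)]
          refine mul_le_mul_of_nonneg_left ?_ ((φ n).nonneg_normed _)
          exact (ContinuousLinearMap.le_opNorm _ _).trans (by gcongr)
      _ = _ := by
          rw [integral_mul_const, integral_sub_left_eq_self η volume z, hη,
            (φ n).integral_normed, one_mul]
  exact le_of_tendsto ((hconv x).sub (hconv y)).norm (Eventually.of_forall hlip)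

theorem norm_le_and_lipschitz_of_W1inftyNorm_le {u : E3 → E3} (hu : Continuous u) {M : ℝ≥0}
    (h : W1inftyNorm u ≤ M) : (∀ x, ‖u x‖ ≤ M) ∧ ∀ x y, ‖u x - u y‖ ≤ M * ‖x - y‖ := by
  -- The norm is an infimum over gradients, so a slack `δ` selects one gradient without invoking its
  -- uniqueness.
  have key : ∀ δ : ℝ≥0, 0 < δ → (∀ x, ‖u x‖ ≤ M + δ) ∧ ∀ x y, ‖u x - u y‖ ≤ (M + δ) * ‖x - y‖ := by
    intro δ hδ
    have hlt : W1inftyNorm u < ((M + δ : ℝ≥0) : ℝ≥0∞) :=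
      h.trans_lt (by exact_mod_cast lt_add_of_pos_right M hδ)
    unfold W1inftyNorm at hlt
    simp only [iInf_lt_iff] at hlt
    obtain ⟨G, hG, hlt⟩ := hlt
    have h1 : eLpNorm u ∞ volume ≤ ((M + δ : ℝ≥0) : ℝ≥0∞) := le_self_add.trans hlt.le
    have h2 : eLpNorm G ∞ volume ≤ ((M + δ : ℝ≥0) : ℝ≥0∞) := le_add_self.trans hlt.le
    rw [eLpNorm_exponent_top] at h1 h2
    have a1 : ∀ᵐ x, ‖u x‖ ≤ M + δ := by
      filter_upwards [ae_le_eLpNormEssSup (f := u) (μ := (volume : Measure E3))] with x hx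
      have := hx.trans h1
      rw [enorm_le_coe] at this
      exact_mod_cast this
    have a2 : ∀ᵐ x, ‖G x‖ ≤ M + δ := by
      filter_upwards [ae_le_eLpNormEssSup (f := G) (μ := (volume : Measure E3))] with x hx
      have := hx.trans h2
      rw [enorm_le_coe] at this
      exact_mod_cast this
    exact ⟨norm_le_of_ae_norm_le hu a1,
      norm_sub_le_of_hasWeakGradient hu hG (by positivity) a2⟩
  constructor
  · intro x
    refine le_of_forall_pos_le_add fun δ hδ => ?_
    exact (key ⟨δ, hδ.le⟩ hδ).1 x
  · intro x y
    refine le_of_forall_pos_le_add fun δ hδ => ?_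
    have hpos : 0 < δ / (‖x - y‖ + 1) := by positivity
    refine ((key ⟨δ / (‖x - y‖ + 1), hpos.le⟩ hpos).2 x y).trans ?_
    change ((M : ℝ) + δ / (‖x - y‖ + 1)) * _ ≤ _
    rw [add_mul]
    gcongr
    rw [div_mul_eq_mul_div, div_le_iff₀ (by positivity)]
    nlinarith [norm_nonneg (x - y)]

end Lipschitz

/-! ### Integration by parts against the weak gradient. -/

section WeakForm

variable {u : E3 → E3} {G : E3 → E3 →L[ℝ] E3}

lemma HasWeakGradient.integrable_smul (hG : HasWeakGradient u G) {ζ : E3 → ℝ}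
    (hζ : Continuous ζ) (hc : HasCompactSupport ζ) : Integrable (fun x => ζ x • u x) :=
  hG.1.integrable_smul_left_of_hasCompactSupport hζ hc

lemma HasWeakGradient.integrable_smul_gradient (hG : HasWeakGradient u G) {ζ : E3 → ℝ}
    (hζ : Continuous ζ) (hc : HasCompactSupport ζ) (e : E3) :
    Integrable (fun x => ζ x • G x e) :=
  (ContinuousLinearMap.apply ℝ E3 e).integrable_comp
    (hG.2.1.integrable_smul_left_of_hasCompactSupport hζ hc)

lemma HasWeakGradient.integral_coord (hG : HasWeakGradient u G) {ζ : E3 → ℝ}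
    (hζ : ContDiff ℝ ∞ ζ) (hc : HasCompactSupport ζ) (e : E3) (j : Fin 3) :
    ∫ x, ζ x * G x e j = - ∫ x, fderiv ℝ ζ x e * u x j := by
  have hd : Continuous fun x => fderiv ℝ ζ x e :=
    (hζ.continuous_fderiv (by simp)).clm_apply continuous_const
  have h := congrArg (EuclideanSpace.proj (𝕜 := ℝ) j) (hG.2.2 ζ hζ hc e)
  rw [map_neg, ← ContinuousLinearMap.integral_comp_comm _
    (hG.integrable_smul_gradient hζ.continuous hc e), ← ContinuousLinearMap.integral_comp_comm _
    (hG.integrable_smul hd (hc.fderiv_apply ℝ e))] at h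
  simpa using h

/-- A second integration by parts, `∫ ∇u : ∇φ = -∫ u · Δφ`, removes the gradient of `u` from the
weak equation. -/
lemma HasWeakGradient.integral_frob (hG : HasWeakGradient u G) {φ : E3 → E3}
    (hφ : ContDiff ℝ ∞ φ) (hc : HasCompactSupport φ) :
    ∫ x, frob (G x) (fderiv ℝ φ x) = - ∫ x, inner ℝ (u x) (∑ i : Fin 3,
      fderiv ℝ (fun y => fderiv ℝ φ y (EuclideanSpace.single i 1)) x
        (EuclideanSpace.single i 1)) := by
  set b : Fin 3 → E3 := fun i => EuclideanSpace.single i 1 with hb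
  set D : Fin 3 → E3 → E3 := fun i y => fderiv ℝ φ y (b i) with hD
  have hDs : ∀ i, ContDiff ℝ ∞ (D i) := fun i =>
    (hφ.fderiv_right (m := ∞) (by simp)).clm_apply contDiff_const
  have hDc : ∀ i, HasCompactSupport (D i) := fun i => hc.fderiv_apply ℝ (b i)
  set Z : Fin 3 → Fin 3 → E3 → ℝ := fun i j y => D i y j with hZ
  have hZs : ∀ i j, ContDiff ℝ ∞ (Z i j) := fun i j =>
    (EuclideanSpace.proj (𝕜 := ℝ) j).contDiff.comp (hDs i)
  have hZc : ∀ i j, HasCompactSupport (Z i j) := fun i j =>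
    (hDc i).comp_left (g := EuclideanSpace.proj (𝕜 := ℝ) j) (map_zero _)
  have hZd : ∀ i j x, fderiv ℝ (Z i j) x (b i) = (fderiv ℝ (D i) x (b i)) j := by
    intro i j x
    have h1 := ((hDs i).differentiable (by simp) x).hasFDerivAt
    have h2 := (EuclideanSpace.proj (𝕜 := ℝ) j).hasFDerivAt.comp x h1
    have h3 : HasFDerivAt (Z i j) _ x := h2
    rw [h3.fderiv]
    rfl
  have i1 : ∀ i j, Integrable (fun x => Z i j x * G x (b i) j) := fun i j =>
    (EuclideanSpace.proj (𝕜 := ℝ) j).integrable_comp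
      (hG.integrable_smul_gradient (hZs i j).continuous (hZc i j) (b i))
  have i2 : ∀ i j, Integrable (fun x => fderiv ℝ (Z i j) x (b i) * u x j) := fun i j =>
    (EuclideanSpace.proj (𝕜 := ℝ) j).integrable_comp
      (hG.integrable_smul (((hZs i j).continuous_fderiv (by simp)).clm_apply continuous_const)
        ((hZc i j).fderiv_apply ℝ (b i)))
  have e1 : (fun x => frob (G x) (fderiv ℝ φ x)) = fun x => ∑ i, ∑ j, Z i j x * G x (b i) j := by
    funext x
    unfold frob
    refine Finset.sum_congr rfl fun i _ => ?_
    simp only [PiLp.inner_apply, RCLike.inner_apply, conj_trivial]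
    rfl
  have e2 : (fun x => (inner ℝ (u x) (∑ i : Fin 3, fderiv ℝ (D i) x (b i)) : ℝ))
      = fun x => ∑ i, ∑ j, fderiv ℝ (Z i j) x (b i) * u x j := by
    funext x
    rw [inner_sum]
    refine Finset.sum_congr rfl fun i _ => ?_
    simp only [PiLp.inner_apply, RCLike.inner_apply, conj_trivial, hZd]
  change ∫ x, frob (G x) (fderiv ℝ φ x)
    = - ∫ x, inner ℝ (u x) (∑ i : Fin 3, fderiv ℝ (D i) x (b i))
  rw [e1, e2, integral_finsetSum _ fun i _ => integrable_finsetSum _ fun j _ => i1 i j,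
    integral_finsetSum _ fun i _ => integrable_finsetSum _ fun j _ => i2 i j,
    ← Finset.sum_neg_distrib]
  refine Finset.sum_congr rfl fun i _ => ?_
  rw [integral_finsetSum _ fun j _ => i1 i j, integral_finsetSum _ fun j _ => i2 i j,
    ← Finset.sum_neg_distrib]
  exact Finset.sum_congr rfl fun j _ => hG.integral_coord (hZs i j) (hZc i j) (b i) j

/-- A divergence-free field is orthogonal to gradients of test functions. This eliminates the
gradient part of `Δφ` in `IsWeakBrinkmanSolution.integral_radial`. -/
lemma HasWeakGradient.integral_fderiv_eq_zero (hG : HasWeakGradient u G)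
    (htr : ∀ᵐ x, tr (G x) = 0) {θ : E3 → ℝ} (hθ : ContDiff ℝ ∞ θ) (hc : HasCompactSupport θ) :
    Integrable (fun x => fderiv ℝ θ x (u x)) ∧ ∫ x, fderiv ℝ θ x (u x) = 0 := by
  set b : Fin 3 → E3 := fun i => EuclideanSpace.single i 1 with hb
  have i1 : ∀ i, Integrable (fun x => θ x * G x (b i) i) := fun i =>
    (EuclideanSpace.proj (𝕜 := ℝ) i).integrable_comp
      (hG.integrable_smul_gradient hθ.continuous hc (b i))
  have i2 : ∀ i, Integrable (fun x => fderiv ℝ θ x (b i) * u x i) := fun i =>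
    (EuclideanSpace.proj (𝕜 := ℝ) i).integrable_comp
      (hG.integrable_smul ((hθ.continuous_fderiv (by simp)).clm_apply continuous_const)
        (hc.fderiv_apply ℝ (b i)))
  have e1 : ∀ x, fderiv ℝ θ x (u x) = ∑ i, fderiv ℝ θ x (b i) * u x i := by
    intro x
    conv_lhs => rw [← (EuclideanSpace.basisFun (Fin 3) ℝ).sum_repr (u x)]
    simp [hb, mul_comm]
  have e2 : ∫ x, ∑ i, θ x * G x (b i) i = 0 := by
    rw [← integral_zero E3 ℝ]
    refine integral_congr_ae ?_
    filter_upwards [htr] with x hx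
    rw [← Finset.mul_sum]
    unfold tr at hx
    rw [hx, mul_zero]
  simp only [e1]
  refine ⟨integrable_finsetSum _ fun i _ => i2 i, ?_⟩
  rw [integral_finsetSum _ fun i _ => i2 i]
  rw [integral_finsetSum _ fun i _ => i1 i] at e2
  have : ∀ i, ∫ x, fderiv ℝ θ x (b i) * u x i = - ∫ x, θ x * G x (b i) i := fun i => by
    rw [hG.integral_coord hθ hc (b i) i, neg_neg]
  simp only [this, Finset.sum_neg_distrib, e2, neg_zero]

end WeakForm

/-! ### Divergence-free test fields built from radial functions. -/

section Radial

/-- `a` is a family of successive derivatives on `(-δ, ∞)`, vanishing far away. -/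
structure IsRadialProfile (δ b : ℝ) (a : ℕ → ℝ → ℝ) : Prop where
  pos : 0 < δ
  contDiffOn : ∀ k, ContDiffOn ℝ ∞ (a k) (Ioi (-δ))
  hasDerivAt : ∀ k, ∀ s ∈ Ioi (-δ), HasDerivAt (a k) (a (k + 1) s) s
  eq_zero : ∀ k s, b < s → a k s = 0

lemma hasFDerivAt_norm_sub_sq (x₀ x : E3) :
    HasFDerivAt (fun x : E3 => ‖x - x₀‖ ^ 2) ((2 : ℝ) • innerSL ℝ (x - x₀)) x := by
  have h0 := HasFDerivAt.norm_sq ((hasFDerivAt_id x).sub_const x₀)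
  rwa [ContinuousLinearMap.comp_id, two_smul, ← two_smul ℝ] at h0

variable {δ b : ℝ} {a : ℕ → ℝ → ℝ} (ha : IsRadialProfile δ b a) (x₀ e : E3)

include ha in
lemma IsRadialProfile.mem (x : E3) : ‖x - x₀‖ ^ 2 ∈ Ioi (-δ) :=
  lt_of_lt_of_le (neg_lt_zero.2 ha.pos) (sq_nonneg _)

include ha in
lemma IsRadialProfile.contDiff (k : ℕ) : ContDiff ℝ ∞ fun x : E3 => a k (‖x - x₀‖ ^ 2) := by
  have h : ContDiff ℝ ∞ fun x : E3 => ‖x - x₀‖ ^ 2 := (contDiff_id.sub contDiff_const).norm_sq ℝ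
  exact (ha.contDiffOn k).comp_contDiff h (ha.mem x₀)

include ha in
lemma IsRadialProfile.hasFDerivAt (k : ℕ) (x : E3) :
    HasFDerivAt (fun x : E3 => a k (‖x - x₀‖ ^ 2))
      ((2 * a (k + 1) (‖x - x₀‖ ^ 2)) • innerSL ℝ (x - x₀)) x := by
  have := (ha.hasDerivAt k _ (ha.mem x₀ x)).comp_hasFDerivAt x (hasFDerivAt_norm_sub_sq x₀ x)
  rw [smul_smul] at this
  rw [mul_comm]
  exact this

lemma hasFDerivAt_inner_sub (x : E3) :
    HasFDerivAt (fun x : E3 => (inner ℝ (x - x₀) e : ℝ)) (innerSL ℝ e) x := by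
  have h : (fun x : E3 => (inner ℝ (x - x₀) e : ℝ)) = fun x => innerSL ℝ e (x - x₀) := by
    funext x; simp [real_inner_comm]
  rw [h]
  exact (innerSL ℝ e).hasFDerivAt.comp x ((hasFDerivAt_id x).sub_const x₀)

/-- The double curl of `h(|x - x₀|²) e`, where `h' = a 0`. -/
def radialField (a : ℕ → ℝ → ℝ) (x₀ e x : E3) : E3 :=
  (-(4 * a 0 (‖x - x₀‖ ^ 2) + 4 * (‖x - x₀‖ ^ 2 * a 1 (‖x - x₀‖ ^ 2)))) • e
    + (4 * (a 1 (‖x - x₀‖ ^ 2) * inner ℝ (x - x₀) e)) • (x - x₀)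

/-- The derivative of `radialField` in the direction `h`. -/
def radialFieldDeriv (a : ℕ → ℝ → ℝ) (x₀ e h x : E3) : E3 :=
  (-((16 * a 1 (‖x - x₀‖ ^ 2) + 8 * (‖x - x₀‖ ^ 2 * a 2 (‖x - x₀‖ ^ 2))) *
      inner ℝ (x - x₀) h)) • e
    + (8 * (a 2 (‖x - x₀‖ ^ 2) * (inner ℝ (x - x₀) h * inner ℝ (x - x₀) e))
      + 4 * inner ℝ h e * a 1 (‖x - x₀‖ ^ 2)) • (x - x₀)
    + (4 * (a 1 (‖x - x₀‖ ^ 2) * inner ℝ (x - x₀) e)) • h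

include ha in
lemma IsRadialProfile.contDiff_radialField : ContDiff ℝ ∞ (radialField a x₀ e) := by
  have h0 := ha.contDiff x₀ 0
  have h1 := ha.contDiff x₀ 1
  unfold radialField
  have hs : ContDiff ℝ ∞ fun x : E3 => ‖x - x₀‖ ^ 2 := (contDiff_id.sub contDiff_const).norm_sq ℝ
  have hz : ContDiff ℝ ∞ fun x : E3 => x - x₀ := contDiff_id.sub contDiff_const
  have hq : ContDiff ℝ ∞ fun x : E3 => (inner ℝ (x - x₀) e : ℝ) := hz.inner ℝ contDiff_const
  exact (((contDiff_const.mul h0).add (contDiff_const.mul (hs.mul h1))).neg.smul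
    contDiff_const).add ((contDiff_const.mul (h1.mul hq)).smul hz)

include ha in
lemma IsRadialProfile.hasCompactSupport {F : Type*} [Zero F] {f : E3 → F}
    (hf : ∀ x, (∀ k, a k (‖x - x₀‖ ^ 2) = 0) → f x = 0) : HasCompactSupport f := by
  refine HasCompactSupport.intro (isCompact_closedBall x₀ (Real.sqrt b)) fun x hx => ?_
  refine hf x fun k => ha.eq_zero k _ ?_
  rw [Metric.mem_closedBall, not_le, dist_eq_norm] at hx
  exact (Real.sqrt_lt' ((Real.sqrt_nonneg _).trans_lt hx)).1 hx

include ha in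
lemma IsRadialProfile.fderiv_radialField (h x : E3) :
    fderiv ℝ (radialField a x₀ e) x h = radialFieldDeriv a x₀ e h x := by
  have d0 := ha.hasFDerivAt x₀ 0 x
  have d1 := ha.hasFDerivAt x₀ 1 x
  have ds := hasFDerivAt_norm_sub_sq x₀ x
  have dq := hasFDerivAt_inner_sub x₀ e x
  have dz : HasFDerivAt (fun x : E3 => x - x₀) (ContinuousLinearMap.id ℝ E3) x :=
    (hasFDerivAt_id x).sub_const x₀
  have hd := (((d0.const_mul 4).add ((ds.mul d1).const_mul 4)).neg.smul_const e).add
    (((d1.mul dq).const_mul 4).smul dz)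
  have hd' : HasFDerivAt (radialField a x₀ e) _ x := hd
  rw [hd'.fderiv]
  unfold radialFieldDeriv
  simp only [add_apply, ContinuousLinearMap.smulRight_apply, Pi.mul_apply,
    neg_apply, smul_apply, innerSL_apply_apply,
    ContinuousLinearMap.id_apply, smul_eq_mul]
  rw [real_inner_comm h e]
  module

include ha in
lemma IsRadialProfile.fderiv_radialFieldDeriv (h x : E3) :
    fderiv ℝ (radialFieldDeriv a x₀ e h) x h =
      (-((48 * a 2 (‖x - x₀‖ ^ 2) + 16 * ‖x - x₀‖ ^ 2 * a 3 (‖x - x₀‖ ^ 2)) *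
          inner ℝ (x - x₀) h ^ 2
        + (16 * a 1 (‖x - x₀‖ ^ 2) + 8 * ‖x - x₀‖ ^ 2 * a 2 (‖x - x₀‖ ^ 2)) * inner ℝ h h)) • e
      + (16 * a 3 (‖x - x₀‖ ^ 2) * inner ℝ (x - x₀) e * inner ℝ (x - x₀) h ^ 2
        + 8 * a 2 (‖x - x₀‖ ^ 2) * inner ℝ (x - x₀) e * inner ℝ h h
        + 16 * a 2 (‖x - x₀‖ ^ 2) * (inner ℝ (x - x₀) h * inner ℝ h e)) • (x - x₀)
      + (16 * a 2 (‖x - x₀‖ ^ 2) * inner ℝ (x - x₀) e * inner ℝ (x - x₀) h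
        + 8 * a 1 (‖x - x₀‖ ^ 2) * inner ℝ h e) • h := by
  have d1 := ha.hasFDerivAt x₀ 1 x
  have d2 := ha.hasFDerivAt x₀ 2 x
  have ds := hasFDerivAt_norm_sub_sq x₀ x
  have dq := hasFDerivAt_inner_sub x₀ e x
  have dp := hasFDerivAt_inner_sub x₀ h x
  have dz : HasFDerivAt (fun x : E3 => x - x₀) (ContinuousLinearMap.id ℝ E3) x :=
    (hasFDerivAt_id x).sub_const x₀
  have hd := (((((d1.const_mul 16).add ((ds.mul d2).const_mul 8)).mul dp).neg.smul_const e).add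
    ((((d2.mul (dp.mul dq)).const_mul 8).add (d1.const_mul (4 * inner ℝ h e))).smul dz)).add
    (((d1.mul dq).const_mul 4).smul_const h)
  have hd' : HasFDerivAt (radialFieldDeriv a x₀ e h) _ x := hd
  rw [hd'.fderiv]
  simp only [add_apply, ContinuousLinearMap.smulRight_apply, Pi.mul_apply, Pi.add_apply,
    neg_apply, smul_apply, innerSL_apply_apply,
    ContinuousLinearMap.id_apply, smul_eq_mul]
  rw [real_inner_comm h e]
  module

include ha in
lemma IsRadialProfile.tr_fderiv_radialField (x : E3) :
    tr (fderiv ℝ (radialField a x₀ e) x) = 0 := by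
  unfold tr
  simp only [ha.fderiv_radialField]
  unfold radialFieldDeriv
  set z := x - x₀
  have hs : ‖z‖ ^ 2 = z 0 ^ 2 + z 1 ^ 2 + z 2 ^ 2 := by
    rw [EuclideanSpace.norm_sq_eq, Fin.sum_univ_three]; simp
  have hq : (inner ℝ z e : ℝ) = z 0 * e 0 + z 1 * e 1 + z 2 * e 2 := by
    simp only [PiLp.inner_apply, Fin.sum_univ_three, RCLike.inner_apply, conj_trivial]; ring
  set A1 := a 1 (‖z‖ ^ 2)
  set A2 := a 2 (‖z‖ ^ 2)
  simp only [EuclideanSpace.inner_single_left, EuclideanSpace.inner_single_right,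
    PiLp.add_apply, PiLp.smul_apply, smul_eq_mul, Fin.sum_univ_three, hq, hs,
    PiLp.single_apply, conj_trivial, map_one, one_mul, if_true]
  ring

include ha in
-- For `h(|x - x₀|²)` with `h' = a 0` this is the identity `Δ curl curl (h e) = ∇(∂ₑ Δh) - (Δ²h) e`.
-- The last parenthesis is the radial form of `Δ²h`, the rest is the gradient of `∂ₑ Δh`.
lemma IsRadialProfile.sum_fderiv_fderiv_radialField (x : E3) :
    ∑ i : Fin 3, fderiv ℝ (fun y => fderiv ℝ (radialField a x₀ e) y (EuclideanSpace.single i 1)) x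
        (EuclideanSpace.single i 1)
      = ((20 * a 1 (‖x - x₀‖ ^ 2) + 8 * (‖x - x₀‖ ^ 2 * a 2 (‖x - x₀‖ ^ 2))) • e
        + ((56 * a 2 (‖x - x₀‖ ^ 2) + 16 * (‖x - x₀‖ ^ 2 * a 3 (‖x - x₀‖ ^ 2))) *
          inner ℝ (x - x₀) e) • (x - x₀))
        - (60 * a 1 (‖x - x₀‖ ^ 2) + 80 * ‖x - x₀‖ ^ 2 * a 2 (‖x - x₀‖ ^ 2)
          + 16 * (‖x - x₀‖ ^ 2) ^ 2 * a 3 (‖x - x₀‖ ^ 2)) • e := by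
  simp only [ha.fderiv_radialField]
  have : ∀ i, fderiv ℝ (fun y => radialFieldDeriv a x₀ e (EuclideanSpace.single i 1) y) x
      (EuclideanSpace.single i 1) = _ := fun i => ha.fderiv_radialFieldDeriv x₀ e _ x
  simp only [this]
  set z := x - x₀
  have hs : ‖z‖ ^ 2 = z 0 ^ 2 + z 1 ^ 2 + z 2 ^ 2 := by
    rw [EuclideanSpace.norm_sq_eq, Fin.sum_univ_three]; simp
  have hq : (inner ℝ z e : ℝ) = z 0 * e 0 + z 1 * e 1 + z 2 * e 2 := by
    simp only [PiLp.inner_apply, Fin.sum_univ_three, RCLike.inner_apply, conj_trivial]; ring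
  set A1 := a 1 (‖z‖ ^ 2)
  set A2 := a 2 (‖z‖ ^ 2)
  set A3 := a 3 (‖z‖ ^ 2)
  ext j
  simp only [EuclideanSpace.inner_single_left, EuclideanSpace.inner_single_right,
    PiLp.add_apply, PiLp.sub_apply, PiLp.smul_apply, smul_eq_mul, Fin.sum_univ_three, hq, hs,
    PiLp.single_apply, conj_trivial, map_one, one_mul, if_true]
  fin_cases j <;> simp <;> ring

/-- Testing the weak Brinkman equation with a radial stream function. -/
theorem IsWeakBrinkmanSolution.integral_radial {μ : Measure Phase} {u : E3 → E3}
    (hu : IsWeakBrinkmanSolution μ u) {δ b : ℝ} {a : ℕ → ℝ → ℝ} (ha : IsRadialProfile δ b a)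
    (x₀ e : E3) :
    ∫ x, (60 * a 1 (‖x - x₀‖ ^ 2) + 80 * ‖x - x₀‖ ^ 2 * a 2 (‖x - x₀‖ ^ 2)
          + 16 * (‖x - x₀‖ ^ 2) ^ 2 * a 3 (‖x - x₀‖ ^ 2)) * inner ℝ (u x) e
      = ∫ z, inner ℝ (z.2 - u z.1) (radialField a x₀ e z.1) ∂μ := by
  obtain ⟨G, hG, -, -, htr, hweak⟩ := hu
  have hφ := ha.contDiff_radialField x₀ e
  have hφc : HasCompactSupport (radialField a x₀ e) := ha.hasCompactSupport x₀ fun x hx => by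
    simp [radialField, hx]
  rw [← hweak _ hφ hφc (ha.tr_fderiv_radialField x₀ e), hG.integral_frob hφ hφc]
  simp only [ha.sum_fderiv_fderiv_radialField]
  set D : E3 → ℝ := fun x => 60 * a 1 (‖x - x₀‖ ^ 2) + 80 * ‖x - x₀‖ ^ 2 * a 2 (‖x - x₀‖ ^ 2)
          + 16 * (‖x - x₀‖ ^ 2) ^ 2 * a 3 (‖x - x₀‖ ^ 2) with hD
  -- `θ` is `∂ₑ Δh`, so the first bracket of the Laplacian is `∇θ`; it drops out because `u` is
  -- divergence free.
  set θ : E3 → ℝ := fun x => (20 * a 1 (‖x - x₀‖ ^ 2) + 8 * (‖x - x₀‖ ^ 2 * a 2 (‖x - x₀‖ ^ 2))) *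
    inner ℝ (x - x₀) e with hθ
  have hs : ContDiff ℝ ∞ fun x : E3 => ‖x - x₀‖ ^ 2 := (contDiff_id.sub contDiff_const).norm_sq ℝ
  have hz : ContDiff ℝ ∞ fun x : E3 => x - x₀ := contDiff_id.sub contDiff_const
  have hq : ContDiff ℝ ∞ fun x : E3 => (inner ℝ (x - x₀) e : ℝ) := hz.inner ℝ contDiff_const
  have hθs : ContDiff ℝ ∞ θ :=
    ((contDiff_const.mul (ha.contDiff x₀ 1)).add
      (contDiff_const.mul (hs.mul (ha.contDiff x₀ 2)))).mul hq
  have hθc : HasCompactSupport θ := ha.hasCompactSupport x₀ fun x hx => by simp [hθ, hx]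
  have hDc : Continuous D :=
    ((continuous_const.mul (ha.contDiff x₀ 1).continuous).add
      ((continuous_const.mul hs.continuous).mul (ha.contDiff x₀ 2).continuous)).add
      ((continuous_const.mul (hs.continuous.pow 2)).mul (ha.contDiff x₀ 3).continuous)
  have hDcs : HasCompactSupport D := ha.hasCompactSupport x₀ fun x hx => by simp [hD, hx]
  have hθd : ∀ x h, fderiv ℝ θ x h = inner ℝ h
      ((20 * a 1 (‖x - x₀‖ ^ 2) + 8 * (‖x - x₀‖ ^ 2 * a 2 (‖x - x₀‖ ^ 2))) • e
        + ((56 * a 2 (‖x - x₀‖ ^ 2) + 16 * (‖x - x₀‖ ^ 2 * a 3 (‖x - x₀‖ ^ 2))) *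
          inner ℝ (x - x₀) e) • (x - x₀)) := by
    intro x h
    have hd := (((ha.hasFDerivAt x₀ 1 x).const_mul 20).add (((hasFDerivAt_norm_sub_sq x₀ x).mul
      (ha.hasFDerivAt x₀ 2 x)).const_mul 8)).mul (hasFDerivAt_inner_sub x₀ e x)
    have hd' : HasFDerivAt θ _ x := hd
    rw [hd'.fderiv]
    simp only [add_apply, smul_apply, Pi.mul_apply, Pi.add_apply, innerSL_apply_apply,
      smul_eq_mul, inner_add_right, inner_smul_right]
    rw [real_inner_comm h e, real_inner_comm h (x - x₀)]
    ring
  obtain ⟨iθ, hdiv⟩ := hG.integral_fderiv_eq_zero htr hθs hθc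
  have iD : Integrable fun x => D x * inner ℝ (u x) e := by
    refine ((innerSL ℝ e).integrable_comp (hG.integrable_smul hDc hDcs)).congr
      (Eventually.of_forall fun x => ?_)
    simp [real_inner_comm]
  have : (fun x => (inner ℝ (u x) (((20 * a 1 (‖x - x₀‖ ^ 2)
        + 8 * (‖x - x₀‖ ^ 2 * a 2 (‖x - x₀‖ ^ 2))) • e
        + ((56 * a 2 (‖x - x₀‖ ^ 2) + 16 * (‖x - x₀‖ ^ 2 * a 3 (‖x - x₀‖ ^ 2))) *
          inner ℝ (x - x₀) e) • (x - x₀)) - D x • e) : ℝ))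
      = fun x => fderiv ℝ θ x (u x) - D x * inner ℝ (u x) e := by
    funext x
    rw [inner_sub_right, ← hθd, inner_smul_right]
  rw [this, integral_sub iθ iD, hdiv]
  ring

end Radial

/-! ### The truncated profile and its rescaling. -/

section Profile

/-- The coefficients of the successive derivatives of `-y^(-1/2)/2`. -/
def profileCoeff : ℕ → ℝ
  | 0 => -(1 / 2)
  | k + 1 => profileCoeff k * (-(1 / 2) - k)

/-- The successive derivatives of a truncation of `-y^(-1/2)/2`. -/
def profile : ℕ → ℝ → ℝ
  | 0 => fun y => -(1 / 2) * (Real.smoothTransition (2 - y) * y ^ (-(1 / 2) : ℝ))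
  | k + 1 => deriv (profile k)

lemma contDiffOn_profile (k : ℕ) : ContDiffOn ℝ ∞ (profile k) (Ioi 0) := by
  induction k with
  | zero =>
    have h : ContDiffOn ℝ ∞ (fun y : ℝ => y ^ (-(1 / 2) : ℝ)) (Ioi 0) := fun y hy =>
      (Real.contDiffAt_rpow_const_of_ne (ne_of_gt hy)).contDiffWithinAt
    exact contDiffOn_const.mul ((Real.smoothTransition.contDiff.comp
      (contDiff_const.sub contDiff_id)).contDiffOn.mul h)
  | succ k ih => exact ih.deriv_of_isOpen isOpen_Ioi (by simp)

lemma hasDerivAt_profile (k : ℕ) {y : ℝ} (hy : 0 < y) :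
    HasDerivAt (profile k) (profile (k + 1) y) y :=
  (((contDiffOn_profile k).differentiableOn (by simp)) y hy).differentiableAt
    (Ioi_mem_nhds hy) |>.hasDerivAt

lemma profile_eq_zero (k : ℕ) {y : ℝ} (hy : 2 < y) : profile k y = 0 := by
  induction k generalizing y with
  | zero => simp [profile, Real.smoothTransition.zero_of_nonpos (by linarith : 2 - y ≤ 0)]
  | succ k ih =>
    have : profile k =ᶠ[𝓝 y] fun _ => 0 := by
      filter_upwards [Ioi_mem_nhds hy] with z hz using ih hz
    simp [profile, this.deriv_eq]

lemma profile_eq (k : ℕ) {y : ℝ} (hy : y ∈ Ioo (0 : ℝ) 1) :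
    profile k y = profileCoeff k * y ^ (-(1 / 2) - k : ℝ) := by
  induction k generalizing y with
  | zero =>
    simp [profile, profileCoeff, Real.smoothTransition.one_of_one_le (by linarith [hy.2] : 1 ≤ 2 - y)]
  | succ k ih =>
    have : profile k =ᶠ[𝓝 y] fun y => profileCoeff k * y ^ (-(1 / 2) - k : ℝ) := by
      filter_upwards [isOpen_Ioo.mem_nhds hy] with z hz using ih hz
    have h2 := (Real.hasDerivAt_rpow_const (p := (-(1 / 2) - k : ℝ))
      (Or.inl hy.1.ne')).const_mul (profileCoeff k)
    simp only [profile, this.deriv_eq, h2.deriv, profileCoeff, Nat.cast_add, Nat.cast_one]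
    rw [mul_assoc]
    ring_nf

/-- On `(0, 1)` the profile is an exact power, on `[1, 2]` compactness suffices, and beyond `2` it
vanishes. A pure power as upper bound is compatible with rescaling, hence uniform in `R` later. -/
lemma exists_profile_bound (k : ℕ) :
    ∃ c, 0 ≤ c ∧ ∀ y, 0 < y → |profile k y| ≤ c * y ^ (-(1 / 2) - k : ℝ) := by
  obtain ⟨c, hc⟩ := (isCompact_Icc (a := (1 : ℝ)) (b := 2)).exists_bound_of_continuousOn
    (f := fun y => profile k y * y ^ (1 / 2 + k : ℝ))
    (((contDiffOn_profile k).continuousOn.mono fun y hy => lt_of_lt_of_le one_pos hy.1).mul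
      (continuousOn_id.rpow_const fun y hy => Or.inl (lt_of_lt_of_le one_pos hy.1).ne'))
  refine ⟨max c |profileCoeff k|, le_max_of_le_right (abs_nonneg _), fun y hy => ?_⟩
  have hp : 0 ≤ y ^ (-(1 / 2) - k : ℝ) := (Real.rpow_pos_of_pos hy _).le
  rcases lt_or_ge y 1 with h1 | h1
  · rw [profile_eq k ⟨hy, h1⟩, abs_mul, abs_of_nonneg hp]
    gcongr
    exact le_max_right _ _
  rcases le_or_gt y 2 with h2 | h2
  · have := hc y ⟨h1, h2⟩
    rw [Real.norm_eq_abs, abs_mul, abs_of_nonneg (Real.rpow_pos_of_pos hy _).le] at this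
    have e : y ^ (1 / 2 + k : ℝ) * y ^ (-(1 / 2) - k : ℝ) = 1 := by
      rw [← Real.rpow_add hy, ← Real.rpow_zero y]; congr 1; ring
    calc |profile k y| = |profile k y| * y ^ (1 / 2 + k : ℝ) * y ^ (-(1 / 2) - k : ℝ) := by
          rw [mul_assoc, e, mul_one]
      _ ≤ _ := by
          gcongr
          exact this.trans (le_max_left _ _)
  · rw [profile_eq_zero k h2, abs_zero]
    exact mul_nonneg (le_max_of_le_right (abs_nonneg _)) hp

/-- The profile rescaled to the length `R` and regularized at the length `ε`. -/
def scaledProfile (R ε : ℝ) (k : ℕ) (s : ℝ) : ℝ :=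
  R⁻¹ * (R⁻¹ ^ 2) ^ k * profile k ((s + ε ^ 2) * R⁻¹ ^ 2)

lemma isRadialProfile_scaledProfile {R ε : ℝ} (hR : 0 < R) (hε : 0 < ε) :
    IsRadialProfile (ε ^ 2) (2 * R ^ 2) (scaledProfile R ε) where
  pos := by positivity
  contDiffOn k := by
    refine contDiffOn_const.mul ((contDiffOn_profile k).comp
      ((contDiff_id.add contDiff_const).mul contDiff_const).contDiffOn fun s hs => ?_)
    have : 0 < s + ε ^ 2 := by linarith [show -ε ^ 2 < s from hs]
    exact mul_pos this (by positivity)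
  hasDerivAt k s hs := by
    have h0 : 0 < s + ε ^ 2 := by linarith [show -ε ^ 2 < s from hs]
    have h1 : HasDerivAt (fun s : ℝ => (s + ε ^ 2) * R⁻¹ ^ 2) (R⁻¹ ^ 2) s := by
      simpa only [one_mul, id_eq] using ((hasDerivAt_id s).add_const (ε ^ 2)).mul_const (R⁻¹ ^ 2)
    have := ((hasDerivAt_profile k (mul_pos h0 (by positivity : 0 < R⁻¹ ^ 2))).comp s h1).const_mul
      (R⁻¹ * (R⁻¹ ^ 2) ^ k)
    refine HasDerivAt.congr_deriv this ?_
    unfold scaledProfile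
    rw [pow_succ]; ring
  eq_zero k s hs := by
    have : 2 < (s + ε ^ 2) * R⁻¹ ^ 2 := by
      rw [inv_pow, ← div_eq_mul_inv, lt_div_iff₀ (by positivity)]
      nlinarith [sq_nonneg ε]
    rw [scaledProfile, profile_eq_zero k this, mul_zero]

/-- The prefactors of `scaledProfile` are chosen so that all powers of `R` cancel on the homogeneous
part. Bounds then hold uniformly in `R`, and where the cutoff is inactive the value does not depend
on `R`. -/
lemma scaledProfile_aux {R f : ℝ} (hR : 0 < R) (hf : 0 < f) (k : ℕ) :
    R⁻¹ * (R⁻¹ ^ 2) ^ k * (f ^ 2 * R⁻¹ ^ 2) ^ (-(1 / 2) - k : ℝ) = f⁻¹ ^ (2 * k + 1) := by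
  have h2 : ((2 : ℕ) : ℝ) * (-(1 / 2) - k) = -((2 * k + 1 : ℕ) : ℝ) := by push_cast; ring
  have h3 : R⁻¹ * (R⁻¹ ^ 2) ^ k = R⁻¹ ^ (2 * k + 1) := by rw [← pow_mul, pow_succ, mul_comm]
  rw [h3, ← mul_pow, ← Real.rpow_natCast (f * R⁻¹) 2, ← Real.rpow_mul (by positivity), h2,
    Real.rpow_neg (by positivity), Real.rpow_natCast, ← inv_pow, ← mul_pow]
  congr 1
  field_simp

lemma abs_scaledProfile_le {k : ℕ} {c : ℝ}
    (hc : ∀ y, 0 < y → |profile k y| ≤ c * y ^ (-(1 / 2) - k : ℝ)) {R ε : ℝ} (hR : 0 < R)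
    (hε : 0 < ε) (z : E3) :
    |scaledProfile R ε k (‖z‖ ^ 2)| ≤ c * (regNorm ε z)⁻¹ ^ (2 * k + 1) := by
  have hf := regNorm_pos hε z
  unfold scaledProfile
  rw [← regNorm_sq, abs_mul, abs_of_nonneg (by positivity), ← scaledProfile_aux hR hf k]
  calc _ ≤ R⁻¹ * (R⁻¹ ^ 2) ^ k * (c * (regNorm ε z ^ 2 * R⁻¹ ^ 2) ^ (-(1 / 2) - k : ℝ)) := by
        gcongr; exact hc _ (by positivity)
    _ = _ := by ring

lemma scaledProfile_eventually_eq {ε : ℝ} (hε : 0 < ε) (k : ℕ) (z : E3) :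
    ∀ᶠ R in atTop, scaledProfile R ε k (‖z‖ ^ 2)
      = profileCoeff k * (regNorm ε z)⁻¹ ^ (2 * k + 1) := by
  have hf := regNorm_pos hε z
  filter_upwards [eventually_gt_atTop (regNorm ε z)] with R hR
  have hR0 := hf.trans hR
  unfold scaledProfile
  rw [← regNorm_sq, profile_eq k, ← scaledProfile_aux hR0 hf k]
  · ring
  · refine ⟨by positivity, ?_⟩
    rw [inv_pow, ← div_eq_mul_inv, div_lt_one (by positivity)]
    exact pow_lt_pow_left₀ hR hf.le two_ne_zero

end Profile

/-! ### Regularized Stokeslet representation of the fluid velocity. -/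

section Representation

lemma integrable_inv_regNorm_pow {ε s : ℝ} (hε : 0 < ε) (hs : 3 < s) :
    Integrable fun x : E3 => regNorm ε x ^ (-s) := by
  have h := (integrable_rpow_neg_one_add_norm_sq (E := E3) (μ := volume) (r := s)
    (by simpa using hs)).const_mul (min 1 ε ^ (-s))
  have hmin : 0 < min 1 ε := lt_min one_pos hε
  refine h.mono' (continuous_regNorm_rpow hε (-s)).aestronglyMeasurable
    (Eventually.of_forall fun x => ?_)
  have hf := regNorm_pos hε x
  rw [Real.norm_of_nonneg (Real.rpow_nonneg hf.le _)]
  have e : (1 + ‖x‖ ^ 2) ^ (-s / 2) = Real.sqrt (1 + ‖x‖ ^ 2) ^ (-s) := by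
    rw [Real.sqrt_eq_rpow, ← Real.rpow_mul (by positivity)]; congr 1; ring
  rw [e, ← Real.mul_rpow hmin.le (Real.sqrt_nonneg _)]
  refine Real.rpow_le_rpow_of_nonpos (by positivity) ?_ (by linarith)
  rw [← Real.sqrt_sq hmin.le, ← Real.sqrt_mul (sq_nonneg _)]
  refine Real.sqrt_le_sqrt ?_
  have h1 : min 1 ε ^ 2 ≤ 1 := by
    calc min 1 ε ^ 2 ≤ 1 ^ 2 := by gcongr; exact min_le_left _ _
      _ = 1 := one_pow 2
  have h2 : min 1 ε ^ 2 ≤ ε ^ 2 := by gcongr; exact min_le_right _ _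
  nlinarith [sq_nonneg ‖x‖]

lemma continuous_radialField {R ε : ℝ} (hR : 0 < R) (hε : 0 < ε) (x₀ e : E3) :
    Continuous (radialField (scaledProfile R ε) x₀ e) :=
  ((isRadialProfile_scaledProfile hR hε).contDiff_radialField x₀ e).continuous

/-- Once `R` exceeds `regNorm ε (x - x₀)` the cutoff equals one, and the coefficients `-1/2` and
`1/4` of the first two profiles, with `‖z‖² = f² - ε²`, reproduce the Stokeslet. -/
lemma radialField_eventually_eq {ε : ℝ} (hε : 0 < ε) (x₀ e x : E3) :
    ∀ᶠ R in atTop, radialField (scaledProfile R ε) x₀ e x = stokeslet ε (x₀ - x) e := by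
  filter_upwards [scaledProfile_eventually_eq hε 0 (x - x₀),
    scaledProfile_eventually_eq hε 1 (x - x₀)] with R h0 h1
  have hf := regNorm_pos hε (x - x₀)
  rw [← neg_sub x x₀, stokeslet_neg_left]
  unfold radialField stokeslet
  rw [h0, h1, eq_sub_of_add_eq (regNorm_sq ε (x - x₀)).symm]
  set f := regNorm ε (x - x₀)
  have e1 : f ^ 2 * f⁻¹ ^ 3 = f⁻¹ := by field_simp
  simp only [profileCoeff, mul_zero, zero_add, pow_one, mul_one, Nat.cast_zero]
  congr 2
  · linear_combination -e1
  · ring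

lemma exists_norm_radialField_le : ∃ c, 0 ≤ c ∧ ∀ {R ε : ℝ}, 0 < R → 0 < ε → ∀ x₀ e x : E3,
    ‖radialField (scaledProfile R ε) x₀ e x‖ ≤ c * ε⁻¹ * ‖e‖ := by
  obtain ⟨c0, hc0, h0⟩ := exists_profile_bound 0
  obtain ⟨c1, hc1, h1⟩ := exists_profile_bound 1
  refine ⟨4 * c0 + 8 * c1, by positivity, fun {R ε} hR hε x₀ e x => ?_⟩
  have b0 := abs_scaledProfile_le h0 hR hε (x - x₀)
  have b1 := abs_scaledProfile_le h1 hR hε (x - x₀)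
  have hf := regNorm_pos hε (x - x₀)
  have hz := norm_le_regNorm ε (x - x₀)
  have hle := le_regNorm (ε := ε) (x - x₀)
  unfold radialField
  set a0 := scaledProfile R ε 0 (‖x - x₀‖ ^ 2)
  set a1 := scaledProfile R ε 1 (‖x - x₀‖ ^ 2)
  set f := regNorm ε (x - x₀)
  set r := ‖x - x₀‖ with hr
  simp only [mul_zero, zero_add, pow_one, mul_one] at b0 b1
  have hin : |(inner ℝ (x - x₀) e : ℝ)| ≤ r * ‖e‖ := abs_real_inner_le_norm _ _
  have hr2 : r ^ 2 * |a1| ≤ c1 * f⁻¹ := by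
    calc r ^ 2 * |a1| ≤ f ^ 2 * (c1 * f⁻¹ ^ (2 + 1)) := by gcongr
      _ = c1 * f⁻¹ := by norm_num only; field_simp
  calc _ ≤ (4 * |a0| + 4 * (r ^ 2 * |a1|)) * ‖e‖ + 4 * (|a1| * (r * ‖e‖)) * r := by
        refine (norm_add_le _ _).trans ?_
        rw [norm_smul, norm_smul, norm_neg, Real.norm_eq_abs, Real.norm_eq_abs, abs_mul, abs_mul]
        gcongr
        · refine (abs_add_le _ _).trans_eq ?_
          simp [abs_mul]
        · norm_num
    _ = (4 * |a0| + 8 * (r ^ 2 * |a1|)) * ‖e‖ := by ring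
    _ ≤ (4 * (c0 * f⁻¹) + 8 * (c1 * f⁻¹)) * ‖e‖ := by gcongr
    _ = (4 * c0 + 8 * c1) * f⁻¹ * ‖e‖ := by ring
    _ ≤ _ := by gcongr

/-- The mollifier produced by the regularized Stokeslet (not normalized). -/
def bump (ε : ℝ) (z : E3) : ℝ := 15 * ε ^ 4 * (regNorm ε z)⁻¹ ^ 7

/-- Regularized Stokeslet representation of weak Brinkman solutions. -/
theorem IsWeakBrinkmanSolution.integral_bump_inner {μ : Measure Phase} {u : E3 → E3}
    (hu : IsWeakBrinkmanSolution μ u) (huc : Continuous u)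
    (hint : Integrable (fun z : Phase => z.2 - u z.1) μ) {ε : ℝ} (hε : 0 < ε) (x₀ e : E3) :
    ∫ x, bump ε (x - x₀) * inner ℝ (u x) e
      = ∫ z, inner ℝ (z.2 - u z.1) (stokeslet ε (x₀ - z.1) e) ∂μ := by
  have hu6 : MemLp u 6 volume := by obtain ⟨G, -, h, -⟩ := hu; exact h
  obtain ⟨c, hc0, hc⟩ := exists_norm_radialField_le
  obtain ⟨c1, hc1, h1⟩ := exists_profile_bound 1
  obtain ⟨c2, hc2, h2⟩ := exists_profile_bound 2
  obtain ⟨c3, hc3, h3⟩ := exists_profile_bound 3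
  have hR : Tendsto (fun R : ℝ => ∫ z, inner ℝ (z.2 - u z.1)
      (radialField (scaledProfile R ε) x₀ e z.1) ∂μ) atTop
      (𝓝 (∫ z, inner ℝ (z.2 - u z.1) (stokeslet ε (x₀ - z.1) e) ∂μ)) := by
    refine tendsto_integral_filter_of_dominated_convergence
      (fun z => ‖z.2 - u z.1‖ * (c * ε⁻¹ * ‖e‖)) ?_ ?_ (hint.norm.mul_const _) ?_
    · filter_upwards [eventually_gt_atTop 0] with R hR
      exact hint.aestronglyMeasurable.inner
        ((continuous_radialField hR hε x₀ e).comp continuous_fst).aestronglyMeasurable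
    · filter_upwards [eventually_gt_atTop 0] with R hR
      refine Eventually.of_forall fun z => (norm_inner_le_norm _ _).trans ?_
      gcongr
      exact hc hR hε _ _ _
    · refine Eventually.of_forall fun z => tendsto_const_nhds.congr' ?_
      filter_upwards [radialField_eventually_eq hε x₀ e z.1] with R h
      rw [h]
  have hL : Tendsto (fun R : ℝ => ∫ x, (60 * scaledProfile R ε 1 (‖x - x₀‖ ^ 2)
        + 80 * ‖x - x₀‖ ^ 2 * scaledProfile R ε 2 (‖x - x₀‖ ^ 2)
        + 16 * (‖x - x₀‖ ^ 2) ^ 2 * scaledProfile R ε 3 (‖x - x₀‖ ^ 2)) * inner ℝ (u x) e) atTop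
      (𝓝 (∫ x, bump ε (x - x₀) * inner ℝ (u x) e)) := by
    refine tendsto_integral_filter_of_dominated_convergence
      (fun x => (60 * c1 + 80 * c2 + 16 * c3) * ‖e‖ *
        (regNorm ε (x - x₀) ^ (-(18 / 5) : ℝ) + ‖u x‖ ^ 6)) ?_ ?_ ?_ ?_
    · filter_upwards [eventually_gt_atTop 0] with R hR
      have ha := isRadialProfile_scaledProfile hR hε
      have d1 := (ha.contDiff x₀ 1).continuous
      have d2 := (ha.contDiff x₀ 2).continuous
      have d3 := (ha.contDiff x₀ 3).continuous
      refine Continuous.aestronglyMeasurable ?_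
      fun_prop
    · filter_upwards [eventually_gt_atTop 0] with R hR
      refine Eventually.of_forall fun x => ?_
      have b1 := abs_scaledProfile_le h1 hR hε (x - x₀)
      have b2 := abs_scaledProfile_le h2 hR hε (x - x₀)
      have b3 := abs_scaledProfile_le h3 hR hε (x - x₀)
      have hf := regNorm_pos hε (x - x₀)
      have hz := norm_le_regNorm ε (x - x₀)
      set a1 := scaledProfile R ε 1 (‖x - x₀‖ ^ 2)
      set a2 := scaledProfile R ε 2 (‖x - x₀‖ ^ 2)
      set a3 := scaledProfile R ε 3 (‖x - x₀‖ ^ 2)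
      set f := regNorm ε (x - x₀)
      set r := ‖x - x₀‖
      have hr0 : 0 ≤ r := norm_nonneg _
      -- Young with exponents `6/5` and `6`: the velocity is globally in `L⁶`, and the dual power
      -- `18/5 > 3` of the kernel is integrable at infinity.
      have hy : f⁻¹ ^ 3 * ‖u x‖ ≤ f ^ (-(18 / 5) : ℝ) + ‖u x‖ ^ 6 := by
        have := Real.young_inequality_of_nonneg (a := f⁻¹ ^ 3) (b := ‖u x‖) (p := 6 / 5) (q := 6)
          (by positivity) (norm_nonneg _) (by constructor <;> norm_num)
        have e1 : (f⁻¹ ^ 3) ^ (6 / 5 : ℝ) = f ^ (-(18 / 5) : ℝ) := by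
          rw [← Real.rpow_natCast, ← Real.rpow_neg_one, ← Real.rpow_mul hf.le,
            ← Real.rpow_mul hf.le]
          congr 1; norm_num
        have e2 : ‖u x‖ ^ (6 : ℝ) = ‖u x‖ ^ 6 := by exact_mod_cast Real.rpow_natCast _ 6
        rw [e1, e2] at this
        have p1 : 0 ≤ f ^ (-(18 / 5) : ℝ) := (Real.rpow_pos_of_pos hf _).le
        have p2 : 0 ≤ ‖u x‖ ^ 6 := by positivity
        linarith
      have k1 : |60 * a1 + 80 * r ^ 2 * a2 + 16 * (r ^ 2) ^ 2 * a3|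
          ≤ (60 * c1 + 80 * c2 + 16 * c3) * f⁻¹ ^ 3 := by
        calc _ ≤ 60 * |a1| + 80 * r ^ 2 * |a2| + 16 * (r ^ 2) ^ 2 * |a3| := by
              refine (abs_add_three _ _ _).trans_eq ?_
              simp [abs_mul]
          _ ≤ 60 * (c1 * f⁻¹ ^ (2 * 1 + 1)) + 80 * f ^ 2 * (c2 * f⁻¹ ^ (2 * 2 + 1))
              + 16 * (f ^ 2) ^ 2 * (c3 * f⁻¹ ^ (2 * 3 + 1)) := by gcongr
          _ = _ := by norm_num only; field_simp
      rw [norm_mul, Real.norm_eq_abs]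
      calc _ ≤ (60 * c1 + 80 * c2 + 16 * c3) * f⁻¹ ^ 3 * (‖u x‖ * ‖e‖) := by
            gcongr
            exact norm_inner_le_norm _ _
        _ = (60 * c1 + 80 * c2 + 16 * c3) * ‖e‖ * (f⁻¹ ^ 3 * ‖u x‖) := by ring
        _ ≤ _ := by gcongr
    · refine Integrable.const_mul ?_ _
      refine Integrable.add ?_ ?_
      · exact (integrable_inv_regNorm_pow hε (by norm_num)).comp_sub_right x₀
      · exact hu6.integrable_norm_pow (by norm_num)
    · refine Eventually.of_forall fun x => tendsto_const_nhds.congr' ?_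
      filter_upwards [scaledProfile_eventually_eq hε 1 (x - x₀),
        scaledProfile_eventually_eq hε 2 (x - x₀),
        scaledProfile_eventually_eq hε 3 (x - x₀)] with R e1 e2 e3
      have hf := regNorm_pos hε (x - x₀)
      rw [e1, e2, e3, eq_sub_of_add_eq (regNorm_sq ε (x - x₀)).symm]
      unfold bump
      set f := regNorm ε (x - x₀)
      -- With coefficients `1/4`, `-3/8`, `15/16` the terms in `f⁻³` and in `ε² f⁻⁵` cancel and `15
      -- ε⁴ f⁻⁷` remains.
      simp only [profileCoeff, Nat.cast_zero, Nat.cast_one, Nat.cast_ofNat]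
      congr 1
      norm_num only
      field_simp
      ring
  refine tendsto_nhds_unique hL (hR.congr' ?_)
  filter_upwards [eventually_gt_atTop 0] with R hR
  exact (hu.integral_radial (isRadialProfile_scaledProfile hR hε) x₀ e).symm

end Representation

/-! ### From the representation to the stability of the Brinkman equation. -/

section FixedTime

lemma continuous_bump {ε : ℝ} (hε : 0 < ε) : Continuous (bump ε) :=
  continuous_const.mul (((continuous_regNorm ε).inv₀ fun z => (regNorm_pos hε z).ne').pow 7)

lemma bump_nonneg (ε : ℝ) (z : E3) : 0 ≤ bump ε z := by
  have : 0 ≤ regNorm ε z := Real.sqrt_nonneg _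
  unfold bump; positivity

lemma bump_smul {ε : ℝ} (hε : 0 < ε) (z : E3) : ε ^ 3 * bump ε (ε • z) = bump 1 z := by
  have h : regNorm ε (ε • z) = ε * regNorm 1 z := by
    unfold regNorm
    rw [norm_smul, Real.norm_of_nonneg hε.le, ← Real.sqrt_sq hε.le, ← Real.sqrt_mul (sq_nonneg _),
      Real.sqrt_sq hε.le]
    congr 1; ring
  have hf := regNorm_pos one_pos z
  unfold bump
  rw [h]
  field_simp

lemma integrable_bump_one : Integrable (bump 1) := by
  refine ((integrable_inv_regNorm_pow one_pos (s := 7) (by norm_num)).const_mul 15).congr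
    (Eventually.of_forall fun x => ?_)
  have hf := regNorm_pos one_pos x
  have : regNorm 1 x ^ (-7 : ℝ) = (regNorm 1 x)⁻¹ ^ 7 := by
    rw [Real.rpow_neg hf.le, inv_pow]; norm_cast
  simp [bump, this]

/-- The mass of the mollifier. -/
def bumpMass : ℝ := ∫ y, bump 1 y

lemma bumpMass_pos : 0 < bumpMass := by
  refine (integral_pos_iff_support_of_nonneg (bump_nonneg 1) integrable_bump_one).2 ?_
  have : Function.support (bump 1) = univ := by
    refine eq_univ_of_forall fun x => ?_
    have hf := regNorm_pos one_pos x
    have : 0 < bump 1 x := by unfold bump; positivity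
    exact this.ne'
  rw [this]
  simp

variable {μ : Measure Phase} {u : E3 → E3}

lemma integrable_bump_smul (huc : Continuous u) {K : ℝ} (huK : ∀ x, ‖u x‖ ≤ K) (ε : ℝ) (x : E3) :
    Integrable fun y => bump 1 y • u (x + ε • y) := by
  refine (integrable_bump_one.mul_const K).mono' ?_ (Eventually.of_forall fun y => ?_)
  · have := continuous_bump one_pos
    exact Continuous.aestronglyMeasurable (by fun_prop)
  · rw [norm_smul, Real.norm_of_nonneg (bump_nonneg _ _)]
    exact mul_le_mul_of_nonneg_left (huK _) (bump_nonneg _ _)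

/-- Symmetry of the kernel moves it onto the force, and scaling by `ε` leaves the fixed mollifier
`bump 1`. For bounded continuous `u`, both the uniform bound and the limit `ε → 0` can then be read
off. -/
theorem IsWeakBrinkmanSolution.stokesletConv_eq [IsProbabilityMeasure μ]
    (hu : IsWeakBrinkmanSolution μ u)
    (huc : Continuous u) {K : ℝ} (huK : ∀ x, ‖u x‖ ≤ K)
    (hint : Integrable (fun z : Phase => z.2 - u z.1) μ) {ε : ℝ} (hε : 0 < ε) (x : E3) :
    stokesletConv μ ε Prod.fst (fun z => z.2 - u z.1) x = ∫ y, bump 1 y • u (x + ε • y) := by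
  refine ext_inner_right ℝ fun e => ?_
  have h1 : (inner ℝ (stokesletConv μ ε Prod.fst (fun z => z.2 - u z.1) x) e : ℝ)
      = ∫ z, inner ℝ (z.2 - u z.1) (stokeslet ε (x - z.1) e) ∂μ := by
    rw [stokesletConv, real_inner_comm, ← integral_inner
      (integrable_stokeslet hε measurable_fst hint x)]
    exact integral_congr_ae (Eventually.of_forall fun z => inner_stokeslet_comm _ _ _ _)
  rw [h1, ← hu.integral_bump_inner huc hint hε x e, real_inner_comm,
    ← integral_inner (integrable_bump_smul huc huK ε x)]
  have h2 := Measure.integral_comp_smul (volume : Measure E3)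
    (fun y => bump ε y * (inner ℝ (u (x + y)) e : ℝ)) ε
  have h3 := integral_add_left_eq_self (μ := (volume : Measure E3))
    (fun y => bump ε (y - x) * (inner ℝ (u y) e : ℝ)) x
  simp only [add_sub_cancel_left] at h3
  rw [← h3]
  have h4 : |(ε ^ Module.finrank ℝ E3)⁻¹| = (ε ^ 3)⁻¹ := by
    rw [finrank_euclideanSpace_fin, abs_of_pos (by positivity)]
  rw [h4, smul_eq_mul] at h2
  have h5 : ∫ y, bump ε y * (inner ℝ (u (x + y)) e : ℝ)
      = ∫ y, ε ^ 3 * (bump ε (ε • y) * (inner ℝ (u (x + ε • y)) e : ℝ)) := by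
    rw [integral_const_mul, h2, mul_inv_cancel_left₀ (by positivity)]
  rw [h5]
  refine integral_congr_ae (Eventually.of_forall fun y => ?_)
  simp only [real_inner_smul_right]
  rw [← mul_assoc, bump_smul hε, real_inner_comm]

theorem IsWeakBrinkmanSolution.tendsto_stokesletConv [IsProbabilityMeasure μ]
    (hu : IsWeakBrinkmanSolution μ u)
    (huc : Continuous u) {K : ℝ} (huK : ∀ x, ‖u x‖ ≤ K)
    (hint : Integrable (fun z : Phase => z.2 - u z.1) μ) (x : E3) :
    Tendsto (fun ε => stokesletConv μ ε Prod.fst (fun z => z.2 - u z.1) x) (𝓝[>] 0)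
      (𝓝 (bumpMass • u x)) := by
  have : Tendsto (fun ε : ℝ => ∫ y, bump 1 y • u (x + ε • y)) (𝓝[>] 0)
      (𝓝 (∫ y, bump 1 y • u x)) := by
    refine tendsto_integral_filter_of_dominated_convergence (fun y => bump 1 y * K)
      (Eventually.of_forall fun ε => (integrable_bump_smul huc huK ε x).aestronglyMeasurable)
      (Eventually.of_forall fun ε => Eventually.of_forall fun y => ?_)
      (integrable_bump_one.mul_const K) (Eventually.of_forall fun y => ?_)
    · rw [norm_smul, Real.norm_of_nonneg (bump_nonneg _ _)]
      exact mul_le_mul_of_nonneg_left (huK _) (bump_nonneg _ _)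
    · have hc : Continuous fun ε : ℝ => bump 1 y • u (x + ε • y) := by fun_prop
      have := hc.tendsto 0
      simp only [zero_smul, add_zero] at this
      exact this.mono_left nhdsWithin_le_nhds
  rw [integral_smul_const] at this
  refine this.congr' ?_
  filter_upwards [self_mem_nhdsWithin] with ε hε
  exact (hu.stokesletConv_eq huc huK hint hε x).symm

theorem IsWeakBrinkmanSolution.norm_stokesletConv_le [IsProbabilityMeasure μ]
    (hu : IsWeakBrinkmanSolution μ u)
    (huc : Continuous u) {K : ℝ} (huK : ∀ x, ‖u x‖ ≤ K)
    (hint : Integrable (fun z : Phase => z.2 - u z.1) μ) {ε : ℝ} (hε : 0 < ε) (x : E3) :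
    ‖stokesletConv μ ε Prod.fst (fun z => z.2 - u z.1) x‖ ≤ bumpMass * K := by
  rw [hu.stokesletConv_eq huc huK hint hε x, bumpMass, ← integral_mul_const]
  refine norm_integral_le_of_norm_le (integrable_bump_one.mul_const K)
    (Eventually.of_forall fun y => ?_)
  rw [norm_smul, Real.norm_of_nonneg (bump_nonneg _ _)]
  exact mul_le_mul_of_nonneg_left (huK _) (bump_nonneg _ _)

lemma stokesletConv_map {γ : Measure (Phase × Phase)} {p : Phase × Phase → Phase}
    (hp : Measurable p) (huc : Continuous u) {ε : ℝ} (hε : 0 < ε) (x : E3) :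
    stokesletConv (γ.map p) ε Prod.fst (fun z => z.2 - u z.1) x
      = stokesletConv γ ε (fun o => (p o).1) (fun o => (p o).2 - u (p o).1) x := by
  have hg : Continuous fun z : Phase => (x - z.1, z.2 - u z.1) := by fun_prop
  have hc : Continuous fun z : Phase => stokeslet ε (x - z.1) (z.2 - u z.1) := by
    have := (continuous_stokeslet hε).comp hg
    simpa only [Function.comp_def] using this
  unfold stokesletConv
  rw [integral_map hp.aemeasurable hc.aestronglyMeasurable]

lemma HasDensityLE.map_fst_absolutelyContinuous {A : ℝ≥0} (h : HasDensityLE A μ) :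
    μ.map Prod.fst ≪ (volume : Measure E3) := by
  have h1 : μ ≪ (volume : Measure Phase) := Measure.AbsolutelyContinuous.mk fun s _ hs => by
    have h1 := Measure.le_iff'.1 h s
    rw [Measure.smul_apply, hs, smul_zero] at h1
    exact le_antisymm h1 zero_le
  have h2 : (volume : Measure Phase).map Prod.fst ≪ (volume : Measure E3) := by
    rw [Measure.volume_eq_prod]
    exact Measure.quasiMeasurePreserving_fst.absolutelyContinuous
  exact (h1.map measurable_fst).trans h2

lemma memLp_snd_of_moment {k : ℝ} (hk : 0 < k) (h : moment k μ < ⊤) :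
    MemLp (Prod.snd : Phase → E3) (ENNReal.ofReal k) μ := by
  refine ⟨measurable_snd.aestronglyMeasurable, ?_⟩
  rw [eLpNorm_lt_top_iff_lintegral_rpow_enorm_lt_top (by simpa using hk) ENNReal.ofReal_ne_top,
    ENNReal.toReal_ofReal hk.le]
  exact h

/-- The fixed-time stability estimate for the Brinkman equation. -/
theorem exists_velocity_difference_bound {q : ℝ≥0∞} (hq : 4 < q) (M : ℝ≥0) :
    ∃ θ C : ℝ, 0 ≤ θ ∧ θ < 1 ∧ 0 ≤ C ∧ ∀ (μ₁ μ₂ : Measure Phase), IsProbabilityMeasure μ₁ →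
      IsProbabilityMeasure μ₂ → ∀ u₁ u₂ : E3 → E3, Continuous u₁ → Continuous u₂ →
      ∀ K : ℝ, (∀ x, ‖u₁ x‖ ≤ K) → IsWeakBrinkmanSolution μ₁ u₁ → IsWeakBrinkmanSolution μ₂ u₂ →
      ∀ A : ℝ≥0, HasDensityLE A μ₁ → HasDensityLE A μ₂ →
      eLpNorm (spatialDensity μ₁) q volume ≤ M → eLpNorm (spatialDensity μ₂) q volume ≤ M →
      W1inftyNorm u₂ ≤ M → moment 9 μ₂ ≤ M → Integrable (Prod.snd : Phase → E3) μ₁ →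
      ∀ γ : Measure (Phase × Phase), IsTransportPlan μ₁ μ₂ γ →
      MemLp (fun o : Phase × Phase => o.1.1 - o.2.1) 2 γ →
      MemLp (fun o : Phase × Phase => o.1.2 - o.2.2) 2 γ →
      MemLp (fun o : Phase × Phase => u₁ o.1.1 - u₂ o.2.1) 2 γ ∧
      l2norm γ (fun o => u₁ o.1.1 - u₂ o.2.1) ≤ θ * l2norm γ (fun o => o.1.2 - o.2.2)
        + C * l2norm γ (fun o => o.1.1 - o.2.1) := by
  obtain ⟨B, hB⟩ := exists_potential_bound hq M
  -- From `(a + b)⁹ ≤ 2⁸ (a⁹ + b⁹)`, with `M` bounding both the ninth moment and the supremum of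
  -- `u₂`.
  set W : ℝ := 2 ^ 8 * (M + (M : ℝ) ^ 9) with hW
  have hm := bumpMass_pos
  -- The sign of `B` is not part of what `exists_potential_bound` provides, hence `max B 0`.
  set τ : ℝ := 2 * (1 + max B 0) / bumpMass with hτ
  have hτ0 : 0 ≤ τ := by positivity
  refine ⟨τ / (1 + τ), 2 * (14 * Real.sqrt ((W + max B 0) * max B 0) / bumpMass + M),
    by positivity, by rw [div_lt_one (by positivity)]; linarith, by positivity, ?_⟩
  intro μ₁ μ₂ hμ₁ hμ₂ u₁ u₂ hu₁ hu₂ K hK hb₁ hb₂ A hA₁ hA₂ hρ₁ hρ₂ hw hmom hV₁ γ hγ hX hV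
  obtain ⟨hu₂M, hlip⟩ := norm_le_and_lipschitz_of_W1inftyNorm_le hu₂ hw
  have hγp : IsProbabilityMeasure γ := by
    have : IsProbabilityMeasure (γ.map Prod.fst) := hγ.1 ▸ hμ₁
    exact (Measure.isProbabilityMeasure_map_iff measurable_fst.aemeasurable).1 this
  have hmem9 : MemLp (Prod.snd : Phase → E3) 9 μ₂ := by
    have := memLp_snd_of_moment (μ := μ₂) (k := 9) (by norm_num)
      (hmom.trans_lt ENNReal.coe_lt_top)
    norm_num at this
    exact this
  have hu₂9 : MemLp (fun z : Phase => u₂ z.1) 9 μ₂ :=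
    (memLp_top_of_bound (hu₂.comp continuous_fst).aestronglyMeasurable (M : ℝ)
      (Eventually.of_forall fun z => hu₂M _)).mono_exponent le_top
  have hk9 : MemLp (fun z : Phase => z.2 - u₂ z.1) 9 μ₂ := hmem9.sub hu₂9
  have hi₁ : Integrable (fun z : Phase => z.2 - u₁ z.1) μ₁ :=
    hV₁.sub ((memLp_top_of_bound (hu₁.comp continuous_fst).aestronglyMeasurable K
      (Eventually.of_forall fun z => hK _)).integrable le_top)
  have hi₂ : Integrable (fun z : Phase => z.2 - u₂ z.1) μ₂ := hk9.integrable (by norm_num)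
  have hWb : ∫ z, ‖z.2 - u₂ z.1‖ ^ 9 ∂μ₂ ≤ W := by
    have i9 : Integrable (fun z : Phase => ‖z.2‖ ^ 9) μ₂ := hmem9.integrable_norm_pow (by norm_num)
    have hmb : ∫ z : Phase, ‖z.2‖ ^ 9 ∂μ₂ ≤ M := by
      rw [integral_eq_lintegral_of_nonneg_ae (Eventually.of_forall fun z => by positivity)
        i9.aestronglyMeasurable]
      refine ENNReal.toReal_le_coe_of_le_coe (le_trans (le_of_eq ?_) hmom)
      unfold moment
      refine lintegral_congr fun z => ?_
      rw [ENNReal.ofReal_pow (norm_nonneg _), ofReal_norm]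
      exact_mod_cast (ENNReal.rpow_natCast _ 9).symm
    calc _ ≤ ∫ z : Phase, 2 ^ 8 * (‖z.2‖ ^ 9 + (M : ℝ) ^ 9) ∂μ₂ := by
          refine integral_mono (hk9.integrable_norm_pow (by norm_num))
            ((i9.add (integrable_const _)).const_mul _) fun z => ?_
          calc ‖z.2 - u₂ z.1‖ ^ 9 ≤ (‖z.2‖ + M) ^ 9 := by
                gcongr
                exact (norm_sub_le _ _).trans (by gcongr; exact hu₂M _)
            _ ≤ _ := add_pow_le (norm_nonneg _) M.2 9
      _ ≤ W := by
          rw [integral_const_mul, integral_add i9 (integrable_const _)]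
          simp only [integral_const, probReal_univ, one_smul, hW]
          gcongr
  have hpot : ∀ (μ : Measure Phase) (p : Phase × Phase → Phase), Measurable p → γ.map p = μ →
      IsProbabilityMeasure μ → HasDensityLE A μ → eLpNorm (spatialDensity μ) q volume ≤ M →
      ∀ ε ∈ Ioc (0 : ℝ) 1, ∀ x, ∫ o, regNorm ε (x - (p o).1) ^ (-(9 / 4) : ℝ) ∂γ ≤ max B 0 := by
    intro μ p hp hpμ hμ hA hρ ε hε x
    have h1 := hB (μ.map Prod.fst)
      (Measure.isProbabilityMeasure_map measurable_fst.aemeasurable)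
      hA.map_fst_absolutelyContinuous hρ ε hε.1 x
    have hc : Continuous fun y => regNorm ε (x - y) ^ (-(9 / 4) : ℝ) :=
      (continuous_regNorm_rpow hε.1 _).comp (continuous_const.sub continuous_id)
    have hc' : Continuous fun z : Phase => regNorm ε (x - z.1) ^ (-(9 / 4) : ℝ) :=
      hc.comp continuous_fst
    rw [integral_map measurable_fst.aemeasurable hc.aestronglyMeasurable, ← hpμ,
      integral_map hp.aemeasurable hc'.aestronglyMeasurable] at h1
    exact h1.trans (le_max_left _ _)
  have hf : Measurable (Prod.fst : Phase × Phase → Phase) := measurable_fst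
  have hs : Measurable (Prod.snd : Phase × Phase → Phase) := measurable_snd
  have hK' : ∀ x, ‖u₁ x‖ ≤ max K M := fun x => (hK x).trans (le_max_left _ _)
  have hM' : ∀ x, ‖u₂ x‖ ≤ max K M := fun x => (hu₂M x).trans (le_max_right _ _)
  refine l2norm_velocity_difference_le (γ := γ) (m := bumpMass) (B := max B 0) (W := W) (M := M)
    (X₁ := fun o => o.1.1) (X₂ := fun o => o.2.1) (V₁ := fun o => o.1.2) (V₂ := fun o => o.2.2)
    (A := bumpMass * max K M) hm M.2 (by fun_prop) (by fun_prop)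
    ?_ hV hX hu₁ hu₂ hK' hM' hlip ?_ ?_
    (hpot μ₁ _ hf hγ.1 hμ₁ hA₁ hρ₁) (hpot μ₂ _ hs hγ.2 hμ₂ hA₂ hρ₂) ?_ ?_ ?_ ?_
  · rw [← hγ.1] at hV₁
    exact hV₁.comp_measurable hf
  · rw [← hγ.2] at hk9
    exact hk9.comp_of_map hs.aemeasurable
  · rw [← hγ.2, integral_map hs.aemeasurable (Continuous.aestronglyMeasurable (by fun_prop))] at hWb
    exact hWb
  · intro x
    refine (hb₁.tendsto_stokesletConv hu₁ hK hi₁ x).congr' ?_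
    filter_upwards [self_mem_nhdsWithin] with ε hε
    rw [← hγ.1, stokesletConv_map hf hu₁ hε]
  · intro x
    refine (hb₂.tendsto_stokesletConv hu₂ hu₂M hi₂ x).congr' ?_
    filter_upwards [self_mem_nhdsWithin] with ε hε
    rw [← hγ.2, stokesletConv_map hs hu₂ hε]
  · intro ε hε x
    have := hb₁.norm_stokesletConv_le hu₁ hK' hi₁ hε.1 x
    rwa [← hγ.1, stokesletConv_map hf hu₁ hε.1] at this
  · intro ε hε x
    have := hb₂.norm_stokesletConv_le hu₂ hM' hi₂ hε.1 x
    rwa [← hγ.2, stokesletConv_map hs hu₂ hε.1] at this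

end FixedTime

/-! ### The Wasserstein distance: triangle inequality and weak continuity. -/

section Wasserstein

open ProbabilityTheory

/-- The Euclidean distance on the phase space. -/
def phaseEdist (z w : Phase) : ℝ≥0∞ := (edist z.1 w.1 ^ 2 + edist z.2 w.2 ^ 2) ^ (1 / 2 : ℝ)

lemma phaseEdist_eq (z w : Phase) :
    phaseEdist z w = edist (WithLp.toLp 2 z) (WithLp.toLp 2 w) := by
  rw [WithLp.prod_edist_eq_of_L2]
  rfl

lemma phaseEdist_triangle (x y z : Phase) :
    phaseEdist x z ≤ phaseEdist x y + phaseEdist y z := by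
  simp only [phaseEdist_eq]
  exact edist_triangle _ _ _

lemma phaseEdist_rpow_two (z w : Phase) :
    phaseEdist z w ^ (2 : ℝ) = edist z.1 w.1 ^ 2 + edist z.2 w.2 ^ 2 := by
  rw [phaseEdist, ← ENNReal.rpow_mul]
  norm_num

lemma measurable_phaseEdist : Measurable fun z : Phase × Phase => phaseEdist z.1 z.2 := by
  unfold phaseEdist
  fun_prop

lemma edist_le_phaseEdist (z w : Phase) : edist z w ≤ phaseEdist z w := by
  have h : ∀ a b : ℝ≥0∞, a ≤ (a ^ 2 + b ^ 2) ^ (1 / 2 : ℝ) := fun a b => by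
    calc a = (a ^ 2) ^ (1 / 2 : ℝ) := by
          rw [← ENNReal.rpow_natCast, ← ENNReal.rpow_mul]; norm_num
      _ ≤ _ := by gcongr; exact le_self_add
  rw [Prod.edist_eq]
  refine max_le (h _ _) ?_
  rw [phaseEdist, add_comm]
  exact h _ _

/-- The root mean square displacement of a transport plan. -/
def planCost (γ : Measure (Phase × Phase)) : ℝ≥0∞ :=
  (∫⁻ z, phaseEdist z.1 z.2 ^ (2 : ℝ) ∂γ) ^ (1 / 2 : ℝ)

lemma planCost_eq (γ : Measure (Phase × Phase)) :
    planCost γ = (∫⁻ z, (edist z.1.1 z.2.1 ^ 2 + edist z.1.2 z.2.2 ^ 2) ∂γ) ^ (1 / 2 : ℝ) := by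
  simp only [planCost, phaseEdist_rpow_two]

variable {μ ν π : Measure Phase} {γ : Measure (Phase × Phase)}

lemma W2_le_planCost (h : IsTransportPlan μ ν γ) : W2 μ ν ≤ planCost γ := by
  rw [planCost_eq, W2]
  gcongr
  exact iInf₂_le γ h

/-- Nearly optimal plans replace optimal ones throughout. -/
lemma exists_planCost_lt {c : ℝ≥0∞} (h : W2 μ ν < c) :
    ∃ γ, IsTransportPlan μ ν γ ∧ planCost γ < c := by
  have hc : (c ^ (2 : ℝ)) ^ (1 / 2 : ℝ) = c := by
    rw [← ENNReal.rpow_mul]; norm_num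
  rw [W2, ← hc, ENNReal.rpow_lt_rpow_iff (by norm_num), iInf_lt_iff] at h
  obtain ⟨γ, hγ⟩ := h
  obtain ⟨h1, h2⟩ := iInf_lt_iff.1 hγ
  refine ⟨γ, h1, ?_⟩
  rw [planCost_eq, ← hc]
  exact ENNReal.rpow_lt_rpow h2 (by norm_num)

lemma IsTransportPlan.isProbabilityMeasure [IsProbabilityMeasure μ]
    (h : IsTransportPlan μ ν γ) : IsProbabilityMeasure γ := by
  have : IsProbabilityMeasure (γ.map Prod.fst) := by rw [h.1]; infer_instance
  exact (Measure.isProbabilityMeasure_map_iff measurable_fst.aemeasurable).1 this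

lemma W2_comm_le (μ ν : Measure Phase) : W2 μ ν ≤ W2 ν μ := by
  refine le_of_forall_gt fun c hc => ?_
  obtain ⟨γ, hγ, hγc⟩ := exists_planCost_lt hc
  refine (W2_le_planCost (γ := γ.map Prod.swap) ⟨?_, ?_⟩).trans_lt (hγc.trans_le' (le_of_eq ?_))
  · rw [Measure.map_map measurable_fst measurable_swap]; exact hγ.2
  · rw [Measure.map_map measurable_snd measurable_swap]; exact hγ.1
  · rw [planCost, planCost, lintegral_map (measurable_phaseEdist.pow_const _) measurable_swap]
    simp only [Prod.fst_swap, Prod.snd_swap, phaseEdist_rpow_two, edist_comm]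

lemma W2_comm (μ ν : Measure Phase) : W2 μ ν = W2 ν μ :=
  le_antisymm (W2_comm_le μ ν) (W2_comm_le ν μ)

/-- The second plan is disintegrated along its first marginal, and the third point is drawn
conditionally on the second one. -/
lemma exists_gluing [IsProbabilityMeasure μ] [IsProbabilityMeasure ν]
    {γ₁ γ₂ : Measure (Phase × Phase)} (h₁ : IsTransportPlan μ ν γ₁) (h₂ : IsTransportPlan ν π γ₂) :
    ∃ ρ : Measure ((Phase × Phase) × Phase), ρ.map Prod.fst = γ₁ ∧
      ρ.map (fun z => (z.1.2, z.2)) = γ₂ := by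
  have := h₁.isProbabilityMeasure
  have := h₂.isProbabilityMeasure
  set κ : Kernel (Phase × Phase) Phase := γ₂.condKernel.comap Prod.snd measurable_snd with hκ
  refine ⟨γ₁ ⊗ₘ κ, Measure.fst_compProd γ₁ κ, ?_⟩
  have hm : Measurable fun z : (Phase × Phase) × Phase => (z.1.2, z.2) := by fun_prop
  ext s hs
  rw [Measure.map_apply hm hs, Measure.compProd_apply (hm hs)]
  have e1 : γ₂ s = (γ₂.fst ⊗ₘ γ₂.condKernel) s := by rw [Measure.disintegrate]
  have e2 : γ₂.fst = γ₁.map Prod.snd := h₂.1.trans h₁.2.symm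
  rw [e1, Measure.compProd_apply hs, e2, lintegral_map
    (Kernel.measurable_kernel_prodMk_left hs) measurable_snd]
  rfl

/-- Under a glued measure all three points live on one space; Minkowski's inequality then bounds the
cost of the outer pair. -/
theorem W2_triangle [IsProbabilityMeasure μ] [IsProbabilityMeasure ν] :
    W2 μ π ≤ W2 μ ν + W2 ν π := by
  refine ENNReal.le_of_forall_pos_le_add fun ε hε htop => ?_
  have hε2 : (0 : ℝ≥0∞) < ε / 2 := by simpa using hε.ne'
  have ht := ENNReal.add_lt_top.1 htop
  obtain ⟨γ₁, h₁, c₁⟩ := exists_planCost_lt (ENNReal.lt_add_right ht.1.ne hε2.ne')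
  obtain ⟨γ₂, h₂, c₂⟩ := exists_planCost_lt (ENNReal.lt_add_right ht.2.ne hε2.ne')
  obtain ⟨ρ, hρ₁, hρ₂⟩ := exists_gluing h₁ h₂
  have m1 : Measurable fun z : (Phase × Phase) × Phase => (z.1.2, z.2) := by fun_prop
  have m2 : Measurable fun z : (Phase × Phase) × Phase => (z.1.1, z.2) := by fun_prop
  have mp := measurable_phaseEdist.pow_const (2 : ℝ)
  have hplan : IsTransportPlan μ π (ρ.map fun z => (z.1.1, z.2)) := by
    constructor
    · rw [Measure.map_map measurable_fst m2, ← h₁.1, ← hρ₁,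
        Measure.map_map measurable_fst measurable_fst]
      rfl
    · rw [Measure.map_map measurable_snd m2, ← h₂.2, ← hρ₂, Measure.map_map measurable_snd m1]
      rfl
  calc W2 μ π ≤ planCost (ρ.map fun z => (z.1.1, z.2)) := W2_le_planCost hplan
    _ = (∫⁻ z, phaseEdist z.1.1 z.2 ^ (2 : ℝ) ∂ρ) ^ (1 / 2 : ℝ) := by
        rw [planCost, lintegral_map mp m2]
    _ ≤ (∫⁻ z, ((fun z : (Phase × Phase) × Phase => phaseEdist z.1.1 z.1.2)
          + fun z : (Phase × Phase) × Phase => phaseEdist z.1.2 z.2) z ^ (2 : ℝ) ∂ρ) ^ (1 / 2 : ℝ) := by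
        gcongr with z
        exact phaseEdist_triangle _ _ _
    _ ≤ (∫⁻ z, phaseEdist z.1.1 z.1.2 ^ (2 : ℝ) ∂ρ) ^ (1 / 2 : ℝ)
        + (∫⁻ z, phaseEdist z.1.2 z.2 ^ (2 : ℝ) ∂ρ) ^ (1 / 2 : ℝ) :=
        ENNReal.lintegral_Lp_add_le (p := 2) (measurable_phaseEdist.comp measurable_fst).aemeasurable
          (measurable_phaseEdist.comp m1).aemeasurable (by norm_num)
    _ = planCost γ₁ + planCost γ₂ := by
        rw [planCost, planCost, ← hρ₁, ← hρ₂, lintegral_map mp measurable_fst, lintegral_map mp m1]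
    _ ≤ (W2 μ ν + ε / 2) + (W2 ν π + ε / 2) := add_le_add c₁.le c₂.le
    _ = W2 μ ν + W2 ν π + ε := by
        rw [add_add_add_comm, ENNReal.add_halves]

/-- The easy half of Kantorovich duality: `ψ z₁ - ψ z₂` is integrated over a plan, and
Cauchy-Schwarz passes from mean to root mean square displacement. -/
lemma enorm_integral_sub_le [IsProbabilityMeasure μ] [IsProbabilityMeasure ν] {ψ : Phase → ℝ}
    {L : ℝ≥0} (hL : LipschitzWith L ψ) {C : ℝ} (hC : ∀ z, ‖ψ z‖ ≤ C) :
    ‖∫ z, ψ z ∂μ - ∫ z, ψ z ∂ν‖ₑ ≤ L * W2 μ ν := by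
  have key : ∀ γ, IsTransportPlan μ ν γ → ‖∫ z, ψ z ∂μ - ∫ z, ψ z ∂ν‖ₑ ≤ L * planCost γ := by
    intro γ hγ
    have := hγ.isProbabilityMeasure
    have i1 : Integrable (fun z : Phase × Phase => ψ z.1) γ :=
      Integrable.of_bound (hL.continuous.comp continuous_fst).aestronglyMeasurable C
        (Eventually.of_forall fun z => hC _)
    have i2 : Integrable (fun z : Phase × Phase => ψ z.2) γ :=
      Integrable.of_bound (hL.continuous.comp continuous_snd).aestronglyMeasurable C
        (Eventually.of_forall fun z => hC _)
    rw [← hγ.1, ← hγ.2, integral_map measurable_fst.aemeasurable hL.continuous.aestronglyMeasurable,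
      integral_map measurable_snd.aemeasurable hL.continuous.aestronglyMeasurable,
      ← integral_sub i1 i2]
    refine (enorm_integral_le_lintegral_enorm _).trans ?_
    calc ∫⁻ z, ‖ψ z.1 - ψ z.2‖ₑ ∂γ ≤ ∫⁻ z, L * phaseEdist z.1 z.2 ∂γ := by
          gcongr with z
          rw [← edist_eq_enorm_sub]
          exact (hL _ _).trans (by gcongr; exact edist_le_phaseEdist _ _)
      _ = L * ∫⁻ z, ((fun z : Phase × Phase => phaseEdist z.1 z.2) * fun _ : Phase × Phase => (1 : ℝ≥0∞)) z ∂γ := by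
          rw [lintegral_const_mul _ measurable_phaseEdist]
          simp
      _ ≤ L * (planCost γ * (∫⁻ z, (fun _ : Phase × Phase => (1 : ℝ≥0∞)) z ^ (2 : ℝ) ∂γ)
          ^ (1 / 2 : ℝ)) := by
          gcongr
          exact ENNReal.lintegral_mul_le_Lp_mul_Lq γ (p := 2) (q := 2)
            (by constructor <;> norm_num) measurable_phaseEdist.aemeasurable aemeasurable_const
      _ = L * planCost γ := by simp
  -- Dividing by `L` is impossible here, and if `W2` is infinite the right side is `0 * ⊤ = 0`; the
  -- product plan covers that case.
  by_cases hL0 : L = 0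
  · subst hL0
    by_cases hW : W2 μ ν < ⊤
    · obtain ⟨γ, hγ, -⟩ := exists_planCost_lt hW
      simpa using key γ hγ
    · have hp : IsTransportPlan μ ν (μ.prod ν) := by
        constructor
        · exact Measure.fst_prod
        · exact Measure.snd_prod
      simpa using key _ hp
  · have hL' : (L : ℝ≥0∞) ≠ 0 := by simpa using hL0
    rw [mul_comm]
    refine (ENNReal.div_le_iff hL' ENNReal.coe_ne_top).1 ?_
    refine le_of_forall_gt fun c hc => ?_
    obtain ⟨γ, hγ, hγc⟩ := exists_planCost_lt hc
    refine lt_of_le_of_lt ?_ hγc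
    refine (ENNReal.div_le_iff hL' ENNReal.coe_ne_top).2 ?_
    rw [mul_comm]
    exact key γ hγ

/-- A `W2`-continuous curve of probability measures on `[0, T]`. -/
structure IsW2Curve (T : ℝ) (f : ℝ → Measure Phase) : Prop where
  prob : ∀ t ∈ Icc 0 T, IsProbabilityMeasure (f t)
  continuous : ∀ t ∈ Icc 0 T, Tendsto (fun s => W2 (f s) (f t)) (𝓝[Icc 0 T] t) (𝓝 0)

variable {T : ℝ} {f : ℝ → Measure Phase}

/-- A `W2`-continuous curve is weakly continuous. -/
theorem IsW2Curve.continuous_integral (hf : IsW2Curve T f) {ψ : Phase → ℝ} (hψ : Continuous ψ)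
    {C : ℝ} (hC : ∀ z, ‖ψ z‖ ≤ C) : ContinuousOn (fun t => ∫ z, ψ z ∂(f t)) (Icc 0 T) := by
  rw [continuousOn_iff_continuous_domRestrict, continuous_iff_continuousAt]
  intro t
  let F : Icc 0 T → ProbabilityMeasure Phase := fun s => ⟨f s, hf.prob s s.2⟩
  have h : Tendsto F (𝓝 t) (𝓝 (F t)) := by
    rw [tendsto_iff_forall_lipschitz_integral_tendsto]
    rintro φ ⟨D, hD⟩ ⟨L, hL⟩
    have hb : ∀ z, ‖φ z‖ ≤ ‖φ 0‖ + D := fun z => by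
      have := hD z 0
      rw [dist_eq_norm] at this
      calc ‖φ z‖ = ‖φ 0 + (φ z - φ 0)‖ := by congr 1; ring
        _ ≤ _ := (norm_add_le _ _).trans (by gcongr)
    rw [tendsto_iff_edist_tendsto_0]
    have hc := hf.continuous t t.2
    rw [nhdsWithin_eq_map_subtype_coe t.2, tendsto_map'_iff] at hc
    have hc2 : Tendsto (fun s : Icc 0 T => (L : ℝ≥0∞) * W2 (f s) (f t)) (𝓝 t) (𝓝 0) := by
      have := ENNReal.Tendsto.const_mul hc (a := (L : ℝ≥0∞)) (Or.inr ENNReal.coe_ne_top)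
      simpa using this
    refine tendsto_of_tendsto_of_tendsto_of_le_of_le tendsto_const_nhds hc2 (fun _ => zero_le)
      fun s => ?_
    have := hf.prob s s.2
    have := hf.prob t t.2
    rw [edist_eq_enorm_sub]
    exact enorm_integral_sub_le hL hb
  exact ProbabilityMeasure.tendsto_iff_forall_integral_tendsto.1 h
    (BoundedContinuousFunction.ofNormedAddCommGroup ψ hψ C hC)

/-- Uniform continuity of `Φ` freezes its time argument, which reduces the claim to
`IsW2Curve.continuous_integral`. -/
theorem IsW2Curve.continuousOn_integral (hf : IsW2Curve T f) {Φ : ℝ × Phase → ℝ}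
    (hΦ : Continuous Φ) (hc : HasCompactSupport Φ) :
    ContinuousOn (fun t => ∫ z, Φ (t, z) ∂(f t)) (Icc 0 T) := by
  obtain ⟨C, hC⟩ := hc.exists_bound_of_continuous hΦ
  have hu := hc.uniformContinuous_of_continuous hΦ
  intro t ht
  rw [ContinuousWithinAt, Metric.tendsto_nhds]
  intro ε hε
  have h1 := (hf.continuous_integral (ψ := fun z => Φ (t, z)) (by fun_prop)
    (fun z => hC (t, z))) t ht
  rw [ContinuousWithinAt, Metric.tendsto_nhds] at h1
  obtain ⟨δ, hδ, hδε⟩ := Metric.uniformContinuous_iff.1 hu (ε / 2) (half_pos hε)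
  filter_upwards [h1 (ε / 2) (half_pos hε), self_mem_nhdsWithin,
    nhdsWithin_le_nhds (Metric.ball_mem_nhds t hδ)] with s hs hsT hsδ
  have := hf.prob s hsT
  have i : ∀ r, Integrable (fun z => Φ (r, z)) (f s) := fun r =>
    Integrable.of_bound (Continuous.aestronglyMeasurable (by fun_prop)) C
      (Eventually.of_forall fun z => hC _)
  have h2 : dist (∫ z, Φ (s, z) ∂(f s)) (∫ z, Φ (t, z) ∂(f s)) ≤ ε / 2 := by
    rw [dist_eq_norm, ← integral_sub (i s) (i t)]
    have := norm_integral_le_of_norm_le_const (μ := f s) (f := fun z => Φ (s, z) - Φ (t, z))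
      (C := ε / 2) (Eventually.of_forall fun z => ?_)
    · simpa using this
    · rw [← dist_eq_norm]
      refine (hδε ?_).le
      rw [Prod.dist_eq, dist_self]
      exact max_lt hsδ hδ
  calc _ ≤ _ := dist_triangle _ _ _
    _ < ε / 2 + ε / 2 := add_lt_add_of_le_of_lt h2 hs
    _ = ε := add_halves ε

end Wasserstein

/-! ### Flows of fields that are Lipschitz in space. -/

section Flow

variable {E : Type*} [NormedAddCommGroup E] [NormedSpace ℝ E] {b : ℝ → E → E} {L : ℝ≥0}

/-- Gronwall in both time directions; for `t ≤ s` it is applied to the time-reversed trajectories.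
-/
lemma dist_le_of_forall_hasDerivAt (hb : ∀ t, LipschitzWith L (b t)) {α β : ℝ → E}
    (hα : ∀ t, HasDerivAt α (b t (α t)) t) (hβ : ∀ t, HasDerivAt β (b t (β t)) t) (s t : ℝ) :
    dist (α t) (β t) ≤ dist (α s) (β s) * Real.exp (L * |t - s|) := by
  rcases le_total s t with h | h
  · rw [abs_of_nonneg (sub_nonneg.2 h)]
    exact dist_le_of_trajectories_ODE hb (fun r _ => (hα r).continuousAt.continuousWithinAt)
      (fun r _ => (hα r).hasDerivWithinAt) (fun r _ => (hβ r).continuousAt.continuousWithinAt)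
      (fun r _ => (hβ r).hasDerivWithinAt) le_rfl t ⟨h, le_rfl⟩
  · have hrev : ∀ {δ : ℝ → E}, (∀ t, HasDerivAt δ (b t (δ t)) t) → ∀ r,
        HasDerivAt (fun r => δ (-r)) (-b (-r) (δ (-r))) r := fun hδ r => by
      simpa [Function.comp_def] using (hδ (-r)).scomp r (hasDerivAt_neg r)
    have h' : -s ≤ -t := neg_le_neg h
    have := dist_le_of_trajectories_ODE (v := fun r x => -b (-r) x) (K := L) (a := -s) (b := -t)
      (δ := dist (α s) (β s)) (fun r => (hb (-r)).neg)
      (fun r _ => (hrev hα r).continuousAt.continuousWithinAt)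
      (fun r _ => (hrev hα r).hasDerivWithinAt)
      (fun r _ => (hrev hβ r).continuousAt.continuousWithinAt)
      (fun r _ => (hrev hβ r).hasDerivWithinAt) (by simp) (-t) ⟨h', le_rfl⟩
    rw [abs_of_nonpos (sub_nonpos.2 h)]
    simpa [sub_eq_add_neg, add_comm] using this

/-- Global solutions are obtained by gluing solutions on bounded intervals. -/
lemma exists_forall_hasDerivAt_of_local (hb : ∀ t, LipschitzWith L (b t)) (s : ℝ) (z : E)
    (h : ∀ N : ℕ, ∃ α : ℝ → E, α s = z ∧
      ∀ t ∈ Ioo (s - (N + 1)) (s + (N + 1)), HasDerivAt α (b t (α t)) t) :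
    ∃ α : ℝ → E, α s = z ∧ ∀ t, HasDerivAt α (b t (α t)) t := by
  choose α hα0 hα using h
  have huniq : ∀ M N : ℕ, M ≤ N → ∀ t ∈ Ioo (s - (M + 1)) (s + (M + 1)), α M t = α N t := by
    intro M N hMN
    have hMN' : (M : ℝ) ≤ N := by exact_mod_cast hMN
    exact ODE_solution_unique_of_mem_Ioo (v := b) (s := fun _ => univ) (K := L) (t₀ := s)
      (fun t _ => (hb t).lipschitzOnWith) ⟨by linarith [Nat.cast_nonneg (α := ℝ) M],
        by linarith [Nat.cast_nonneg (α := ℝ) M]⟩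
      (fun t ht => ⟨hα M t ht, mem_univ _⟩)
      (fun t ht => ⟨hα N t ⟨by linarith [ht.1], by linarith [ht.2]⟩, mem_univ _⟩)
      ((hα0 M).trans (hα0 N).symm)
  have hmem : ∀ t, ∀ N : ℕ, |t - s| < N + 1 → t ∈ Ioo (s - (N + 1 : ℝ)) (s + (N + 1)) :=
    fun t N ht => ⟨by linarith [(abs_lt.1 ht).1], by linarith [(abs_lt.1 ht).2]⟩
  set β : ℝ → E := fun t => α ⌈|t - s|⌉₊ t with hβ
  have hβα : ∀ N : ℕ, ∀ t, |t - s| ≤ N → β t = α N t := fun N t ht =>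
    huniq _ N (Nat.ceil_le.2 ht) t (hmem t _ (by linarith [Nat.le_ceil |t - s|]))
  refine ⟨β, by rw [hβα 0 s (by simp), hα0], fun t => ?_⟩
  obtain ⟨N, hN⟩ := exists_nat_gt |t - s|
  have hev : β =ᶠ[𝓝 t] α N := by
    have : ∀ᶠ r in 𝓝 t, |r - s| < N :=
      (continuous_abs.comp (continuous_id.sub continuous_const)).continuousAt.eventually_lt_const hN
    filter_upwards [this] with r hr using hβα N r hr.le
  have := hα N t (hmem t N (by linarith))
  rw [← hβα N t hN.le] at this
  exact this.congr_of_eventuallyEq hev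

/-- `Z s t z` is the position at time `t` of the trajectory through `z` at time `s`. -/
structure IsFlow (b : ℝ → E → E) (L : ℝ≥0) (Z : ℝ → ℝ → E → E) : Prop where
  lipschitz : ∀ t, LipschitzWith L (b t)
  continuous_field : Continuous fun p : ℝ × E => b p.1 p.2
  self : ∀ s z, Z s s z = z
  hasDerivAt : ∀ s z t, HasDerivAt (fun t => Z s t z) (b t (Z s t z)) t

variable {Z : ℝ → ℝ → E → E} (hZ : IsFlow b L Z)

include hZ

lemma IsFlow.comp (s t r : ℝ) (z : E) : Z t r (Z s t z) = Z s r z := by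
  have := dist_le_of_forall_hasDerivAt hZ.lipschitz (hZ.hasDerivAt t (Z s t z))
    (hZ.hasDerivAt s z) t r
  rw [hZ.self, dist_self, zero_mul] at this
  exact dist_le_zero.1 this

lemma IsFlow.dist_le (s t : ℝ) (z w : E) :
    dist (Z s t z) (Z s t w) ≤ dist z w * Real.exp (L * |t - s|) := by
  have := dist_le_of_forall_hasDerivAt hZ.lipschitz (hZ.hasDerivAt s z) (hZ.hasDerivAt s w) s t
  rwa [hZ.self, hZ.self] at this

/-- Continuity in the starting time is included: at time `p.1` the reference trajectory passes
through `Z s₀ p.1 z₀`, and Gronwall compares the two trajectories from there. -/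
lemma IsFlow.continuous : Continuous fun p : ℝ × ℝ × E => Z p.1 p.2.1 p.2.2 := by
  rw [continuous_iff_continuousAt]
  rintro ⟨s₀, r₀, z₀⟩
  rw [ContinuousAt, tendsto_iff_dist_tendsto_zero]
  have hc : Continuous fun r => Z s₀ r z₀ :=
    continuous_iff_continuousAt.2 fun r => (hZ.hasDerivAt s₀ z₀ r).continuousAt
  have hlim : Continuous fun p : ℝ × ℝ × E =>
      dist p.2.2 (Z s₀ p.1 z₀) * Real.exp (L * |p.2.1 - p.1|)
        + dist (Z s₀ p.2.1 z₀) (Z s₀ r₀ z₀) := by fun_prop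
  have h0 := hlim.tendsto (s₀, r₀, z₀)
  simp only [hZ.self, dist_self, zero_mul, add_zero] at h0
  refine squeeze_zero (fun _ => dist_nonneg) (fun p => ?_) h0
  refine (dist_triangle _ (Z s₀ p.2.1 z₀) _).trans (add_le_add ?_ le_rfl)
  rw [← hZ.comp s₀ p.1 p.2.1 z₀]
  exact hZ.dist_le _ _ _ _

/-- Uniform control of the velocity along short pieces of trajectories. -/
lemma IsFlow.exists_norm_sub_le {S : Set (ℝ × E)} (hS : IsCompact S) {δ : ℝ} (hδ : 0 < δ) :
    ∃ ρ > 0, ∀ p ∈ S, ∀ q : ℝ × E, dist q p < ρ → ∀ h : ℝ, |h| < ρ →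
      ‖Z q.1 (q.1 + h) q.2 - q.2 - h • b p.1 p.2‖ ≤ δ * |h| := by
  set H : ℝ × E × ℝ → E := fun x => b x.2.2 (Z x.1 x.2.2 x.2.1) with hH
  have hHc : Continuous H := by
    have h1 : Continuous fun x : ℝ × E × ℝ => Z x.1 x.2.2 x.2.1 :=
      hZ.continuous.comp (f := fun x : ℝ × E × ℝ => (x.1, x.2.2, x.2.1)) (by fun_prop)
    exact hZ.continuous_field.comp (f := fun x : ℝ × E × ℝ => (x.2.2, Z x.1 x.2.2 x.2.1))
      (Continuous.prodMk (by fun_prop) h1)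
  have hS' : IsCompact ((fun p : ℝ × E => (p.1, p.2, p.1)) '' S) := hS.image (by fun_prop)
  have := hS'.uniformContinuousAt_of_continuousAt H (fun a _ => hHc.continuousAt)
    (Metric.dist_mem_uniformity hδ)
  obtain ⟨ρ, hρ, hρS⟩ := Metric.mem_uniformity_dist.1 this
  refine ⟨ρ / 2, half_pos hρ, fun p hp q hq h hh => ?_⟩
  have hq1 : dist q.1 p.1 < ρ / 2 := (le_max_left _ _).trans_lt hq
  have hq2 : dist q.2 p.2 < ρ / 2 := (le_max_right _ _).trans_lt hq
  have hv : ∀ r ∈ uIcc q.1 (q.1 + h), ‖b r (Z q.1 r q.2) - b p.1 p.2‖ ≤ δ := by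
    intro r hr
    have hr1 : dist r q.1 ≤ |h| := by
      have := abs_sub_left_of_mem_uIcc hr
      rwa [add_sub_cancel_left] at this
    have hd : dist (p.1, p.2, p.1) (q.1, q.2, r) < ρ := by
      rw [Prod.dist_eq, Prod.dist_eq]
      refine max_lt ?_ (max_lt ?_ ?_)
      · rw [dist_comm]; linarith
      · rw [dist_comm]; linarith
      · rw [dist_comm]; linarith [dist_triangle r q.1 p.1]
    have h2 : dist (H (p.1, p.2, p.1)) (H (q.1, q.2, r)) < δ := hρS hd ⟨p, hp, rfl⟩
    simp only [hH, hZ.self] at h2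
    rw [← dist_eq_norm, dist_comm]
    exact h2.le
  have hd : ∀ r ∈ uIcc q.1 (q.1 + h), HasDerivWithinAt (fun r => Z q.1 r q.2 - r • b p.1 p.2)
      (b r (Z q.1 r q.2) - b p.1 p.2) (uIcc q.1 (q.1 + h)) r := fun r _ => by
    have h1 := (hZ.hasDerivAt q.1 q.2 r).fun_sub ((hasDerivAt_id' r).smul_const (b p.1 p.2))
    rw [one_smul] at h1
    exact h1.hasDerivWithinAt
  have := Convex.norm_image_sub_le_of_norm_hasDerivWithin_le hd hv (convex_uIcc _ _)
    left_mem_uIcc right_mem_uIcc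
  simp only [hZ.self, add_sub_cancel_left, Real.norm_eq_abs] at this
  refine (le_of_eq ?_).trans this
  congr 1
  module

end Flow

/-! ### Characteristics of the Vlasov equation. -/

section Drift

/-- The characteristic field of the Vlasov equation. -/
def drift (g : E3) (lam : ℝ) (w : ℝ → E3 → E3) (t : ℝ) (z : Phase) : Phase :=
  (z.2, lam • (g + w t z.1 - z.2))

/-- A continuous velocity field, bounded and Lipschitz in space. -/
structure IsRegularVelocity (K : ℝ≥0) (w : ℝ → E3 → E3) : Prop where
  continuous : Continuous fun p : ℝ × E3 => w p.1 p.2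
  bound : ∀ t x, ‖w t x‖ ≤ K
  lipschitz : ∀ t, LipschitzWith K (w t)

variable {g : E3} {lam : ℝ} {w : ℝ → E3 → E3} {K : ℝ≥0} (hw : IsRegularVelocity K w)

include hw

lemma IsRegularVelocity.continuous_drift :
    Continuous fun p : ℝ × Phase => drift g lam w p.1 p.2 := by
  have : Continuous fun p : ℝ × Phase => w p.1 p.2.1 :=
    hw.continuous.comp (f := fun p : ℝ × Phase => (p.1, p.2.1)) (by fun_prop)
  exact Continuous.prodMk (by fun_prop)
    (((continuous_const.add this).sub (by fun_prop)).const_smul lam)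

lemma IsRegularVelocity.lipschitzWith_drift (t : ℝ) :
    LipschitzWith (1 + ‖lam‖₊ * (K + 1)) (drift g lam w t) := by
  refine LipschitzWith.of_dist_le_mul fun z z' => ?_
  have h1 : dist z.1 z'.1 ≤ dist z z' := le_max_left _ _
  have h2 : dist z.2 z'.2 ≤ dist z z' := le_max_right _ _
  have h0 : 0 ≤ dist z z' := dist_nonneg
  have hK := (hw.lipschitz t).dist_le_mul z.1 z'.1
  rw [Prod.dist_eq]
  push_cast
  refine max_le ?_ ?_
  · calc _ ≤ 1 * dist z z' := by rw [one_mul]; exact h2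
      _ ≤ _ := by gcongr; simp; positivity
  · unfold drift
    simp only [dist_smul₀]
    calc ‖lam‖ * dist (g + w t z.1 - z.2) (g + w t z'.1 - z'.2)
        ≤ ‖lam‖ * (K * dist z z' + dist z z') := by
          gcongr
          refine (dist_sub_sub_le _ _ _ _).trans (add_le_add ?_ h2)
          rw [dist_add_left]
          exact hK.trans (by gcongr)
      _ ≤ (1 + ‖lam‖ * (K + 1)) * dist z z' := by nlinarith

/-- The drift is unbounded in `v`, so Picard-Lindelöf gives no prescribed existence time directly.
In the variables `(x + lam⁻¹ v, exp (lam t) v)` the linear friction disappears and the field `G` is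
bounded on bounded time intervals. -/
lemma IsRegularVelocity.exists_local_solution (hlam : 0 < lam) (s : ℝ) (z : Phase) (N : ℕ) :
    ∃ α : ℝ → Phase, α s = z ∧
      ∀ t ∈ Ioo (s - (N + 1)) (s + (N + 1)), HasDerivAt α (drift g lam w t (α t)) t := by
  set m : ℝ := Real.exp (lam * (|s| + (N + 1))) with hm
  have hm0 : 0 < m := Real.exp_pos _
  have hN : (0 : ℝ) < N + 1 := by positivity
  have hexp : ∀ t ∈ Icc (s - (N + 1 : ℝ)) (s + (N + 1)), Real.exp (lam * t) ≤ m ∧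
      Real.exp (-(lam * t)) ≤ m := by
    intro t ht
    have h1 := ht.1; have h2 := ht.2
    have h3 := le_abs_self s; have h4 := neg_abs_le s
    constructor
    · exact Real.exp_le_exp.2 (by nlinarith)
    · exact Real.exp_le_exp.2 (by nlinarith)
  set pos : ℝ → Phase → E3 := fun t y => y.1 - (lam⁻¹ * Real.exp (-(lam * t))) • y.2 with hpos
  set G : ℝ → Phase → Phase := fun t y =>
    (g + w t (pos t y), (lam * Real.exp (lam * t)) • (g + w t (pos t y))) with hG
  set Lb : ℝ≥0 := ⟨(1 + lam * m) * (‖g‖ + K), by positivity⟩ with hLb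
  set Kb : ℝ≥0 := ⟨(1 + lam * m) * (K * (1 + lam⁻¹ * m)), by positivity⟩ with hKb
  have hs : s ∈ Icc (s - (N + 1 : ℝ)) (s + (N + 1)) := ⟨by linarith, by linarith⟩
  -- The ball has radius bound times half-length, exactly the distance a solution can travel; `G`
  -- satisfies its bounds everywhere, so this radius costs nothing.
  have hPL : IsPicardLindelof G (⟨s, hs⟩ : Icc (s - (N + 1 : ℝ)) (s + (N + 1)))
      (z.1 + lam⁻¹ • z.2, Real.exp (lam * s) • z.2) (Lb * ⟨N + 1, hN.le⟩) 0 Lb Kb := by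
    constructor
    · intro t ht
      refine LipschitzWith.lipschitzOnWith (LipschitzWith.of_dist_le_mul fun y y' => ?_)
      obtain ⟨e1, e2⟩ := hexp t ht
      have h1 : dist y.1 y'.1 ≤ dist y y' := le_max_left _ _
      have h2 : dist y.2 y'.2 ≤ dist y y' := le_max_right _ _
      have h0 : 0 ≤ dist y y' := dist_nonneg
      have hp : dist (pos t y) (pos t y') ≤ (1 + lam⁻¹ * m) * dist y y' := by
        refine (dist_sub_sub_le _ _ _ _).trans ?_
        rw [dist_smul₀, Real.norm_of_nonneg (by positivity), add_mul, one_mul]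
        gcongr
      have hd : dist (g + w t (pos t y)) (g + w t (pos t y'))
          ≤ K * (1 + lam⁻¹ * m) * dist y y' := by
        rw [dist_add_left, mul_assoc]
        exact ((hw.lipschitz t).dist_le_mul _ _).trans (by gcongr)
      rw [Prod.dist_eq]
      change max _ _ ≤ (1 + lam * m) * (K * (1 + lam⁻¹ * m)) * dist y y'
      have hP : 0 ≤ K * (1 + lam⁻¹ * m) * dist y y' := by positivity
      refine max_le ?_ ?_
      · refine hd.trans ?_
        rw [mul_assoc (1 + lam * m)]
        exact le_mul_of_one_le_left hP (by simp; positivity)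
      · simp only [hG, dist_smul₀]
        rw [Real.norm_of_nonneg (by positivity), mul_assoc (1 + lam * m)]
        gcongr
        nlinarith
    · intro y _
      have h1 : Continuous fun t => pos t y := by fun_prop
      have h2 : Continuous fun t => w t (pos t y) :=
        hw.continuous.comp (f := fun t => (t, pos t y)) (by fun_prop)
      exact (Continuous.prodMk (continuous_const.add h2)
        (Continuous.smul (f := fun t => lam * Real.exp (lam * t)) (by fun_prop)
          (continuous_const.add h2))).continuousOn
    · intro t ht y _
      obtain ⟨e1, e2⟩ := hexp t ht
      have h1 : ‖g + w t (pos t y)‖ ≤ ‖g‖ + K := (norm_add_le _ _).trans (by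
        gcongr; exact hw.bound _ _)
      change max _ _ ≤ (1 + lam * m) * (‖g‖ + K)
      refine max_le ?_ ?_
      · exact h1.trans (le_mul_of_one_le_left (by positivity) (by simp; positivity))
      · simp only [hG, norm_smul]
        rw [Real.norm_of_nonneg (by positivity)]
        gcongr
        nlinarith
    · simp only [add_sub_cancel_left, sub_sub_cancel, max_self]
      simp only [NNReal.coe_zero, sub_zero]
      exact le_rfl
  obtain ⟨y, hy0, hy⟩ := hPL.exists_eq_forall_mem_Icc_hasDerivWithinAt₀
  refine ⟨fun t => (pos t (y t), Real.exp (-(lam * t)) • (y t).2), ?_, fun t ht => ?_⟩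
  · have hy0' : y s = _ := hy0
    simp only [hpos, hy0', smul_smul]
    rw [mul_assoc, ← Real.exp_add]
    simp
  · have hd : HasDerivAt y (G t (y t)) t :=
      (hy t (Ioo_subset_Icc_self ht)).hasDerivAt (Icc_mem_nhds ht.1 ht.2)
    have he : HasDerivAt (fun t => Real.exp (-(lam * t))) (-lam * Real.exp (-(lam * t))) t := by
      have := ((hasDerivAt_id t).const_mul lam).neg.exp
      simpa [mul_comm] using this
    have h1 : HasDerivAt (fun t => (y t).1) (G t (y t)).1 t := hd.fst
    have h2 : HasDerivAt (fun t => (y t).2) (G t (y t)).2 t := hd.snd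
    have hV := he.smul h2
    have hX := h1.sub ((he.const_mul lam⁻¹).smul h2)
    refine (hX.prodMk hV).congr_deriv ?_
    have ee : Real.exp (-(lam * t)) * Real.exp (lam * t) = 1 := by
      rw [← Real.exp_add]; simp
    unfold drift
    simp only [hG, smul_smul]
    have e3 : Real.exp (-(lam * t)) * (lam * Real.exp (lam * t)) = lam := by
      linear_combination lam * ee
    have e4 : lam⁻¹ * Real.exp (-(lam * t)) * (lam * Real.exp (lam * t)) = 1 := by
      rw [mul_assoc, e3, inv_mul_cancel₀ hlam.ne']
    have e5 : lam⁻¹ * (-lam * Real.exp (-(lam * t))) = -Real.exp (-(lam * t)) := by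
      field_simp
    rw [e3, e4, e5]
    ext1
    · simp only; module
    · simp only; module

theorem IsRegularVelocity.exists_flow (hlam : 0 < lam) :
    ∃ Z, IsFlow (drift g lam w) (1 + ‖lam‖₊ * (K + 1)) Z := by
  have := fun s z => exists_forall_hasDerivAt_of_local (b := drift g lam w)
    hw.lipschitzWith_drift s z (hw.exists_local_solution hlam s z)
  choose Z hZ0 hZ using this
  exact ⟨fun s t z => Z s z t, hw.lipschitzWith_drift, hw.continuous_drift, hZ0, hZ⟩

end Drift

/-! ### The du Bois-Reymond lemma. -/

section Constancy

lemma abs_integral_bump_mul_sub_le {F : ℝ → ℝ} {t₀ δ : ℝ} (ρ : ContDiffBump t₀)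
    (hF : ContinuousOn F (Metric.closedBall t₀ ρ.rOut))
    (hδ : ∀ t ∈ Metric.ball t₀ ρ.rOut, |F t - F t₀| ≤ δ) :
    Integrable (fun t => ρ.normed volume t * F t) ∧
      |(∫ t, ρ.normed volume t * F t) - F t₀| ≤ δ := by
  have hsupp : ∀ t, t ∉ Metric.ball t₀ ρ.rOut → ρ.normed volume t = 0 := fun t ht => by
    rw [← ρ.support_normed_eq (μ := volume)] at ht
    exact Function.notMem_support.1 ht
  have hint : Integrable fun t => ρ.normed volume t * F t := by
    rw [← integrableOn_iff_integrable_of_support_subset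
      (s := Metric.closedBall t₀ ρ.rOut) (fun t ht => ?_)]
    · exact (ρ.continuous_normed.continuousOn.mul hF).integrableOn_compact
        (isCompact_closedBall _ _)
    · by_contra hc
      exact ht (by simp [hsupp t fun h => hc (Metric.ball_subset_closedBall h)])
  refine ⟨hint, ?_⟩
  have h1 : ∫ t, ρ.normed volume t * F t₀ = F t₀ := by
    rw [integral_mul_const, ρ.integral_normed, one_mul]
  have i1 : Integrable fun t => ρ.normed volume t * F t₀ := ρ.integrable_normed.mul_const _
  have i2 : Integrable fun t => ρ.normed volume t * δ := ρ.integrable_normed.mul_const _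
  have h2 : ∫ t, ρ.normed volume t * δ = δ := by
    rw [integral_mul_const, ρ.integral_normed, one_mul]
  conv_lhs => rw [← h1]
  rw [← integral_sub hint i1, ← h2, ← Real.norm_eq_abs]
  refine norm_integral_le_of_norm_le i2 (Eventually.of_forall fun t => ?_)
  rw [← mul_sub, norm_mul, Real.norm_of_nonneg (ρ.nonneg_normed t), Real.norm_eq_abs]
  by_cases ht : t ∈ Metric.ball t₀ ρ.rOut
  · exact mul_le_mul_of_nonneg_left (hδ t ht) (ρ.nonneg_normed t)
  · simp [hsupp t ht]

/-- A continuous function with vanishing distributional derivative is constant. -/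
lemma eq_of_forall_integral_deriv_mul_eq_zero {F : ℝ → ℝ} {a b : ℝ} {J : Set ℝ}
    (hJ : Ioo a b ⊆ J) (hF : ContinuousOn F (Ioo a b))
    (h : ∀ χ : ℝ → ℝ, ContDiff ℝ ∞ χ → HasCompactSupport χ → tsupport χ ⊆ Ioo a b →
      ∫ t in J, deriv χ t * F t = 0) {t₀ t₁ : ℝ} (h₀ : t₀ ∈ Ioo a b) (h₁ : t₁ ∈ Ioo a b) :
    F t₀ = F t₁ := by
  refine eq_of_forall_dist_le fun ε hε => ?_
  have hloc : ∀ t ∈ Ioo a b, ∃ r > 0, Metric.closedBall t r ⊆ Ioo a b ∧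
      ∀ s ∈ Metric.closedBall t r, |F s - F t| ≤ ε / 2 := by
    intro t ht
    have hc : ContinuousAt F t := hF.continuousAt (isOpen_Ioo.mem_nhds ht)
    have := (isOpen_Ioo.mem_nhds ht : Ioo a b ∈ 𝓝 t)
    obtain ⟨r, hr, hrs⟩ := Metric.nhds_basis_closedBall.mem_iff.1
      (Filter.inter_mem this (Metric.tendsto_nhds.1 hc (ε / 2) (half_pos hε)))
    exact ⟨r, hr, fun s hs => (hrs hs).1, fun s hs => (hrs hs).2.le⟩
  obtain ⟨r₀, hr₀, hb₀, hd₀⟩ := hloc t₀ h₀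
  obtain ⟨r₁, hr₁, hb₁, hd₁⟩ := hloc t₁ h₁
  let ρ₀ : ContDiffBump t₀ := ⟨r₀ / 2, r₀, half_pos hr₀, half_lt_self hr₀⟩
  let ρ₁ : ContDiffBump t₁ := ⟨r₁ / 2, r₁, half_pos hr₁, half_lt_self hr₁⟩
  obtain ⟨i₀, e₀⟩ := abs_integral_bump_mul_sub_le ρ₀ (hF.mono hb₀)
    fun t ht => hd₀ t (Metric.ball_subset_closedBall ht)
  obtain ⟨i₁, e₁⟩ := abs_integral_bump_mul_sub_le ρ₁ (hF.mono hb₁)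
    fun t ht => hd₁ t (Metric.ball_subset_closedBall ht)
  -- A difference of two normalized bumps has zero mean, so its primitive `χ` is compactly supported
  -- and admissible. Testing with it compares averages of `F` near `t₀` and `t₁`.
  set η : ℝ → ℝ := fun t => ρ₀.normed volume t - ρ₁.normed volume t with hη
  have hηs : ContDiff ℝ ∞ η := ρ₀.contDiff_normed.sub ρ₁.contDiff_normed
  set χ : ℝ → ℝ := fun t => ∫ s in a..t, η s with hχ
  have hχd : ∀ t, HasDerivAt χ (η t) t := fun t =>
    intervalIntegral.integral_hasDerivAt_right (hηs.continuous.intervalIntegrable _ _)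
      (hηs.continuous.stronglyMeasurableAtFilter _ _) hηs.continuous.continuousAt
  have hχ' : deriv χ = η := funext fun t => (hχd t).deriv
  have hχs : ContDiff ℝ ∞ χ := by
    rw [contDiff_infty_iff_deriv, hχ']
    exact ⟨fun t => (hχd t).differentiableAt, hηs⟩
  have hsupp₀ : ∀ t, t ∉ Metric.closedBall t₀ r₀ → ρ₀.normed volume t = 0 := fun t ht => by
    refine Function.notMem_support.1 fun hc => ht ?_
    rw [ρ₀.support_normed_eq] at hc
    exact Metric.ball_subset_closedBall hc
  have hsupp₁ : ∀ t, t ∉ Metric.closedBall t₁ r₁ → ρ₁.normed volume t = 0 := fun t ht => by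
    refine Function.notMem_support.1 fun hc => ht ?_
    rw [ρ₁.support_normed_eq] at hc
    exact Metric.ball_subset_closedBall hc
  rw [Real.closedBall_eq_Icc] at hsupp₀ hsupp₁ hb₀ hb₁
  set m := min (t₀ - r₀) (t₁ - r₁)
  set M := max (t₀ + r₀) (t₁ + r₁)
  have ha0 := (hb₀ (left_mem_Icc.2 (by linarith))).1
  have ha1 := (hb₁ (left_mem_Icc.2 (by linarith))).1
  have hb0 := (hb₀ (right_mem_Icc.2 (by linarith))).2
  have hb1 := (hb₁ (right_mem_Icc.2 (by linarith))).2
  have hzero : ∀ t, t ∉ Icc m M → χ t = 0 := by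
    intro t ht
    rcases lt_or_ge t m with hm | hm
    · have h0 : t < t₀ - r₀ := hm.trans_le (min_le_left _ _)
      have h1 : t < t₁ - r₁ := hm.trans_le (min_le_right _ _)
      rw [hχ]
      simp only
      rw [intervalIntegral.integral_congr (g := fun _ => 0) fun s hs => ?_]
      · simp
      · have hs2 : s ≤ max a t := hs.2
        have ha : s < t₀ - r₀ := hs2.trans_lt (max_lt ha0 h0)
        have hb : s < t₁ - r₁ := hs2.trans_lt (max_lt ha1 h1)
        simp [hη, hsupp₀ s fun hc => by linarith [hc.1], hsupp₁ s fun hc => by linarith [hc.1]]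
    · have hM : M < t := by
        by_contra hc
        exact ht ⟨hm, not_lt.1 hc⟩
      have h0 : t₀ + r₀ < t := (le_max_left _ _).trans_lt hM
      have h1 : t₁ + r₁ < t := (le_max_right _ _).trans_lt hM
      have k0 : ∫ s in a..t, ρ₀.normed volume s = 1 := by
        rw [intervalIntegral.integral_eq_integral_of_support_subset, ρ₀.integral_normed]
        intro s hs
        by_contra hc
        refine hs (hsupp₀ s fun hx => hc ⟨by linarith [hx.1], by linarith [hx.2]⟩)
      have k1 : ∫ s in a..t, ρ₁.normed volume s = 1 := by
        rw [intervalIntegral.integral_eq_integral_of_support_subset, ρ₁.integral_normed]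
        intro s hs
        by_contra hc
        refine hs (hsupp₁ s fun hx => hc ⟨by linarith [hx.1], by linarith [hx.2]⟩)
      simp only [hχ, hη]
      rw [intervalIntegral.integral_sub (ρ₀.continuous_normed.intervalIntegrable _ _)
        (ρ₁.continuous_normed.intervalIntegrable _ _), k0, k1, sub_self]
  have hts : tsupport χ ⊆ Icc m M := by
    refine closure_minimal (fun t ht => ?_) isClosed_Icc
    by_contra hc
    exact ht (hzero t hc)
  have hmM : Icc m M ⊆ Ioo a b := fun t ht =>
    ⟨(lt_min ha0 ha1).trans_le ht.1, ht.2.trans_lt (max_lt hb0 hb1)⟩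
  have h0 := h χ hχs (HasCompactSupport.intro isCompact_Icc hzero) (hts.trans hmM)
  rw [hχ', setIntegral_eq_integral_of_forall_compl_eq_zero] at h0
  · simp only [hη, sub_mul] at h0
    rw [integral_sub i₀ i₁] at h0
    rw [Real.dist_eq]
    have := abs_le.1 e₀
    have := abs_le.1 e₁
    rw [abs_le]
    constructor <;> linarith
  · intro t ht
    have h1 : t ∉ Ioo a b := fun hc => ht (hJ hc)
    simp [hη, hsupp₀ t fun hc => h1 (hb₀ hc), hsupp₁ t fun hc => h1 (hb₁ hc)]

end Constancy

/-! ### Compactly supported Lipschitz functions determine a probability measure. -/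

section MeasureExt

/-- Probability measures are determined by the integrals of compactly supported Lipschitz
functions. -/
lemma ext_of_forall_lipschitz_hasCompactSupport {E : Type*} [NormedAddCommGroup E]
    [ProperSpace E] [MeasurableSpace E] [BorelSpace E] {μ ν : Measure E} [IsProbabilityMeasure μ]
    [IsProbabilityMeasure ν] (h : ∀ ψ : E → ℝ, (∃ L, LipschitzWith L ψ) → HasCompactSupport ψ →
      ∫ z, ψ z ∂μ = ∫ z, ψ z ∂ν) : μ = ν := by
  have hlip : ∀ φ : E → ℝ, (∃ C : ℝ, ∀ x y, dist (φ x) (φ y) ≤ C) → (∃ L, LipschitzWith L φ) →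
      ∫ z, φ z ∂μ = ∫ z, φ z ∂ν := by
    rintro φ ⟨D, hD⟩ ⟨L, hL⟩
    obtain ⟨C, hC⟩ : ∃ C, ∀ z, ‖φ z‖ ≤ C := ⟨‖φ 0‖ + D, fun z => by
      have := hD z 0
      rw [dist_eq_norm] at this
      calc ‖φ z‖ = ‖φ 0 + (φ z - φ 0)‖ := by congr 1; ring
        _ ≤ _ := (norm_add_le _ _).trans (by gcongr)⟩
    have hC0 : 0 ≤ C := (norm_nonneg _).trans (hC 0)
    -- Lipschitz cutoffs increasing to one pass from compactly supported to bounded Lipschitz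
    -- functions, which determine weak convergence and hence the measure.
    set ξ : ℕ → E → ℝ := fun n z => max 0 (min 1 (n - ‖z‖)) with hξ
    have hξ0 : ∀ n z, 0 ≤ ξ n z := fun n z => le_max_left _ _
    have hξ1 : ∀ n z, ξ n z ≤ 1 := fun n z => max_le zero_le_one (min_le_left _ _)
    have hξL : ∀ n, LipschitzWith 1 (ξ n) := fun n => by
      have h1 : LipschitzWith 1 fun z : E => (n : ℝ) - ‖z‖ := by
        refine LipschitzWith.of_dist_le_mul fun x y => ?_
        rw [dist_sub_left, NNReal.coe_one, one_mul]
        rw [dist_eq_norm x y]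
        exact dist_norm_norm_le x y
      exact (h1.const_min 1).const_max 0
    have hψ : ∀ n, ∫ z, φ z * ξ n z ∂μ = ∫ z, φ z * ξ n z ∂ν := by
      intro n
      refine h _ ⟨L + Real.toNNReal C, LipschitzWith.of_dist_le_mul fun x y => ?_⟩ ?_
      · have e : φ x * ξ n x - φ y * ξ n y = (φ x - φ y) * ξ n x + φ y * (ξ n x - ξ n y) := by ring
        rw [Real.dist_eq, e]
        push_cast
        rw [Real.coe_toNNReal _ hC0, add_mul]
        refine (abs_add_le _ _).trans ?_
        rw [abs_mul, abs_mul]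
        have h1 := hL.dist_le_mul x y
        have h2 := (hξL n).dist_le_mul x y
        rw [Real.dist_eq] at h1 h2
        rw [NNReal.coe_one, one_mul] at h2
        refine add_le_add ?_ ?_
        · rw [abs_of_nonneg (hξ0 n x)]
          exact (mul_le_of_le_one_right (abs_nonneg _) (hξ1 n x)).trans h1
        · exact mul_le_mul (hC y) h2 (abs_nonneg _) hC0
      · refine HasCompactSupport.intro (isCompact_closedBall (0 : E) n) fun z hz => ?_
        rw [mem_closedBall_zero_iff, not_le] at hz
        have : ξ n z = 0 := max_eq_left ((min_le_right _ _).trans (by linarith))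
        rw [this, mul_zero]
    have hlim : ∀ (m : Measure E) [IsProbabilityMeasure m],
        Tendsto (fun n => ∫ z, φ z * ξ n z ∂m) atTop (𝓝 (∫ z, φ z ∂m)) := by
      intro m _
      refine tendsto_integral_of_dominated_convergence (fun _ => C)
        (fun n => (hL.continuous.mul (hξL n).continuous).aestronglyMeasurable) (integrable_const _)
        (fun n => Eventually.of_forall fun z => ?_) (Eventually.of_forall fun z => ?_)
      · rw [norm_mul, Real.norm_of_nonneg (hξ0 n z)]
        exact (mul_le_of_le_one_right (norm_nonneg _) (hξ1 n z)).trans (hC z)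
      · refine tendsto_const_nhds.congr' ?_
        obtain ⟨N, hN⟩ := exists_nat_ge (‖z‖ + 1)
        filter_upwards [eventually_ge_atTop N] with n hn
        have : (N : ℝ) ≤ n := by exact_mod_cast hn
        have : ξ n z = 1 := by
          rw [hξ]
          simp only
          rw [min_eq_left (by linarith), max_eq_right zero_le_one]
        rw [this, mul_one]
    exact tendsto_nhds_unique (hlim μ) ((hlim ν).congr fun n => (hψ n).symm)
  let m : ProbabilityMeasure E := ⟨μ, inferInstance⟩
  let n : ProbabilityMeasure E := ⟨ν, inferInstance⟩
  have ht : Tendsto (fun _ : ℕ => m) atTop (𝓝 n) := by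
    rw [tendsto_iff_forall_lipschitz_integral_tendsto]
    intro φ h1 h2
    have e : ∫ z, φ z ∂(m : Measure E) = ∫ z, φ z ∂(n : Measure E) := hlip φ h1 h2
    simp only [e]
    exact tendsto_const_nhds
  have hmn : m = n := tendsto_nhds_unique tendsto_const_nhds ht
  exact congrArg (fun p : ProbabilityMeasure E => (p : Measure E)) hmn

end MeasureExt

/-! ### Weak solutions of the continuity equation follow the flow. -/

section Transport

open ContinuousLinearMap
open scoped Convolution Pointwise

instance isAddHaarMeasure_volume_phase : (volume : Measure Phase).IsAddHaarMeasure :=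
  inferInstanceAs ((volume : Measure E3).prod (volume : Measure E3)).IsAddHaarMeasure

instance isAddHaarMeasure_volume_time_phase : (volume : Measure (ℝ × Phase)).IsAddHaarMeasure :=
  Measure.prod.instIsAddHaarMeasure (volume : Measure ℝ) (volume : Measure Phase)

instance isNegInvariant_volume_time_phase : (volume : Measure (ℝ × Phase)).IsNegInvariant := by
  have : (volume : Measure (ℝ × Phase)).Regular := inferInstance
  exact Measure.IsAddHaarMeasure.isNegInvariant_of_regular _

variable {b : ℝ → Phase → Phase} {L : ℝ≥0} {Z : ℝ → ℝ → Phase → Phase}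

/-- The solution of the transport equation with value `ψ` at time `t₁`. -/
def transported (Z : ℝ → ℝ → Phase → Phase) (t₁ : ℝ) (ψ : Phase → ℝ) (p : ℝ × Phase) : ℝ :=
  ψ (Z p.1 t₁ p.2)

/-- The points of trajectories that pass through the support of `ψ` at time `t₁`. -/
def tube (Z : ℝ → ℝ → Phase → Phase) (t₁ : ℝ) (ψ : Phase → ℝ) (I : Set ℝ) : Set (ℝ × Phase) :=
  (fun p : ℝ × Phase => (p.1, Z t₁ p.1 p.2)) '' (I ×ˢ tsupport ψ)

variable (hZ : IsFlow b L Z) {t₁ : ℝ} {ψ : Phase → ℝ}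

include hZ

lemma IsFlow.continuous_transported (hψ : Continuous ψ) : Continuous (transported Z t₁ ψ) :=
  hψ.comp (hZ.continuous.comp (f := fun p : ℝ × Phase => (p.1, t₁, p.2)) (by fun_prop))

lemma IsFlow.transported_flow (s t : ℝ) (z : Phase) :
    transported Z t₁ ψ (t, Z s t z) = transported Z t₁ ψ (s, z) := by
  simp only [transported, hZ.comp]

lemma IsFlow.isCompact_tube (hψ : HasCompactSupport ψ) {I : Set ℝ} (hI : IsCompact I) :
    IsCompact (tube Z t₁ ψ I) :=
  (hI.prod hψ).image (continuous_fst.prodMk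
    (hZ.continuous.comp (f := fun p : ℝ × Phase => (t₁, p.1, p.2)) (by fun_prop)))

lemma IsFlow.mem_tube {I : Set ℝ} {p : ℝ × Phase} (hp : p.1 ∈ I) (h : transported Z t₁ ψ p ≠ 0) :
    p ∈ tube Z t₁ ψ I :=
  ⟨(p.1, Z p.1 t₁ p.2), ⟨hp, subset_tsupport _ h⟩, by simp [hZ.comp, hZ.self]⟩

lemma IsFlow.hasCompactSupport_mul_transported (hψ : HasCompactSupport ψ) {ξ : ℝ → ℝ}
    (hξ : HasCompactSupport ξ) : HasCompactSupport fun p => ξ p.1 * transported Z t₁ ψ p := by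
  refine HasCompactSupport.intro (hZ.isCompact_tube (t₁ := t₁) hψ hξ) fun p hp => ?_
  by_contra hc
  refine hp (hZ.mem_tube (subset_tsupport _ ?_) (right_ne_zero_of_mul hc))
  exact left_ne_zero_of_mul hc

lemma IsFlow.abs_transported_sub_le {Lψ : ℝ≥0} (hψ : LipschitzWith Lψ ψ) {R t : ℝ}
    (ht : |t₁ - t| ≤ R) (z w : Phase) :
    |transported Z t₁ ψ (t, z) - transported Z t₁ ψ (t, w)|
      ≤ Lψ * Real.exp (L * R) * ‖z - w‖ := by
  rw [← Real.dist_eq, ← dist_eq_norm]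
  refine (hψ.dist_le_mul _ _).trans ?_
  rw [mul_assoc]
  gcongr
  refine (hZ.dist_le _ _ _ _).trans ?_
  rw [mul_comm]
  gcongr

/-- Mollification of a transported function. -/
def mollified (Z : ℝ → ℝ → Phase → Phase) (t₁ : ℝ) (ψ : Phase → ℝ)
    (ρ : ContDiffBump (0 : ℝ × Phase)) : ℝ × Phase → ℝ :=
  (ρ.normed volume) ⋆[lsmul ℝ ℝ, volume] (transported Z t₁ ψ)

omit hZ in
lemma mollified_apply (ρ : ContDiffBump (0 : ℝ × Phase)) (p : ℝ × Phase) :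
    mollified Z t₁ ψ ρ p = ∫ q, ρ.normed volume q * transported Z t₁ ψ (p - q) := rfl

lemma IsFlow.contDiff_mollified (hψ : Continuous ψ) (ρ : ContDiffBump (0 : ℝ × Phase)) :
    ContDiff ℝ ∞ (mollified Z t₁ ψ ρ) :=
  ρ.hasCompactSupport_normed.contDiff_convolution_left _ ρ.contDiff_normed
    (hZ.continuous_transported hψ).locallyIntegrable

lemma IsFlow.integrable_mollified (hψ : Continuous ψ) (ρ : ContDiffBump (0 : ℝ × Phase))
    (p : ℝ × Phase) : Integrable fun q => ρ.normed volume q * transported Z t₁ ψ (p - q) := by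
  have hc : Continuous fun q => transported Z t₁ ψ (p - q) :=
    (hZ.continuous_transported hψ).comp (continuous_const.sub continuous_id)
  exact (ρ.continuous_normed.mul hc).integrable_of_hasCompactSupport
    ρ.hasCompactSupport_normed.mul_right

lemma IsFlow.abs_mollified_sub_le (hψ : Continuous ψ) {S : Set (ℝ × Phase)} (hS : IsCompact S)
    {δ : ℝ} (hδ : 0 < δ) : ∃ r > 0, ∀ ρ : ContDiffBump (0 : ℝ × Phase), ρ.rOut < r → ∀ p ∈ S,
      |mollified Z t₁ ψ ρ p - transported Z t₁ ψ p| ≤ δ := by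
  have hc := hZ.continuous_transported (t₁ := t₁) hψ
  have := hS.uniformContinuousAt_of_continuousAt (transported Z t₁ ψ)
    (fun a _ => hc.continuousAt) (Metric.dist_mem_uniformity hδ)
  obtain ⟨r, hr, hrS⟩ := Metric.mem_uniformity_dist.1 this
  refine ⟨r, hr, fun ρ hρ p hp => ?_⟩
  rw [← Real.dist_eq]
  refine ρ.dist_normed_convolution_le hc.aestronglyMeasurable fun x hx => ?_
  have h1 : dist p x < r := by
    rw [dist_comm]; exact (Metric.mem_ball.1 hx).trans hρ
  have h2 : dist (transported Z t₁ ψ p) (transported Z t₁ ψ x) < δ := hrS h1 hp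
  rw [dist_comm]
  exact h2.le

/-- No commutator estimate is needed. The transported function is constant along trajectories and
Lipschitz in space. A step along `(1, b p)` from any point near `p` misses its own trajectory by at
most a small multiple of the step (`IsFlow.exists_norm_sub_le`). Averaging these increments bounds
the difference quotient, hence the derivative. -/
lemma IsFlow.abs_fderiv_mollified_le {Lψ : ℝ≥0} (hψ : LipschitzWith Lψ ψ) {S : Set (ℝ × Phase)}
    (hS : IsCompact S) {δ : ℝ} (hδ : 0 < δ) : ∃ r > 0, ∀ ρ : ContDiffBump (0 : ℝ × Phase),
      ρ.rOut < r → ∀ p ∈ S, |fderiv ℝ (mollified Z t₁ ψ ρ) p (1, b p.1 p.2)| ≤ δ := by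
  obtain ⟨R, hR⟩ := (hS.image (f := fun p : ℝ × Phase => |t₁ - p.1|) (by fun_prop)).bddAbove
  have hR' : ∀ p ∈ S, |t₁ - p.1| ≤ R := fun p hp => hR ⟨p, hp, rfl⟩
  set Λ : ℝ := Lψ * Real.exp (L * (R + 2)) with hΛ
  have hΛ0 : 0 ≤ Λ := by positivity
  obtain ⟨r, hr, hrS⟩ := hZ.exists_norm_sub_le hS (δ := δ / (Λ + 1)) (by positivity)
  refine ⟨min r 1, by positivity, fun ρ hρ p hp => ?_⟩
  have hρr := hρ.trans_le (min_le_left _ _)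
  have hρ1 := hρ.trans_le (min_le_right _ _)
  set c : ℝ × Phase := (1, b p.1 p.2) with hc
  have hd : HasDerivAt (fun h : ℝ => mollified Z t₁ ψ ρ (p + h • c))
      (fderiv ℝ (mollified Z t₁ ψ ρ) p c) 0 := by
    have h1 := ((hZ.contDiff_mollified (t₁ := t₁) hψ.continuous ρ).differentiable (by simp)
      (p + (0 : ℝ) • c)).hasFDerivAt
    have h2 : HasDerivAt (fun h : ℝ => p + h • c) c 0 := by
      simpa using ((hasDerivAt_id' (0 : ℝ)).smul_const c).const_add p
    have := h1.comp_hasDerivAt (0 : ℝ) h2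
    simpa using! this
  rw [← Real.norm_eq_abs]
  refine hd.le_of_lip' hδ.le ?_
  have hev : ∀ᶠ h : ℝ in 𝓝 0, |h| < min r 1 := by
    have : Tendsto (fun h : ℝ => |h|) (𝓝 0) (𝓝 |0|) := continuous_abs.tendsto 0
    rw [abs_zero] at this
    exact this.eventually_lt_const (by positivity)
  filter_upwards [hev] with h hh
  have hhr := hh.trans_le (min_le_left _ _)
  have hh1 := hh.trans_le (min_le_right _ _)
  rw [zero_smul, add_zero, mollified_apply, mollified_apply,
    ← integral_sub (hZ.integrable_mollified hψ.continuous ρ _)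
      (hZ.integrable_mollified hψ.continuous ρ _), sub_zero, Real.norm_eq_abs h]
  have e : ∫ q, ρ.normed volume q * (δ * |h|) = δ * |h| := by
    rw [integral_mul_const, ρ.integral_normed, one_mul]
  rw [← e]
  refine norm_integral_le_of_norm_le (ρ.integrable_normed.mul_const _)
    (Eventually.of_forall fun q => ?_)
  rw [← mul_sub, norm_mul, Real.norm_of_nonneg (ρ.nonneg_normed q)]
  by_cases hq : q ∈ Metric.ball (0 : ℝ × Phase) ρ.rOut
  swap
  · rw [← ρ.support_normed_eq (μ := volume)] at hq
    simp [Function.notMem_support.1 hq]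
  refine mul_le_mul_of_nonneg_left ?_ (ρ.nonneg_normed q)
  have hqn : ‖q‖ < ρ.rOut := mem_ball_zero_iff.1 hq
  have hdist : dist (p - q) p < r := by
    rw [dist_eq_norm, sub_sub_cancel_left, norm_neg]
    exact hqn.trans hρr
  have key := hrS p hp (p - q) hdist h hhr
  set y := p - q with hy
  have e1 : p + h • c - q = (y.1 + h, y.2 + h • b p.1 p.2) := by
    ext1
    · simp [hy, hc]; ring
    · simp only [hy, hc, Prod.snd_sub, Prod.snd_add, Prod.smul_snd]; abel
  have e2 : transported Z t₁ ψ y = transported Z t₁ ψ (y.1 + h, Z y.1 (y.1 + h) y.2) := by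
    rw [hZ.transported_flow]
  rw [e1, e2, Real.norm_eq_abs]
  have hq1 : |q.1| ≤ 1 := (norm_fst_le q).trans (hqn.le.trans hρ1.le)
  have hRt : |t₁ - (y.1 + h)| ≤ R + 2 := by
    have : t₁ - (y.1 + h) = (t₁ - p.1) + q.1 - h := by simp [hy]; ring
    rw [this]
    have := hR' p hp
    have h3 := abs_sub (t₁ - p.1 + q.1) h
    have h4 := abs_add_le (t₁ - p.1) q.1
    linarith
  refine (hZ.abs_transported_sub_le hψ hRt _ _).trans ?_
  rw [← hΛ]
  have hn : ‖y.2 + h • b p.1 p.2 - Z y.1 (y.1 + h) y.2‖ ≤ δ / (Λ + 1) * |h| := by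
    rw [← norm_neg]
    refine (le_of_eq ?_).trans key
    congr 1; abel
  calc Λ * _ ≤ Λ * (δ / (Λ + 1) * |h|) := by gcongr
    _ = Λ / (Λ + 1) * (δ * |h|) := by ring
    _ ≤ 1 * (δ * |h|) := by
        gcongr
        rw [div_le_one (by positivity)]; linarith
    _ = δ * |h| := one_mul _

/-- Smooth compactly supported test functions that approximately solve the localized transport
equation. -/
lemma IsFlow.exists_test {Lψ : ℝ≥0} (hψ : LipschitzWith Lψ ψ) (hψc : HasCompactSupport ψ)
    {χ : ℝ → ℝ} (hχ : ContDiff ℝ ∞ χ) (hχc : HasCompactSupport χ) {δ : ℝ} (hδ : 0 < δ) :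
    ∃ φ : ℝ × Phase → ℝ, ContDiff ℝ ∞ φ ∧ HasCompactSupport φ ∧ (∀ p, φ p ≠ 0 → p.1 ∈ tsupport χ) ∧
      ∀ p, |fderiv ℝ φ p (1, b p.1 p.2) - deriv χ p.1 * transported Z t₁ ψ p| ≤ δ := by
  obtain ⟨C, hC⟩ := hχc.exists_bound_of_continuous hχ.continuous
  have hχ' : Continuous (deriv χ) := hχ.continuous_deriv (by simp)
  obtain ⟨C', hC'⟩ := hχc.deriv.exists_bound_of_continuous hχ'
  have hC0 : 0 ≤ C := (norm_nonneg _).trans (hC 0)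
  have hC0' : 0 ≤ C' := (norm_nonneg _).trans (hC' 0)
  -- The mollifier has radius at most one, so enlarging the time set and the tube by one captures
  -- every point where the mollified or transported function can be nonzero over the support of `χ`.
  set I : Set ℝ := Metric.cthickening 1 (tsupport χ) with hI
  have hIc : IsCompact I := hχc.isCompact.cthickening
  set S : Set (ℝ × Phase) := tube Z t₁ ψ I + Metric.closedBall 0 1 with hS
  have hSc : IsCompact S := (hZ.isCompact_tube hψc hIc).add (isCompact_closedBall _ _)
  obtain ⟨r₁, hr₁, h₁⟩ := hZ.abs_mollified_sub_le (t₁ := t₁) hψ.continuous hSc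
    (δ := δ / (C + C' + 1)) (by positivity)
  obtain ⟨r₂, hr₂, h₂⟩ := hZ.abs_fderiv_mollified_le (t₁ := t₁) hψ hSc
    (δ := δ / (C + C' + 1)) (by positivity)
  set r := min 1 (min r₁ r₂) / 2 with hr
  have hr0 : 0 < r := by positivity
  have hm : r < min 1 (min r₁ r₂) := half_lt_self (by positivity)
  let ρ : ContDiffBump (0 : ℝ × Phase) := ⟨r / 2, r, half_pos hr0, half_lt_self hr0⟩
  have hρ : ρ.rOut < min 1 (min r₁ r₂) := hm
  have k₁ := h₁ ρ (hρ.trans_le ((min_le_right _ _).trans (min_le_left _ _)))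
  have k₂ := h₂ ρ (hρ.trans_le ((min_le_right _ _).trans (min_le_right _ _)))
  have hρ1 : ρ.rOut ≤ 1 := (hρ.trans_le (min_le_left _ _)).le
  set Φ := mollified Z t₁ ψ ρ with hΦ
  have hΦs : ContDiff ℝ ∞ Φ := hZ.contDiff_mollified hψ.continuous ρ
  have hzero : ∀ p : ℝ × Phase, p.1 ∈ tsupport χ → p ∉ S →
      Φ p = 0 ∧ transported Z t₁ ψ p = 0 := by
    intro p hp hpS
    have hy : ∀ q ∈ Metric.closedBall (0 : ℝ × Phase) 1, transported Z t₁ ψ (p - q) = 0 := by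
      intro q hq
      by_contra hc
      refine hpS ⟨p - q, hZ.mem_tube ?_ hc, q, hq, sub_add_cancel p q⟩
      refine Metric.mem_cthickening_of_dist_le _ p.1 _ _ hp ?_
      rw [Prod.fst_sub, dist_eq_norm, sub_sub_cancel_left, norm_neg]
      exact (norm_fst_le q).trans (mem_closedBall_zero_iff.1 hq)
    constructor
    · rw [hΦ, mollified_apply, ← integral_zero (ℝ × Phase) ℝ]
      refine integral_congr_ae (Eventually.of_forall fun q => ?_)
      simp only
      by_cases hq : q ∈ Metric.ball (0 : ℝ × Phase) ρ.rOut
      · rw [hy q (Metric.closedBall_subset_closedBall hρ1 (Metric.ball_subset_closedBall hq)),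
          mul_zero]
      · rw [← ρ.support_normed_eq (μ := volume)] at hq
        rw [Function.notMem_support.1 hq, zero_mul]
    · simpa using hy 0 (by simp)
  set φ : ℝ × Phase → ℝ := fun p => χ p.1 * Φ p with hφ
  have hφ0 : ∀ p ∉ S, φ p = 0 := fun p hp => by
    by_cases h : p.1 ∈ tsupport χ
    · simp [hφ, (hzero p h hp).1]
    · simp [hφ, image_eq_zero_of_notMem_tsupport h]
  have hφS : tsupport φ ⊆ S := closure_minimal (fun p hp => by
    by_contra hc
    exact hp (hφ0 p hc)) hSc.isClosed
  refine ⟨φ, (hχ.comp contDiff_fst).mul hΦs, HasCompactSupport.intro hSc hφ0,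
    fun p hp => subset_tsupport _ (left_ne_zero_of_mul hp), fun p => ?_⟩
  by_cases hpS : p ∈ S
  · have d1 : HasFDerivAt (fun p : ℝ × Phase => χ p.1)
        (deriv χ p.1 • ContinuousLinearMap.fst ℝ ℝ Phase) p :=
      ((hχ.differentiable (by simp) p.1).hasDerivAt).comp_hasFDerivAt p hasFDerivAt_fst
    have d2 := (hΦs.differentiable (by simp) p).hasFDerivAt
    have d : HasFDerivAt φ _ p := d1.mul d2
    rw [d.fderiv]
    simp only [add_apply, smul_apply, ContinuousLinearMap.coe_fst', smul_eq_mul, mul_one]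
    have e : χ p.1 * fderiv ℝ Φ p (1, b p.1 p.2) + Φ p * deriv χ p.1
        - deriv χ p.1 * transported Z t₁ ψ p = χ p.1 * fderiv ℝ Φ p (1, b p.1 p.2)
          + deriv χ p.1 * (Φ p - transported Z t₁ ψ p) := by ring
    rw [e]
    calc _ ≤ |χ p.1| * |fderiv ℝ Φ p (1, b p.1 p.2)|
          + |deriv χ p.1| * |Φ p - transported Z t₁ ψ p| := by
          refine (abs_add_le _ _).trans_eq ?_
          rw [abs_mul, abs_mul]
      _ ≤ C * (δ / (C + C' + 1)) + C' * (δ / (C + C' + 1)) := by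
          gcongr
          · exact hC _
          · exact k₂ p hpS
          · exact hC' _
          · exact k₁ p hpS
      _ = (C + C') / (C + C' + 1) * δ := by ring
      _ ≤ 1 * δ := by
          gcongr
          rw [div_le_one (by positivity)]; linarith
      _ = δ := one_mul δ
  · have : fderiv ℝ φ p = 0 := fderiv_of_notMem_tsupport ℝ fun h => hpS (hφS h)
    rw [this]
    have h0 : deriv χ p.1 * transported Z t₁ ψ p = 0 := by
      by_cases h : p.1 ∈ tsupport χ
      · rw [(hzero p h hpS).2, mul_zero]
      · rw [image_eq_zero_of_notMem_tsupport fun hc => h (tsupport_deriv_subset hc), zero_mul]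
    rw [h0]
    simp [hδ.le]

/-- Weak solutions of the continuity equation are transported by the flow. -/
theorem IsFlow.eq_map {T : ℝ} {f : ℝ → Measure Phase} (hf : IsW2Curve T f) {c d : ℝ}
    (hcd : Ioo c d ⊆ Ioo 0 T)
    (hweak : ∀ φ : ℝ × Phase → ℝ, ContDiff ℝ ∞ φ → HasCompactSupport φ →
      tsupport φ ⊆ Ioo c d ×ˢ (univ : Set Phase) →
      ∫ t in Ioo 0 T, (∫ z, fderiv ℝ φ (t, z) (1, b t z) ∂(f t)) = 0)
    {t₀ t₁ : ℝ} (h₀ : t₀ ∈ Ioo c d) (h₁ : t₁ ∈ Ioo c d) :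
    f t₁ = (f t₀).map (Z t₀ t₁) := by
  have hT : (0 : ℝ) < T := (hcd h₀).1.trans (hcd h₀).2
  have hIcc : ∀ t ∈ Ioo c d, t ∈ Icc 0 T := fun t ht => Ioo_subset_Icc_self (hcd ht)
  have hZc : Continuous (Z t₀ t₁) :=
    hZ.continuous.comp (f := fun z => (t₀, t₁, z)) (by fun_prop)
  have := hf.prob t₀ (hIcc _ h₀)
  have := hf.prob t₁ (hIcc _ h₁)
  have := Measure.isProbabilityMeasure_map (μ := f t₀) hZc.measurable.aemeasurable
  refine ext_of_forall_lipschitz_hasCompactSupport fun ψ ⟨Lψ, hψ⟩ hψc => ?_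
  rw [integral_map hZc.measurable.aemeasurable hψ.continuous.aestronglyMeasurable]
  -- The backward transport equation is dual to the continuity equation, so `F` should be constant;
  -- its values at `t₁` and `t₀` are the two integrals to be compared.
  set F : ℝ → ℝ := fun t => ∫ z, transported Z t₁ ψ (t, z) ∂(f t) with hF
  have hF₁ : F t₁ = ∫ z, ψ z ∂(f t₁) := by simp [hF, transported, hZ.self]
  have hF₀ : F t₀ = ∫ z, ψ (Z t₀ t₁ z) ∂(f t₀) := rfl
  rw [← hF₁, ← hF₀]
  have hcont : ∀ ξ : ℝ → ℝ, Continuous ξ → HasCompactSupport ξ →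
      ContinuousOn (fun t => ∫ z, ξ t * transported Z t₁ ψ (t, z) ∂(f t)) (Icc 0 T) :=
    fun ξ hξ hξc => hf.continuousOn_integral (Φ := fun p => ξ p.1 * transported Z t₁ ψ p)
      ((hξ.comp continuous_fst).mul (hZ.continuous_transported hψ.continuous))
      (hZ.hasCompactSupport_mul_transported hψc hξc)
  refine eq_of_forall_integral_deriv_mul_eq_zero (J := Ioo 0 T) hcd ?_ ?_ h₁ h₀
  -- The transported function need not have compact support in time; a cutoff equal to one on `[0,
  -- T]` supplies it without changing `F` there.
  · let B : ContDiffBump (0 : ℝ) := ⟨T, T + 1, hT, by linarith⟩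
    refine ((hcont B B.continuous B.hasCompactSupport).mono
      (Ioo_subset_Icc_self.trans' hcd)).congr fun t ht => ?_
    have : B t = 1 := B.one_of_mem_closedBall (by
      rw [mem_closedBall_zero_iff, Real.norm_of_nonneg (hIcc t ht).1]
      exact (hIcc t ht).2)
    simp [hF, this]
  · intro χ hχ hχc hχs
    have hgoal : ∀ t, deriv χ t * F t = ∫ z, deriv χ t * transported Z t₁ ψ (t, z) ∂(f t) :=
      fun t => (integral_const_mul _ _).symm
    simp only [hgoal]
    rw [← abs_nonpos_iff]
    refine le_of_forall_pos_le_add fun ε hε => ?_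
    obtain ⟨φ, hφs, hφc, hφχ, hφ⟩ := hZ.exists_test (t₁ := t₁) hψ hψc hχ hχc (δ := ε / T)
      (by positivity)
    have hsupp : tsupport φ ⊆ Ioo c d ×ˢ (univ : Set Phase) := by
      have : tsupport φ ⊆ Prod.fst ⁻¹' tsupport χ :=
        closure_minimal hφχ ((isClosed_tsupport χ).preimage continuous_fst)
      exact fun p hp => ⟨hχs (this hp), mem_univ _⟩
    have h0 := hweak φ hφs hφc hsupp
    set A : ℝ × Phase → ℝ := fun p => fderiv ℝ φ p (1, b p.1 p.2) with hA
    have hAc : Continuous A :=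
      (hφs.continuous_fderiv (by simp)).clm_apply (continuous_const.prodMk hZ.continuous_field)
    have hAs : HasCompactSupport A := hφc.fderiv ℝ |>.mono' fun p hp => by
      refine subset_tsupport _ fun hc => hp ?_
      simp [hA, hc]
    have hχ' : Continuous (deriv χ) := hχ.continuous_deriv (by simp)
    have c1 := hf.continuousOn_integral hAc hAs
    have c2 := hcont (deriv χ) hχ' hχc.deriv
    have i1 : IntegrableOn (fun t => ∫ z, A (t, z) ∂(f t)) (Ioo 0 T) :=
      (c1.integrableOn_compact isCompact_Icc).mono_set Ioo_subset_Icc_self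
    have i2 : IntegrableOn (fun t => ∫ z, deriv χ t * transported Z t₁ ψ (t, z) ∂(f t)) (Ioo 0 T) :=
      (c2.integrableOn_compact isCompact_Icc).mono_set Ioo_subset_Icc_self
    obtain ⟨CA, hCA⟩ := hAs.exists_bound_of_continuous hAc
    have hBc : Continuous fun p : ℝ × Phase => deriv χ p.1 * transported Z t₁ ψ p :=
      (hχ'.comp continuous_fst).mul (hZ.continuous_transported hψ.continuous)
    obtain ⟨CB, hCB⟩ := (hZ.hasCompactSupport_mul_transported (t₁ := t₁) hψc
      hχc.deriv).exists_bound_of_continuous hBc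
    have hb : ∀ t ∈ Ioo 0 T, ‖(∫ z, A (t, z) ∂(f t))
        - ∫ z, deriv χ t * transported Z t₁ ψ (t, z) ∂(f t)‖ ≤ ε / T := by
      intro t ht
      have := hf.prob t (Ioo_subset_Icc_self ht)
      rw [← integral_sub]
      · have := norm_integral_le_of_norm_le_const (μ := f t) (C := ε / T)
          (f := fun z => A (t, z) - deriv χ t * transported Z t₁ ψ (t, z))
          (Eventually.of_forall fun z => hφ (t, z))
        simpa using this
      · exact Integrable.of_bound (hAc.comp (Continuous.prodMk_right t)).aestronglyMeasurable CA
          (Eventually.of_forall fun z => hCA _)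
      · exact Integrable.of_bound (hBc.comp (Continuous.prodMk_right t)).aestronglyMeasurable CB
          (Eventually.of_forall fun z => hCB (t, z))
    have := norm_setIntegral_le_of_norm_le_const (μ := volume) (s := Ioo 0 T) (by simp) hb
    rw [integral_sub i1 i2] at this
    have h0' : ∫ t in Ioo 0 T, (∫ z, A (t, z) ∂(f t)) = 0 := h0
    rw [h0', zero_sub, norm_neg, Real.norm_eq_abs, Real.volume_real_Ioo_of_le hT.le, sub_zero,
      div_mul_cancel₀ _ hT.ne'] at this
    linarith

end Transport

/-! ### Growth along coupled characteristics, uniformly in the relaxation rate. -/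

section Growth

variable {Ω : Type*} [MeasurableSpace Ω] {γ : Measure Ω}

lemma l2norm_const_smul (c : ℝ) (h : Ω → E3) :
    l2norm γ (fun o => c • h o) = |c| * l2norm γ h := by
  unfold l2norm
  simp only [norm_smul, mul_pow]
  rw [integral_const_mul, Real.sqrt_mul (sq_nonneg _), Real.sqrt_sq (norm_nonneg _),
    Real.norm_eq_abs]

/-- Minkowski's integral inequality for time integrals of square integrable fields. -/
lemma l2norm_intervalIntegral_le [IsProbabilityMeasure γ] {w : ℝ → Ω → E3}
    (hw : Measurable fun p : ℝ × Ω => w p.1 p.2) {s t : ℝ} (hst : s ≤ t) {G : Ω → ℝ}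
    (hG : MemLp G 2 γ) (hwG : ∀ r ∈ Icc s t, ∀ o, ‖w r o‖ ≤ G o) {h : ℝ → ℝ} (hh : Continuous h)
    (hle : ∀ᵐ r ∂volume.restrict (Ioc s t), l2norm γ (w r) ≤ h r) :
    MemLp (fun o => ∫ r in s..t, w r o) 2 γ ∧
      l2norm γ (fun o => ∫ r in s..t, w r o) ≤ ∫ r in s..t, h r := by
  set I : Ω → E3 := fun o => ∫ r in s..t, w r o with hI
  have hw' : Measurable fun p : Ω × ℝ => w p.2 p.1 := hw.comp measurable_swap
  have hIm : StronglyMeasurable I := by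
    simp only [hI, intervalIntegral.integral_of_le hst]
    exact StronglyMeasurable.integral_prod_right (f := fun o r => w r o) hw'.stronglyMeasurable
  have hIG : ∀ o, ‖I o‖ ≤ (t - s) * G o := fun o => by
    have := intervalIntegral.norm_integral_le_of_norm_le_const (a := s) (b := t)
      (f := fun r => w r o) (C := G o) fun r hr => by
        rw [uIoc_of_le hst] at hr
        exact hwG r (Ioc_subset_Icc_self hr) o
    rwa [abs_of_nonneg (sub_nonneg.2 hst), mul_comm] at this
  have hIL : MemLp I 2 γ := by
    refine (hG.const_mul (t - s)).mono hIm.aestronglyMeasurable (Eventually.of_forall fun o => ?_)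
    exact (hIG o).trans (le_abs_self _)
  refine ⟨hIL, ?_⟩
  have hwL : ∀ r ∈ Icc s t, MemLp (w r) 2 γ := fun r hr =>
    hG.mono (hw.comp (measurable_const.prodMk measurable_id)).aestronglyMeasurable
      (Eventually.of_forall fun o => (hwG r hr o).trans (le_abs_self _))
  have hint : Integrable (fun p : Ω × ℝ => (inner ℝ (I p.1) (w p.2 p.1) : ℝ))
      (γ.prod (volume.restrict (Ioc s t))) := by
    have hb : Integrable (fun o => ‖I o‖ * G o) γ := hIL.norm.integrable_mul hG
    refine (hb.comp_fst (volume.restrict (Ioc s t))).mono' ?_ ?_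
    · exact (hIm.aestronglyMeasurable.comp_fst).inner hw'.aestronglyMeasurable
    · have hmem : ∀ᵐ p ∂(γ.prod (volume.restrict (Ioc s t))), p.2 ∈ Ioc s t :=
        Measure.quasiMeasurePreserving_snd.ae (ae_restrict_mem measurableSet_Ioc)
      filter_upwards [hmem] with p hp
      exact (norm_inner_le_norm _ _).trans
        (mul_le_mul_of_nonneg_left (hwG _ (Ioc_subset_Icc_self hp) _) (norm_nonneg _))
  have hwi : ∀ o, IntervalIntegrable (fun r => w r o) volume s t := fun o => by
    rw [intervalIntegrable_iff_integrableOn_Ioc_of_le hst]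
    refine Integrable.of_bound (hw.comp (measurable_id.prodMk measurable_const)).aestronglyMeasurable
      (G o) ?_
    filter_upwards [ae_restrict_mem measurableSet_Ioc] with r hr
    exact hwG r (Ioc_subset_Icc_self hr) o
  have hsq : l2norm γ I ^ 2 = ∫ r in Ioc s t, (∫ o, inner ℝ (I o) (w r o) ∂γ) := by
    rw [l2norm_sq, ← integral_integral_swap hint]
    refine integral_congr_ae (Eventually.of_forall fun o => ?_)
    simp only
    have := (hwi o).1
    rw [integral_inner this, ← real_inner_self_eq_norm_sq]
    simp only [hI, intervalIntegral.integral_of_le hst]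
  have h0 : ∀ᵐ r ∂volume.restrict (Ioc s t), 0 ≤ h r := hle.mono fun r hr =>
    (l2norm_nonneg _).trans hr
  -- Duality: the integral `I` is tested against itself, and one factor `l2norm γ I` is cancelled
  -- afterwards.
  have hle2 : l2norm γ I ^ 2 ≤ l2norm γ I * ∫ r in s..t, h r := by
    rw [hsq, intervalIntegral.integral_of_le hst, ← integral_const_mul]
    refine integral_mono_ae hint.integral_prod_right ?_ ?_
    · exact ((hh.integrableOn_Icc).mono_set Ioc_subset_Icc_self).const_mul _
    · filter_upwards [hle, ae_restrict_mem measurableSet_Ioc] with r hr hrm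
      exact (integral_inner_le_l2norm hIL (hwL r (Ioc_subset_Icc_self hrm))).trans
        (mul_le_mul_of_nonneg_left hr (l2norm_nonneg _))
  rcases (l2norm_nonneg (γ := γ) I).eq_or_lt with h | h
  · rw [← h, intervalIntegral.integral_of_le hst]
    exact integral_nonneg_of_ae h0
  · rw [sq] at hle2
    exact le_of_mul_le_mul_left hle2 h

/-- The Duhamel kernel has mass at most one for `lam > 0` and `s ≤ t`, whatever the size of `lam`;
this makes the final constants independent of the relaxation rate. -/
lemma intervalIntegral_relax (lam s t : ℝ) :
    ∫ r in s..t, lam * Real.exp (-(lam * (t - r))) = 1 - Real.exp (-(lam * (t - s))) := by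
  have hd : ∀ r, HasDerivAt (fun r => Real.exp (-(lam * (t - r))))
      (lam * Real.exp (-(lam * (t - r)))) r := fun r => by
    have := (((hasDerivAt_id' r).const_sub t).const_mul lam).fun_neg.exp
    refine this.congr_deriv ?_
    ring
  rw [intervalIntegral.integral_eq_sub_of_hasDerivAt (fun r _ => hd r)
    (Continuous.intervalIntegrable (by fun_prop) _ _)]
  simp

variable {x v U : ℝ → Ω → E3} {lam : ℝ}

omit [MeasurableSpace Ω] in
lemma duhamel (hv : ∀ o r, HasDerivAt (fun r => v r o) (lam • (U r o - v r o)) r)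
    (hU : ∀ o, Continuous fun r => U r o) (s t : ℝ) (o : Ω) :
    v t o = Real.exp (-(lam * (t - s))) • v s o
      + ∫ r in s..t, (lam * Real.exp (-(lam * (t - r)))) • U r o := by
  have hd : ∀ r, HasDerivAt (fun r => Real.exp (-(lam * (t - r))) • v r o)
      ((lam * Real.exp (-(lam * (t - r)))) • U r o) r := fun r => by
    have h1 := (((hasDerivAt_id' r).const_sub t).const_mul lam).fun_neg.exp
    refine (h1.smul (hv o r)).congr_deriv ?_
    module
  have := hU o
  rw [intervalIntegral.integral_eq_sub_of_hasDerivAt (fun r _ => hd r)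
    (Continuous.intervalIntegrable (by fun_prop) _ _)]
  simp

/-- Growth of the distance of two coupled systems of characteristics, uniformly in the relaxation
rate `lam`. -/
theorem l2norm_add_l2norm_le_exp [IsProbabilityMeasure γ] (hlam : 0 < lam)
    (hx : ∀ o r, HasDerivAt (fun r => x r o) (v r o) r)
    (hv : ∀ o r, HasDerivAt (fun r => v r o) (lam • (U r o - v r o)) r)
    (hU : ∀ o, Continuous fun r => U r o)
    (hvm : Measurable fun p : ℝ × Ω => v p.1 p.2)
    (hUm : Measurable fun p : ℝ × Ω => U p.1 p.2) {K : ℝ} (hUK : ∀ r o, ‖U r o‖ ≤ K) {s t : ℝ}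
    (hst : s ≤ t) (hx0 : MemLp (x s) 2 γ) (hv0 : MemLp (v s) 2 γ) {θ C : ℝ} (hθ0 : 0 ≤ θ)
    (hθ : θ < 1) (hC : 0 ≤ C)
    (hest : ∀ᵐ r ∂volume.restrict (Ioc s t), MemLp (x r) 2 γ → MemLp (v r) 2 γ →
      l2norm γ (U r) ≤ θ * l2norm γ (v r) + C * l2norm γ (x r)) :
    MemLp (x t) 2 γ ∧ MemLp (v t) 2 γ ∧
      l2norm γ (x t) + l2norm γ (v t) ≤ (1 + 4 * (1 + C) / (1 - θ)) *
        (l2norm γ (x s) + l2norm γ (v s)) * Real.exp ((2 * C / (1 - θ) + 1) * (t - s)) := by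
  by_cases hΩ : Nonempty Ω
  swap
  · rw [not_nonempty_iff] at hΩ
    have h := measure_univ (μ := γ)
    rw [Measure.eq_zero_of_isEmpty γ] at h
    simp at h
  have hK0 : 0 ≤ K := (norm_nonneg _).trans (hUK s hΩ.some)
  have hvr : ∀ r, Measurable (v r) := fun r => hvm.comp (measurable_const.prodMk measurable_id)
  have hrelax : ∀ {a b : ℝ}, a ≤ b → ∀ r ∈ Icc a b, 0 ≤ lam * Real.exp (-(lam * (b - r))) :=
    fun _ r _ => by positivity
  have hexp1 : ∀ {a b : ℝ}, a ≤ b → Real.exp (-(lam * (b - a))) ≤ 1 := fun h =>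
    Real.exp_le_one_iff.2 (by nlinarith)
  have hxint : ∀ r o, x r o = x s o + ∫ τ in s..r, v τ o := fun r o => by
    have hc : Continuous fun τ => v τ o :=
      continuous_iff_continuousAt.2 fun τ => (hv o τ).continuousAt
    rw [intervalIntegral.integral_eq_sub_of_hasDerivAt (fun τ _ => hx o τ)
      (hc.intervalIntegrable _ _)]
    abel
  -- pointwise bounds
  have hvb : ∀ r ∈ Icc s t, ∀ o, ‖v r o‖ ≤ ‖v s o‖ + K := by
    intro r hr o
    rw [duhamel hv hU s r o]
    refine (norm_add_le _ _).trans (add_le_add ?_ ?_)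
    · rw [norm_smul, Real.norm_of_nonneg (Real.exp_pos _).le]
      exact mul_le_of_le_one_left (norm_nonneg _) (hexp1 hr.1)
    · have hb : ‖∫ τ in s..r, (lam * Real.exp (-(lam * (r - τ)))) • U τ o‖
          ≤ ∫ τ in s..r, lam * Real.exp (-(lam * (r - τ))) * K := by
        refine intervalIntegral.norm_integral_le_of_norm_le hr.1
          (Eventually.of_forall fun τ _ => ?_)
          (Continuous.intervalIntegrable (by fun_prop) _ _)
        rw [norm_smul, Real.norm_of_nonneg (by positivity)]
        exact mul_le_mul_of_nonneg_left (hUK _ _) (by positivity)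
      refine hb.trans ?_
      rw [intervalIntegral.integral_mul_const, intervalIntegral_relax]
      exact mul_le_of_le_one_left hK0 (by linarith [Real.exp_pos (-(lam * (r - s)))])
  have hG : MemLp (fun o => ‖v s o‖ + K) 2 γ := hv0.norm.add (memLp_const K)
  have hvL : ∀ r ∈ Icc s t, MemLp (v r) 2 γ := fun r hr =>
    hG.mono (hvr r).aestronglyMeasurable
      (Eventually.of_forall fun o => (hvb r hr o).trans (le_abs_self _))
  -- Integrating velocities over time costs `1/β` in the weighted norm. This `β` makes `C / β ≤ (1 -
  -- θ)/2`, so the position term uses only half of the gap left by `θ`; the `+ 1` keeps `β ≥ 1`.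
  set β : ℝ := 2 * C / (1 - θ) + 1 with hβ
  have hθ' : 0 < 1 - θ := by linarith
  have hβ1 : 1 ≤ β := by
    have : 0 ≤ 2 * C / (1 - θ) := by positivity
    linarith
  have hβ0 : 0 < β := by linarith
  -- The weighted velocity norm whose supremum `M` is estimated by itself. The crude bound by `K`
  -- only ensures that `M` is finite; it does not enter the conclusion.
  set E : ℝ → ℝ := fun r => l2norm γ (v r) * Real.exp (-(β * (r - s))) with hE
  have hEbdd : BddAbove (E '' Icc s t) := by
    refine ⟨Real.sqrt (∫ o, (‖v s o‖ + K) ^ 2 ∂γ), ?_⟩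
    rintro _ ⟨r, hr, rfl⟩
    have h1 : l2norm γ (v r) ≤ Real.sqrt (∫ o, (‖v s o‖ + K) ^ 2 ∂γ) := by
      refine (l2norm_le_of_norm_le (Real.sqrt_nonneg _) hG (hvr r).aestronglyMeasurable
        (hvb r hr) ?_).2
      rw [Real.sq_sqrt (integral_nonneg fun _ => sq_nonneg _)]
    have h2 : Real.exp (-(β * (r - s))) ≤ 1 :=
      Real.exp_le_one_iff.2 (by nlinarith [hr.1])
    exact (mul_le_of_le_one_right (l2norm_nonneg _) h2).trans h1
  set M : ℝ := sSup (E '' Icc s t) with hM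
  have hexpinv : ∀ r, Real.exp (-(β * (r - s))) * Real.exp (β * (r - s)) = 1 := fun r => by
    rw [← Real.exp_add]; simp
  have hvM : ∀ r ∈ Icc s t, l2norm γ (v r) ≤ M * Real.exp (β * (r - s)) := fun r hr => by
    have h1 : E r ≤ M := le_csSup hEbdd ⟨r, hr, rfl⟩
    calc l2norm γ (v r) = E r * Real.exp (β * (r - s)) := by
          rw [hE]; simp only; rw [mul_assoc, hexpinv, mul_one]
      _ ≤ _ := by gcongr
  have hM0 : 0 ≤ M := by
    have h1 : E s ≤ M := le_csSup hEbdd ⟨s, left_mem_Icc.2 hst, rfl⟩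
    exact (mul_nonneg (l2norm_nonneg _) (Real.exp_pos _).le).trans h1
  set D₀ := l2norm γ (x s) with hD₀
  set E₀ := l2norm γ (v s) with hE₀
  have hD0 : 0 ≤ D₀ := l2norm_nonneg _
  have hE0 : 0 ≤ E₀ := l2norm_nonneg _
  have hone : ∀ r ∈ Icc s t, 1 ≤ Real.exp (β * (r - s)) := fun r hr =>
    Real.one_le_exp (by nlinarith [hr.1])
  -- positions
  have hxM : ∀ r ∈ Icc s t, MemLp (x r) 2 γ ∧
      l2norm γ (x r) ≤ (D₀ + M / β) * Real.exp (β * (r - s)) := by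
    intro r hr
    have hsub : Icc s r ⊆ Icc s t := Icc_subset_Icc_right hr.2
    obtain ⟨m1, m2⟩ := l2norm_intervalIntegral_le (γ := γ) (w := v) hvm hr.1 hG
      (fun τ hτ => hvb τ (hsub hτ)) (h := fun τ => M * Real.exp (β * (τ - s))) (by fun_prop)
      (by
        filter_upwards [ae_restrict_mem measurableSet_Ioc] with τ hτ
        exact hvM τ (hsub (Ioc_subset_Icc_self hτ)))
    have hxe : x r = fun o => x s o + ∫ τ in s..r, v τ o := funext (hxint r)
    rw [hxe]
    refine ⟨hx0.add m1, (l2norm_add_le hx0 m1).trans ?_⟩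
    have hi : ∫ τ in s..r, M * Real.exp (β * (τ - s))
        = M / β * (Real.exp (β * (r - s)) - 1) := by
      have hd : ∀ τ, HasDerivAt (fun τ => M / β * Real.exp (β * (τ - s)))
          (M * Real.exp (β * (τ - s))) τ := fun τ => by
        have := ((((hasDerivAt_id' τ).sub_const s).const_mul β).exp).const_mul (M / β)
        refine this.congr_deriv ?_
        field_simp
      rw [intervalIntegral.integral_eq_sub_of_hasDerivAt (fun τ _ => hd τ)
        (Continuous.intervalIntegrable (by fun_prop) _ _)]
      simp
      ring
    rw [hi] at m2
    have h1 := hone r hr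
    have h2 : 0 ≤ M / β := by positivity
    calc _ ≤ D₀ + M / β * (Real.exp (β * (r - s)) - 1) := by gcongr
      _ ≤ _ := by nlinarith
  -- velocities
  set A : ℝ := θ * M + C * (D₀ + M / β) with hA
  have hA0 : 0 ≤ A := by positivity
  have hvM' : ∀ r ∈ Icc s t, l2norm γ (v r) ≤ (E₀ + A) * Real.exp (β * (r - s)) := by
    intro r hr
    have hsub : Icc s r ⊆ Icc s t := Icc_subset_Icc_right hr.2
    have hest' : ∀ᵐ τ ∂volume.restrict (Ioc s r), MemLp (x τ) 2 γ → MemLp (v τ) 2 γ →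
        l2norm γ (U τ) ≤ θ * l2norm γ (v τ) + C * l2norm γ (x τ) :=
      ae_restrict_of_ae_restrict_of_subset (Ioc_subset_Ioc_right hr.2) hest
    obtain ⟨m1, m2⟩ := l2norm_intervalIntegral_le (γ := γ)
      (w := fun τ o => (lam * Real.exp (-(lam * (r - τ)))) • U τ o)
      (Measurable.smul (f := fun p : ℝ × Ω => lam * Real.exp (-(lam * (r - p.1))))
        (by fun_prop) hUm) hr.1 (G := fun _ => lam * K) (memLp_const _)
      (fun τ hτ o => by
        rw [norm_smul, Real.norm_of_nonneg (by positivity)]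
        have h1 := hUK τ o
        have h2 := hexp1 hτ.2
        have h3 : lam * Real.exp (-(lam * (r - τ))) ≤ lam := mul_le_of_le_one_right hlam.le h2
        exact mul_le_mul h3 h1 (norm_nonneg _) hlam.le)
      -- The exponential weight is frozen at the final time `r`, so that the relaxation kernel alone
      -- is integrated and contributes at most one.
      (h := fun τ => lam * Real.exp (-(lam * (r - τ))) * (A * Real.exp (β * (r - s))))
      (by fun_prop) (by
        filter_upwards [hest', ae_restrict_mem measurableSet_Ioc] with τ hτ hm
        have hτm := hsub (Ioc_subset_Icc_self hm)
        have h1 := hτ (hxM τ hτm).1 (hvL τ hτm)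
        have h2 : l2norm γ (U τ) ≤ A * Real.exp (β * (r - s)) := by
          calc _ ≤ θ * (M * Real.exp (β * (τ - s)))
                + C * ((D₀ + M / β) * Real.exp (β * (τ - s))) := by
                refine h1.trans ?_
                gcongr
                · exact hvM τ hτm
                · exact (hxM τ hτm).2
            _ = A * Real.exp (β * (τ - s)) := by rw [hA]; ring
            _ ≤ _ := by
                gcongr
                exact hm.2
        have h3 : l2norm γ (fun o => (lam * Real.exp (-(lam * (r - τ)))) • U τ o)
            = lam * Real.exp (-(lam * (r - τ))) * l2norm γ (U τ) := by
          rw [l2norm_const_smul, abs_of_nonneg (by positivity)]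
        rw [h3]
        gcongr)
    have hve : v r = fun o => Real.exp (-(lam * (r - s))) • v s o
        + ∫ τ in s..r, (lam * Real.exp (-(lam * (r - τ)))) • U τ o := funext (duhamel hv hU s r)
    have hL0 : MemLp (fun o => Real.exp (-(lam * (r - s))) • v s o) 2 γ := hv0.const_smul (Real.exp (-(lam * (r - s))))
    rw [hve]
    refine (l2norm_add_le hL0 m1).trans ?_
    rw [intervalIntegral.integral_mul_const, intervalIntegral_relax] at m2
    have h1 := hone r hr
    have h2 : l2norm γ (fun o => Real.exp (-(lam * (r - s))) • v s o) ≤ E₀ := by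
      rw [l2norm_const_smul, abs_of_nonneg (Real.exp_pos _).le]
      exact mul_le_of_le_one_left hE0 (hexp1 hr.1)
    have h3 : (1 - Real.exp (-(lam * (r - s)))) * (A * Real.exp (β * (r - s)))
        ≤ A * Real.exp (β * (r - s)) :=
      mul_le_of_le_one_left (by positivity) (by linarith [Real.exp_pos (-(lam * (r - s)))])
    calc _ ≤ E₀ + A * Real.exp (β * (r - s)) := add_le_add h2 (m2.trans h3)
      _ ≤ _ := by nlinarith
  have hMle : M ≤ E₀ + A := by
    refine csSup_le ⟨_, s, left_mem_Icc.2 hst, rfl⟩ ?_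
    rintro _ ⟨r, hr, rfl⟩
    calc E r ≤ (E₀ + A) * Real.exp (β * (r - s)) * Real.exp (-(β * (r - s))) := by
          rw [hE]; simp only; gcongr; exact hvM' r hr
      _ = E₀ + A := by rw [mul_assoc, mul_comm (Real.exp _), hexpinv, mul_one]
  have hCβ : C / β ≤ (1 - θ) / 2 := by
    rw [div_le_iff₀ hβ0, hβ]
    have : (1 - θ) / 2 * (2 * C / (1 - θ) + 1) = C + (1 - θ) / 2 := by field_simp
    rw [this]; linarith
  have hMfin : M ≤ 2 / (1 - θ) * (E₀ + C * D₀) := by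
    have h1 : A = θ * M + C * D₀ + C / β * M := by rw [hA]; ring
    have h2 : C / β * M ≤ (1 - θ) / 2 * M := by gcongr
    -- From `M ≤ E₀ + θ M + C D₀ + (1 - θ)/2 * M`, where the strict inequality `θ < 1` permits
    -- absorption.
    have h3 : (1 - θ) / 2 * M ≤ E₀ + C * D₀ := by linarith
    rw [div_mul_eq_mul_div, le_div_iff₀ hθ']
    linarith
  have htI : t ∈ Icc s t := right_mem_Icc.2 hst
  refine ⟨(hxM t htI).1, hvL t htI, ?_⟩
  have hMβ : M / β ≤ M := div_le_self hM0 hβ1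
  calc l2norm γ (x t) + l2norm γ (v t)
      ≤ (D₀ + M / β) * Real.exp (β * (t - s)) + M * Real.exp (β * (t - s)) :=
        add_le_add (hxM t htI).2 (hvM t htI)
    _ = (D₀ + M / β + M) * Real.exp (β * (t - s)) := by ring
    _ ≤ _ := by
        gcongr
        have h1 : D₀ + M / β + M ≤ D₀ + 2 * (2 / (1 - θ) * (E₀ + C * D₀)) := by linarith
        refine h1.trans ?_
        have h2 : 0 ≤ 1 / (1 - θ) := by positivity
        have h3 : (1 + 4 * (1 + C) / (1 - θ)) * (D₀ + E₀)
            - (D₀ + 2 * (2 / (1 - θ) * (E₀ + C * D₀)))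
            = E₀ + 4 * (1 / (1 - θ)) * (D₀ + C * E₀) := by ring
        have h4 : 0 ≤ E₀ + 4 * (1 / (1 - θ)) * (D₀ + C * E₀) := by positivity
        linarith

end Growth

/-! ### Comparison of plan costs with L² norms. -/

section Costs

variable {Ω Ω' : Type*} [MeasurableSpace Ω] [MeasurableSpace Ω'] {γ : Measure Ω}

lemma ofReal_l2norm {h : Ω → E3} (hh : MemLp h 2 γ) :
    ENNReal.ofReal (l2norm γ h) = (∫⁻ o, ‖h o‖ₑ ^ 2 ∂γ) ^ (1 / 2 : ℝ) := by
  rw [l2norm, Real.sqrt_eq_rpow, ← ENNReal.ofReal_rpow_of_nonneg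
    (integral_nonneg fun _ => sq_nonneg _) (by norm_num),
    ofReal_integral_eq_lintegral_ofReal (hh.integrable_norm_pow (by norm_num))
      (Eventually.of_forall fun _ => sq_nonneg _)]
  congr 1
  refine lintegral_congr fun o => ?_
  rw [ENNReal.ofReal_pow (norm_nonneg _), ofReal_norm]

lemma memLp_two_of_lintegral_lt_top {h : Ω → E3} (hm : AEStronglyMeasurable h γ)
    (hh : ∫⁻ o, ‖h o‖ₑ ^ 2 ∂γ < ⊤) : MemLp h 2 γ := by
  refine ⟨hm, ?_⟩
  rw [eLpNorm_lt_top_iff_lintegral_rpow_enorm_lt_top (by norm_num) (by norm_num)]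
  simpa using hh

lemma l2norm_map {X : Ω → Ω'} (hX : Measurable X) {h : Ω' → E3} (hh : Measurable h) :
    l2norm (γ.map X) h = l2norm γ (fun o => h (X o)) := by
  rw [l2norm, l2norm, integral_map hX.aemeasurable]
  exact (hh.norm.pow_const 2).aestronglyMeasurable

lemma measurable_position_sub : Measurable fun o : Phase × Phase => o.1.1 - o.2.1 := by fun_prop

lemma measurable_velocity_sub : Measurable fun o : Phase × Phase => o.1.2 - o.2.2 := by fun_prop

lemma planCost_eq_enorm (γ : Measure (Phase × Phase)) :
    planCost γ = (∫⁻ o, ‖o.1.1 - o.2.1‖ₑ ^ 2 ∂γ + ∫⁻ o, ‖o.1.2 - o.2.2‖ₑ ^ 2 ∂γ)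
      ^ (1 / 2 : ℝ) := by
  rw [planCost_eq, ← lintegral_add_left (measurable_position_sub.enorm.pow_const 2)]
  simp only [edist_eq_enorm_sub]

lemma memLp_of_planCost_lt_top {γ : Measure (Phase × Phase)} (h : planCost γ < ⊤) :
    (MemLp (fun o : Phase × Phase => o.1.1 - o.2.1) 2 γ ∧
      ENNReal.ofReal (l2norm γ (fun o : Phase × Phase => o.1.1 - o.2.1)) ≤ planCost γ) ∧
    MemLp (fun o : Phase × Phase => o.1.2 - o.2.2) 2 γ ∧
      ENNReal.ofReal (l2norm γ (fun o : Phase × Phase => o.1.2 - o.2.2)) ≤ planCost γ := by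
  have h' := h
  rw [planCost_eq_enorm] at h'
  have hs := (ENNReal.rpow_lt_top_iff_of_pos (by norm_num)).1 h'
  obtain ⟨h1, h2⟩ := ENNReal.add_lt_top.1 hs
  have m1 := memLp_two_of_lintegral_lt_top measurable_position_sub.aestronglyMeasurable h1
  have m2 := memLp_two_of_lintegral_lt_top measurable_velocity_sub.aestronglyMeasurable h2
  refine ⟨⟨m1, ?_⟩, m2, ?_⟩
  · rw [ofReal_l2norm m1, planCost_eq_enorm]
    gcongr
    exact le_self_add
  · rw [ofReal_l2norm m2, planCost_eq_enorm]
    gcongr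
    exact le_add_self

lemma planCost_le_ofReal_l2norm {γ : Measure (Phase × Phase)} [IsProbabilityMeasure γ]
    (hx : MemLp (fun o : Phase × Phase => o.1.1 - o.2.1) 2 γ)
    (hv : MemLp (fun o : Phase × Phase => o.1.2 - o.2.2) 2 γ) :
    planCost γ ≤ ENNReal.ofReal (l2norm γ (fun o : Phase × Phase => o.1.1 - o.2.1)
      + l2norm γ (fun o : Phase × Phase => o.1.2 - o.2.2)) := by
  rw [ENNReal.ofReal_add (l2norm_nonneg _) (l2norm_nonneg _), ofReal_l2norm hx, ofReal_l2norm hv,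
    planCost_eq_enorm]
  exact ENNReal.rpow_add_le_add_rpow _ _ (by norm_num) (by norm_num)

end Costs

/-! ### Solutions in the interior of the time interval as transported measures. -/

section Solutions

variable {g : E3} {lam T K : ℝ} {f0 : Measure Phase} {f : ℝ → Measure Phase} {u : ℝ → E3 → E3}

lemma le_of_ae_le_of_continuousOn {U : Set ℝ} (hU : IsOpen U) {F : ℝ → ℝ} (hF : ContinuousOn F U)
    {c : ℝ} (h : ∀ᵐ t ∂volume.restrict U, F t ≤ c) : ∀ t ∈ U, F t ≤ c := by
  have : EqOn (fun t => max (F t) c) (fun _ => c) U := by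
    refine Measure.eqOn_open_of_ae_eq (μ := volume) ?_ hU
      (hF.sup continuousOn_const) continuousOn_const
    filter_upwards [h] with t ht
    exact max_eq_right ht
  exact fun t ht => max_eq_right_iff.1 (this ht)

lemma IsSolution.isW2Curve (h : IsSolution g lam T K f0 f u) : IsW2Curve T f :=
  ⟨h.prob, h.continuous_f⟩

lemma IsSolution.continuous_velocity (h : IsSolution g lam T K f0 f u) {t : ℝ}
    (ht : t ∈ Ioo 0 T) : Continuous (u t) := by
  have : ContinuousOn (fun x : E3 => u t x) univ :=
    h.continuous_u.comp (f := fun x : E3 => (t, x)) (by fun_prop) fun x _ => ⟨ht, mem_univ _⟩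
  exact continuousOn_univ.1 this

lemma IsSolution.continuousOn_time (h : IsSolution g lam T K f0 f u) (x : E3) :
    ContinuousOn (fun t => u t x) (Ioo 0 T) :=
  h.continuous_u.comp (f := fun t : ℝ => (t, x)) (by fun_prop) fun t ht => ⟨ht, mem_univ _⟩

/-- The bounds are assumed for almost every time only; continuity of `u` in time at fixed points
extends them to every interior time. -/
lemma IsSolution.exists_bound (h : IsSolution g lam T K f0 f u) :
    ∃ B : ℝ≥0, ∀ t ∈ Ioo 0 T, (∀ x, ‖u t x‖ ≤ B) ∧ ∀ x y, ‖u t x - u t y‖ ≤ B * ‖x - y‖ := by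
  obtain ⟨B, hB⟩ := h.bounded_u
  have key : ∀ᵐ t ∂volume.restrict (Ioo 0 T),
      (∀ x, ‖u t x‖ ≤ B) ∧ ∀ x y, ‖u t x - u t y‖ ≤ B * ‖x - y‖ := by
    filter_upwards [hB, ae_restrict_mem measurableSet_Ioo] with t ht htm
    exact norm_le_and_lipschitz_of_W1inftyNorm_le (h.continuous_velocity htm) ht
  refine ⟨B, fun t ht => ⟨fun x => ?_, fun x y => ?_⟩⟩
  · exact le_of_ae_le_of_continuousOn isOpen_Ioo (h.continuousOn_time x).norm
      (key.mono fun t ht => ht.1 x) t ht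
  · exact le_of_ae_le_of_continuousOn isOpen_Ioo
      ((h.continuousOn_time x).sub (h.continuousOn_time y)).norm
      (key.mono fun t ht => ht.2 x y) t ht

/-- On compact time intervals a solution is transported by a globally defined flow. -/
theorem IsSolution.exists_flow (h : IsSolution g lam T K f0 f u) (hlam : 0 < lam) {c d : ℝ}
    (hc : 0 < c) (hcd : c < d) (hd : d < T) :
    ∃ (B : ℝ≥0) (w : ℝ → E3 → E3) (L : ℝ≥0) (Z : ℝ → ℝ → Phase → Phase),
      IsRegularVelocity B w ∧ (∀ t ∈ Icc c d, w t = u t) ∧ IsFlow (drift g lam w) L Z ∧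
      ∀ s ∈ Ioo c d, ∀ t ∈ Ioo c d, f t = (f s).map (Z s t) := by
  obtain ⟨B, hB⟩ := h.exists_bound
  -- Clamping time to `[c, d]` gives a field defined for all times that agrees with `u` where it
  -- matters.
  set k : ℝ → ℝ := fun t => max c (min d t) with hk
  have hkc : Continuous k := by fun_prop
  have hkm : ∀ t, k t ∈ Ioo 0 T := fun t =>
    ⟨hc.trans_le (le_max_left c _), max_lt (hcd.trans hd) ((min_le_left d t).trans_lt hd)⟩
  have hkeq : ∀ t ∈ Icc c d, k t = t := fun t ht => by
    simp only [hk]; rw [min_eq_right ht.2, max_eq_right ht.1]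
  set w : ℝ → E3 → E3 := fun t => u (k t) with hw
  have hweq : ∀ t ∈ Icc c d, w t = u t := fun t ht => by rw [hw]; simp only; rw [hkeq t ht]
  have hwr : IsRegularVelocity B w := by
    refine ⟨?_, fun t x => (hB _ (hkm t)).1 x, fun t => ?_⟩
    · exact h.continuous_u.comp_continuous (f := fun p : ℝ × E3 => (k p.1, p.2))
        ((hkc.comp continuous_fst).prodMk continuous_snd) fun p => ⟨hkm _, mem_univ _⟩
    · refine LipschitzWith.of_dist_le_mul fun x y => ?_
      rw [dist_eq_norm, dist_eq_norm]
      exact (hB _ (hkm t)).2 x y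
  obtain ⟨Z, hZ⟩ := hwr.exists_flow (g := g) hlam
  have hsub : Ioo c d ⊆ Ioo 0 T := Ioo_subset_Ioo hc.le hd.le
  refine ⟨B, w, _, Z, hwr, hweq, hZ, fun s hs t ht => ?_⟩
  refine hZ.eq_map h.isW2Curve hsub (fun φ hφ hφc hφs => ?_) hs ht
  refine Eq.trans ?_ (h.vlasov φ hφ hφc (hφs.trans (prod_mono hsub Subset.rfl)))
  refine setIntegral_congr_fun measurableSet_Ioo fun r _ => ?_
  refine integral_congr_ae (Eventually.of_forall fun z => ?_)
  -- Outside `(c, d)` the modified field differs from `u`, but there the derivative of the test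
  -- function vanishes.
  by_cases hr : r ∈ Ioo c d
  · simp only [drift]
    rw [hweq r (Ioo_subset_Icc_self hr)]
  · have : fderiv ℝ φ (r, z) = 0 := fderiv_of_notMem_tsupport ℝ fun hm => hr (hφs hm).1
    simp only [this, zero_apply]

lemma IsSolution.integrable_snd (h : IsSolution g lam T K f0 f u) (hK : 1 ≤ K) {t : ℝ}
    (ht : t ∈ Ioo 0 T) : Integrable (Prod.snd : Phase → E3) (f t) := by
  have := h.prob t (Ioo_subset_Icc_self ht)
  obtain ⟨B, hB⟩ := h.moment_f
  have := memLp_snd_of_moment (by linarith) ((hB t ht).trans_lt ENNReal.coe_lt_top)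
  exact this.integrable (by simpa using hK)

end Solutions

/-! ### The Wasserstein estimate. -/

/-- Stability in the interior of the time interval. -/
theorem exists_W2_growth_bound {q : ℝ≥0∞} (hq : 4 < q) (M : ℝ≥0) :
    ∃ C β : ℝ, 1 ≤ C ∧ 0 ≤ β ∧
      ∀ (g : E3) (K lam T : ℝ) (_ : 1 ≤ K) (_ : 0 < lam) (f0₁ f0₂ : Measure Phase)
        (f₁ f₂ : ℝ → Measure Phase) (u₁ u₂ : ℝ → E3 → E3)
        (_ : IsSolution g lam T K f0₁ f₁ u₁) (_ : IsSolution g lam T K f0₂ f₂ u₂)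
        (_ : ∀ t ∈ Ioo 0 T, eLpNorm (spatialDensity (f₁ t)) q volume ≤ M ∧
          eLpNorm (spatialDensity (f₂ t)) q volume ≤ M ∧ W1inftyNorm (u₂ t) ≤ M ∧
          moment 9 (f₂ t) ≤ M) (s t : ℝ) (_ : 0 < s) (_ : s ≤ t) (_ : t < T),
        W2 (f₁ t) (f₂ t) ≤ ENNReal.ofReal (C * Real.exp (β * (t - s))) * W2 (f₁ s) (f₂ s) := by
  obtain ⟨θ, C, hθ0, hθ, hC, H⟩ := exists_velocity_difference_bound hq M
  have hθ' : 0 < 1 - θ := by linarith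
  set C' : ℝ := 1 + 4 * (1 + C) / (1 - θ) with hC'
  set β : ℝ := 2 * C / (1 - θ) + 1 with hβ
  have hC'1 : 1 ≤ C' := by
    have : 0 ≤ 4 * (1 + C) / (1 - θ) := by positivity
    linarith
  have hβ0 : 0 ≤ β := by positivity
  -- The factor `2` arises because position and velocity differences are each bounded by the full
  -- plan cost.
  refine ⟨2 * C', β, by linarith, hβ0, ?_⟩
  intro g K lam T hK hlam f0₁ f0₂ f₁ f₂ u₁ u₂ h₁ h₂ hb s t hs hst ht
  -- The margins put `s` and `t` in the open interval on which the flow represents the solutions.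
  set c : ℝ := s / 2 with hc
  set d : ℝ := (t + T) / 2 with hd
  obtain ⟨B₁, w₁, L₁, Z₁, hw₁, e₁, hZ₁, m₁⟩ :=
    h₁.exists_flow hlam (c := c) (d := d) (by linarith) (by linarith) (by linarith)
  obtain ⟨B₂, w₂, L₂, Z₂, hw₂, e₂, hZ₂, m₂⟩ :=
    h₂.exists_flow hlam (c := c) (d := d) (by linarith) (by linarith) (by linarith)
  have hmem : ∀ r ∈ Icc s t, r ∈ Ioo c d := fun r hr =>
    ⟨by linarith [hr.1], by linarith [hr.2]⟩
  have hmemT : ∀ r ∈ Icc s t, r ∈ Ioo 0 T := fun r hr => ⟨hs.trans_le hr.1, hr.2.trans_lt ht⟩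
  have hsI : s ∈ Icc s t := left_mem_Icc.2 hst
  have htI : t ∈ Icc s t := right_mem_Icc.2 hst
  have := h₁.prob s (Ioo_subset_Icc_self (hmemT s hsI))
  set e : ℝ := Real.exp (β * (t - s)) with he
  have hcpos : 0 < 2 * C' * e := by positivity
  -- Plans of finite cost suffice: their costs approximate `W2` from above, and an infinite distance
  -- leaves nothing to prove.
  suffices key : ∀ γ, IsTransportPlan (f₁ s) (f₂ s) γ → planCost γ < ⊤ →
      W2 (f₁ t) (f₂ t) ≤ ENNReal.ofReal (2 * C' * e) * planCost γ by
    have h0 : ENNReal.ofReal (2 * C' * e) ≠ 0 := by simpa using hcpos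
    rw [mul_comm, ← ENNReal.div_le_iff h0 ENNReal.ofReal_ne_top]
    refine le_of_forall_gt fun b hb => ?_
    obtain ⟨γ, hγ, hγb⟩ := exists_planCost_lt hb
    exact (ENNReal.div_le_of_le_mul' (key γ hγ (hγb.trans_le le_top))).trans_lt hγb
  intro γ hγ hγtop
  have hγp := hγ.isProbabilityMeasure
  obtain ⟨⟨hx0, hx0c⟩, hv0, hv0c⟩ := memLp_of_planCost_lt_top hγtop
  have cont₁ : Continuous fun p : ℝ × Phase × Phase => Z₁ s p.1 p.2.1 := by
    have := hZ₁.continuous.comp (f := fun p : ℝ × Phase × Phase => (s, p.1, p.2.1)) (by fun_prop)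
    simpa only [Function.comp_def] using this
  have cont₂ : Continuous fun p : ℝ × Phase × Phase => Z₂ s p.1 p.2.2 := by
    have := hZ₂.continuous.comp (f := fun p : ℝ × Phase × Phase => (s, p.1, p.2.2)) (by fun_prop)
    simpa only [Function.comp_def] using this
  set Y : ℝ → Phase × Phase → Phase × Phase := fun r o => (Z₁ s r o.1, Z₂ s r o.2) with hY
  have hYc : Continuous fun p : ℝ × Phase × Phase => Y p.1 p.2 := cont₁.prodMk cont₂
  have hYm : ∀ r, Measurable (Y r) := fun r =>
    (hYc.comp (f := fun o : Phase × Phase => (r, o)) (by fun_prop)).measurable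
  have hYs : Y s = id := by
    funext o
    simp only [hY, hZ₁.self, hZ₂.self, id]
  have hplan : ∀ r ∈ Icc s t, IsTransportPlan (f₁ r) (f₂ r) (γ.map (Y r)) := by
    intro r hr
    have hZ₁m : Measurable (Z₁ s r) :=
      (hZ₁.continuous.comp (f := fun z => (s, r, z)) (by fun_prop)).measurable
    have hZ₂m : Measurable (Z₂ s r) :=
      (hZ₂.continuous.comp (f := fun z => (s, r, z)) (by fun_prop)).measurable
    constructor
    · rw [m₁ s (hmem s hsI) r (hmem r hr), ← hγ.1, Measure.map_map measurable_fst (hYm r),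
        Measure.map_map hZ₁m measurable_fst]
      rfl
    · rw [m₂ s (hmem s hsI) r (hmem r hr), ← hγ.2, Measure.map_map measurable_snd (hYm r),
        Measure.map_map hZ₂m measurable_snd]
      rfl
  set x : ℝ → Phase × Phase → E3 := fun r o => (Y r o).1.1 - (Y r o).2.1 with hx
  set v : ℝ → Phase × Phase → E3 := fun r o => (Y r o).1.2 - (Y r o).2.2 with hv
  set U : ℝ → Phase × Phase → E3 := fun r o => w₁ r (Y r o).1.1 - w₂ r (Y r o).2.1 with hU
  have hY₁ : Continuous fun p : ℝ × Phase × Phase => (Y p.1 p.2).1.1 :=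
    continuous_fst.comp (continuous_fst.comp hYc)
  have hY₂ : Continuous fun p : ℝ × Phase × Phase => (Y p.1 p.2).2.1 :=
    continuous_fst.comp (continuous_snd.comp hYc)
  have hUc : Continuous fun p : ℝ × Phase × Phase => U p.1 p.2 :=
    (hw₁.continuous.comp (f := fun p : ℝ × Phase × Phase => (p.1, (Y p.1 p.2).1.1))
      (continuous_fst.prodMk hY₁)).sub
      (hw₂.continuous.comp (f := fun p : ℝ × Phase × Phase => (p.1, (Y p.1 p.2).2.1))
      (continuous_fst.prodMk hY₂))
  have hvc : Continuous fun p : ℝ × Phase × Phase => v p.1 p.2 :=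
    (continuous_snd.comp (continuous_fst.comp hYc)).sub
      (continuous_snd.comp (continuous_snd.comp hYc))
  have hdx : ∀ o r, HasDerivAt (fun r => x r o) (v r o) r := fun o r =>
    ((hasFDerivAt_fst.comp_hasDerivAt r (hZ₁.hasDerivAt s o.1 r)).fun_sub
      (hasFDerivAt_fst.comp_hasDerivAt r (hZ₂.hasDerivAt s o.2 r)))
  have hdv : ∀ o r, HasDerivAt (fun r => v r o) (lam • (U r o - v r o)) r := fun o r => by
    refine ((hasFDerivAt_snd.comp_hasDerivAt r (hZ₁.hasDerivAt s o.1 r)).fun_sub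
      (hasFDerivAt_snd.comp_hasDerivAt r (hZ₂.hasDerivAt s o.2 r))).congr_deriv ?_
    simp only [drift, hU, hv, hY, ContinuousLinearMap.coe_snd']
    module
  have hmap : ∀ r (k : Phase × Phase → E3), Measurable k →
      (MemLp k 2 (γ.map (Y r)) ↔ MemLp (fun o => k (Y r o)) 2 γ) := fun r k hk =>
    memLp_map_measure_iff hk.aestronglyMeasurable (hYm r).aemeasurable
  have hsub : Ioc s t ⊆ Ioo 0 T := fun r hr => hmemT r (Ioc_subset_Icc_self hr)
  obtain ⟨A₁, hA₁⟩ := h₁.bounded_f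
  obtain ⟨A₂, hA₂⟩ := h₂.bounded_f
  have hest : ∀ᵐ r ∂volume.restrict (Ioc s t), MemLp (x r) 2 γ → MemLp (v r) 2 γ →
      l2norm γ (U r) ≤ θ * l2norm γ (v r) + C * l2norm γ (x r) := by
    -- At almost every time the density bound and the fluid equation hold for both solutions, so the
    -- fixed-time estimate applies to the transported plan. The density bounds enter only through
    -- absolute continuity, so their size is irrelevant to the constants.
    filter_upwards [ae_restrict_mem measurableSet_Ioc,
      ae_restrict_of_ae_restrict_of_subset hsub hA₁, ae_restrict_of_ae_restrict_of_subset hsub hA₂,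
      ae_restrict_of_ae_restrict_of_subset hsub h₁.brinkman,
      ae_restrict_of_ae_restrict_of_subset hsub h₂.brinkman] with r hr a₁ a₂ b₁ b₂ hxL hvL
    have hrI := Ioc_subset_Icc_self hr
    have hrT := hmemT r hrI
    have hrc : r ∈ Icc c d := Ioo_subset_Icc_self (hmem r hrI)
    obtain ⟨ρ₁, ρ₂, hW, hm⟩ := hb r hrT
    rw [← e₁ r hrc] at b₁
    rw [← e₂ r hrc] at b₂ hW
    have hle : ∀ {A : ℝ≥0} {μ : Measure Phase}, A ≤ max A₁ A₂ → HasDensityLE A μ →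
        HasDensityLE (max A₁ A₂) μ := fun hA hμ => hμ.trans fun S => by
      simp only [Measure.smul_apply]
      gcongr
    have hc₁ : Continuous (w₁ r) := (hw₁.lipschitz r).continuous
    have hc₂ : Continuous (w₂ r) := (hw₂.lipschitz r).continuous
    have := (H (f₁ r) (f₂ r) (h₁.prob r (Ioo_subset_Icc_self hrT))
      (h₂.prob r (Ioo_subset_Icc_self hrT)) (w₁ r) (w₂ r) hc₁ hc₂ B₁ (hw₁.bound r) b₁ b₂
      (max A₁ A₂) (hle (le_max_left _ _) a₁) (hle (le_max_right _ _) a₂) ρ₁ ρ₂ hW hm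
      (h₁.integrable_snd hK hrT) (γ.map (Y r)) (hplan r hrI)
      ((hmap r _ measurable_position_sub).2 hxL) ((hmap r _ measurable_velocity_sub).2 hvL)).2
    rwa [l2norm_map (hYm r) measurable_position_sub, l2norm_map (hYm r) measurable_velocity_sub,
      l2norm_map (hYm r) (h := fun o : Phase × Phase => w₁ r o.1.1 - w₂ r o.2.1)
        ((hc₁.comp (continuous_fst.comp continuous_fst)).sub
          (hc₂.comp (continuous_fst.comp continuous_snd))).measurable] at this
  have hxs : x s = fun o => o.1.1 - o.2.1 := by rw [hx]; simp only [hYs, id]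
  have hvs : v s = fun o => o.1.2 - o.2.2 := by rw [hv]; simp only [hYs, id]
  obtain ⟨mx, mv, hfin⟩ := l2norm_add_l2norm_le_exp (γ := γ) (x := x) (v := v) (U := U) hlam hdx
    hdv (fun o => hUc.comp (f := fun r : ℝ => (r, o)) (by fun_prop)) hvc.measurable
    hUc.measurable (K := B₁ + B₂)
    (fun r o => (norm_sub_le _ _).trans (add_le_add (hw₁.bound _ _) (hw₂.bound _ _))) hst
    (by rw [hxs]; exact hx0) (by rw [hvs]; exact hv0) hθ0 hθ hC hest
  have := Measure.isProbabilityMeasure_map (μ := γ) (hYm t).aemeasurable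
  refine (W2_le_planCost (hplan t htI)).trans ?_
  refine (planCost_le_ofReal_l2norm ((hmap t _ measurable_position_sub).2 mx)
    ((hmap t _ measurable_velocity_sub).2 mv)).trans ?_
  rw [l2norm_map (hYm t) measurable_position_sub, l2norm_map (hYm t) measurable_velocity_sub]
  refine (ENNReal.ofReal_le_ofReal hfin).trans ?_
  rw [hxs, hvs]
  set X₀ := l2norm γ (fun o : Phase × Phase => o.1.1 - o.2.1)
  set V₀ := l2norm γ (fun o : Phase × Phase => o.1.2 - o.2.2)
  calc ENNReal.ofReal (C' * (X₀ + V₀) * e)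
      = ENNReal.ofReal (C' * e) * (ENNReal.ofReal X₀ + ENNReal.ofReal V₀) := by
        rw [← ENNReal.ofReal_add (l2norm_nonneg _) (l2norm_nonneg _),
          ← ENNReal.ofReal_mul (by positivity)]
        congr 1; ring
    _ ≤ ENNReal.ofReal (C' * e) * (planCost γ + planCost γ) := by gcongr
    _ = ENNReal.ofReal (2 * C' * e) * planCost γ := by
        rw [mul_assoc 2, ENNReal.ofReal_mul zero_le_two, ENNReal.ofReal_ofNat]
        ring

/-- Two `W2`-continuous curves with an interior growth bound satisfy it from the initial time. -/
lemma W2_le_of_forall_interior {T : ℝ} (hT : 0 < T) {f₁ f₂ : ℝ → Measure Phase}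
    (h₁ : IsW2Curve T f₁) (h₂ : IsW2Curve T f₂) {C β : ℝ} (hC : 1 ≤ C) (hβ : 0 ≤ β)
    (h : ∀ s t, 0 < s → s ≤ t → t < T →
      W2 (f₁ t) (f₂ t) ≤ ENNReal.ofReal (C * Real.exp (β * (t - s))) * W2 (f₁ s) (f₂ s))
    {t : ℝ} (ht : t ∈ Icc 0 T) :
    W2 (f₁ t) (f₂ t) ≤ ENNReal.ofReal (C * Real.exp (β * t)) * W2 (f₁ 0) (f₂ 0) := by
  have h0 : (0 : ℝ) ∈ Icc 0 T := ⟨le_rfl, hT.le⟩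
  rcases ht.1.eq_or_lt with rfl | ht0
  · have : (1 : ℝ≥0∞) ≤ ENNReal.ofReal (C * Real.exp (β * 0)) := by simpa using hC
    exact le_mul_of_one_le_left' this
  have tri : ∀ a ∈ Icc 0 T, ∀ b ∈ Icc 0 T, W2 (f₁ a) (f₂ a)
      ≤ W2 (f₁ b) (f₁ a) + W2 (f₁ b) (f₂ b) + W2 (f₂ b) (f₂ a) := by
    intro a ha b hb
    have := h₁.prob a ha
    have := h₁.prob b hb
    have := h₂.prob b hb
    calc W2 (f₁ a) (f₂ a) ≤ W2 (f₁ a) (f₁ b) + W2 (f₁ b) (f₂ a) := W2_triangle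
      _ ≤ W2 (f₁ a) (f₁ b) + (W2 (f₁ b) (f₂ b) + W2 (f₂ b) (f₂ a)) := by gcongr; exact W2_triangle
      _ = _ := by rw [W2_comm (f₁ a), add_assoc]
  -- Same inequality as `tri` with the arguments oriented to fit the continuity assumption at time
  -- `0`.
  have tri' : ∀ a ∈ Icc 0 T, ∀ b ∈ Icc 0 T, W2 (f₁ a) (f₂ a)
      ≤ W2 (f₁ a) (f₁ b) + W2 (f₁ b) (f₂ b) + W2 (f₂ a) (f₂ b) := by
    intro a ha b hb
    have := tri a ha b hb
    rwa [W2_comm (f₁ b) (f₁ a), W2_comm (f₂ b) (f₂ a)] at this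
  set R : ℝ≥0∞ := ENNReal.ofReal (C * Real.exp (β * t)) with hR
  -- the parameters `δ` and `t - δ` are interior times approaching the endpoints
  have hpos : ∀ᶠ δ in 𝓝[>] (0 : ℝ), δ ∈ Ioo 0 (t / 2) :=
    Ioo_mem_nhdsGT (by linarith)
  have l0 : Tendsto (fun δ : ℝ => δ) (𝓝[>] 0) (𝓝[Icc 0 T] 0) := by
    refine tendsto_nhdsWithin_iff.2 ⟨tendsto_nhdsWithin_of_tendsto_nhds tendsto_id, ?_⟩
    filter_upwards [hpos] with δ hδ
    exact ⟨hδ.1.le, by linarith [hδ.2, ht.2, hδ.1]⟩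
  have lt : Tendsto (fun δ : ℝ => t - δ) (𝓝[>] 0) (𝓝[Icc 0 T] t) := by
    refine tendsto_nhdsWithin_iff.2 ⟨tendsto_nhdsWithin_of_tendsto_nhds ?_, ?_⟩
    · have : Tendsto (fun δ : ℝ => t - δ) (𝓝 0) (𝓝 (t - 0)) :=
        tendsto_const_nhds.sub tendsto_id
      simpa using this
    · filter_upwards [hpos] with δ hδ
      exact ⟨by linarith [hδ.2, hδ.1], by linarith [ht.2, hδ.1]⟩
  have a₁ := (h₁.continuous 0 h0).comp l0
  have a₂ := (h₂.continuous 0 h0).comp l0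
  have b₁ := (h₁.continuous t ht).comp lt
  have b₂ := (h₂.continuous t ht).comp lt
  have lim : Tendsto (fun δ : ℝ => W2 (f₁ (t - δ)) (f₁ t)
      + R * (W2 (f₁ δ) (f₁ 0) + W2 (f₁ 0) (f₂ 0) + W2 (f₂ δ) (f₂ 0)) + W2 (f₂ (t - δ)) (f₂ t))
      (𝓝[>] 0) (𝓝 (0 + R * (0 + W2 (f₁ 0) (f₂ 0) + 0) + 0)) := by
    refine (b₁.add (ENNReal.Tendsto.const_mul ((a₁.add tendsto_const_nhds).add a₂)
      (Or.inr ENNReal.ofReal_ne_top))).add b₂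
  simp only [zero_add, add_zero] at lim
  refine ge_of_tendsto lim ?_
  filter_upwards [hpos] with δ hδ
  have hδm : δ ∈ Icc 0 T := ⟨hδ.1.le, by linarith [hδ.2, ht.2, hδ.1]⟩
  have htm : t - δ ∈ Icc 0 T := ⟨by linarith [hδ.2, hδ.1], by linarith [ht.2, hδ.1]⟩
  refine (tri t ht _ htm).trans ?_
  gcongr
  refine (h δ (t - δ) hδ.1 (by linarith [hδ.2]) (by linarith [ht.2, hδ.1])).trans ?_
  refine mul_le_mul' (ENNReal.ofReal_le_ofReal ?_) (tri' δ hδm 0 h0)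
  have : β * (t - δ - δ) ≤ β * t := by nlinarith [hδ.1]
  gcongr

end VlasovStokes

end

theorem corollary5p2 (q : ℝ≥0∞) (hq : 4 < q) (M : ℝ≥0) :
    ∃ C : ℝ, 0 < C ∧
      ∀ (g : VlasovStokes.E3) (_ : ‖g‖ = 1) (K lam T : ℝ) (_ : 9 < K) (_ : 0 < lam) (_ : 0 < T)
        (f0₁ f0₂ : Measure VlasovStokes.Phase)
        (_ : IsProbabilityMeasure f0₁) (_ : IsProbabilityMeasure f0₂)
        (_ : ∃ A : ℝ≥0, VlasovStokes.HasDensityLE A f0₁)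
        (_ : ∃ A : ℝ≥0, VlasovStokes.HasDensityLE A f0₂)
        (_ : VlasovStokes.moment K f0₁ < ⊤) (_ : VlasovStokes.moment K f0₂ < ⊤)
        (f₁ f₂ : ℝ → Measure VlasovStokes.Phase) (u₁ u₂ : ℝ → VlasovStokes.E3 → VlasovStokes.E3)
        (_ : VlasovStokes.IsSolution g lam T K f0₁ f₁ u₁)
        (_ : VlasovStokes.IsSolution g lam T K f0₂ f₂ u₂)
        (_ : (⨆ t ∈ Ioo 0 T,
            (eLpNorm (VlasovStokes.spatialDensity (f₁ t)) q volume
              + eLpNorm (VlasovStokes.spatialDensity (f₂ t)) q volume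
              + VlasovStokes.W1inftyNorm (u₂ t)
              + VlasovStokes.moment 9 (f₂ t))) ≤ M),
        ∀ t ∈ Icc 0 T,
          VlasovStokes.W2 (f₁ t) (f₂ t)
            ≤ ENNReal.ofReal C * VlasovStokes.W2 f0₁ f0₂ * ENNReal.ofReal (Real.exp (C * t)) := by
  obtain ⟨C, β, hC, hβ, H⟩ := VlasovStokes.exists_W2_growth_bound hq M
  have hmax : 0 < max C β := lt_max_of_lt_left (by linarith)
  -- One constant serves both as prefactor and as exponential rate.
  refine ⟨max C β, hmax, ?_⟩
  intro g _ K lam T hK hlam hT f0₁ f0₂ _ _ _ _ _ _ f₁ f₂ u₁ u₂ h₁ h₂ hb t ht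
  have hb' : ∀ r ∈ Ioo 0 T, eLpNorm (VlasovStokes.spatialDensity (f₁ r)) q volume ≤ M ∧
      eLpNorm (VlasovStokes.spatialDensity (f₂ r)) q volume ≤ M ∧
      VlasovStokes.W1inftyNorm (u₂ r) ≤ M ∧ VlasovStokes.moment 9 (f₂ r) ≤ M := by
    intro r hr
    have h := (iSup₂_le_iff.1 hb) r hr
    have h3 := le_self_add.trans h
    have h2 := le_self_add.trans h3
    exact ⟨le_self_add.trans h2, le_add_self.trans h2, le_add_self.trans h3, le_add_self.trans h⟩
  have key := VlasovStokes.W2_le_of_forall_interior hT h₁.isW2Curve h₂.isW2Curve hC hβ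
    (H g K lam T (by linarith) hlam f0₁ f0₂ f₁ f₂ u₁ u₂ h₁ h₂ hb') ht
  rw [h₁.initial, h₂.initial] at key
  refine key.trans ?_
  rw [mul_right_comm, ← ENNReal.ofReal_mul hmax.le]
  have ht0 := ht.1
  have h1 := le_max_left C β
  have h2 := le_max_right C β
  gcongr
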